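/- Let $f:\mathbb R\to\mathbb R$ satisfy $f(x)=0$ for $x<0$, be bounded on every bounded set, and have, as $X\to+\infty$, an asymptotic expansion (in the sense of Poincaré) $$f(X)\sim \frac{e^{\beta_f\sqrt X}}{X^{\alpha_f}}\sum_{n\ge 0}\frac{\gamma_n(f)}{X^{n/2}},\qquad \beta_f>0,\ \gamma_0(f)>0,\ \alpha_f,\gamma_n(f)\in\mathbb R .$$ For $a>0$ and $b,X\in\mathbb R$ put $$S_f(a,b;X)=\sum_{\substack{n\ge 1\\ an^2+bn\le X}}(-1)^{n-1}f\left(X-(an^2+bn)\right),$$ and let $\Delta_u^J$ be the $J$-th iterate of the forward difference $\Delta_uF(u)=F(u+1)-F(u)$. Let $J\in\{0,1,2\}$, $a>0$ and $\mu\in\mathbb R\setminus\{0\}$ be given. Let $X\to+\infty$ and let $b\ge 0$ vary arbitrarily with $X$ (with no restriction on its size), subject to $-\mu J\ne 2b$ and, if $J=2$, to $\sqrt X\,|2b+\mu J|\to\infty$ (which holds, for instance, if $b$ is fixed, or if $|2b+\mu J|$ stays bounded away from $0$). Then $$\frac{\Delta_u^J\big|_{u=0}S_f(a,b+u\mu;X+b)}{X^{-J/2}(\mu\beta_f/2)^Jf(X)}\sim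 e^{\alpha}\,\partial_\alpha^J\left\{\frac{1}{1+e^{\alpha}}\right\}\bigg|_{\alpha=\frac{(2b+\mu J)\beta_f}{4\sqrt X}} .$$ -/

import Mathlib

open Filter Asymptotics

/-- `f` has, as `X → +∞`, the (Poincaré) asymptotic expansion
`f(X) ∼ e^{β √X} X^{-κ} ∑_{n ≥ 0} γ n X^{-n/2}`: for every `N`, truncating the series after `N` terms
leaves an error of the order of the first omitted power. -/
def HasSqrtExpExpansion (f : ℝ → ℝ) (β κ : ℝ) (γ : ℕ → ℝ) : Prop :=
  ∀ N : ℕ,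
    (fun X : ℝ => f X - Real.exp (β * √X) / X ^ κ *
        ∑ n ∈ Finset.range N, γ n / X ^ ((n : ℝ) / 2))
      =O[atTop] (fun X : ℝ => Real.exp (β * √X) / X ^ κ * X ^ (-((N : ℝ) / 2)))

/-- The class of functions considered: `f` has an expansion as above with `β > 0` and `γ 0 > 0`,
vanishes on the negative axis, and is bounded on bounded sets. -/
structure IsPartitionLike (f : ℝ → ℝ) (β κ : ℝ) (γ : ℕ → ℝ) : Prop where
  beta_pos : 0 < β
  gamma_zero_pos : 0 < γ 0
  expansion : HasSqrtExpExpansion f β κ γ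
  eq_zero_of_neg : ∀ x : ℝ, x < 0 → f x = 0
  locally_bounded : ∀ A : ℝ, 0 < A → ∃ C : ℝ, ∀ x : ℝ, |x| ≤ A → |f x| ≤ C

/-- The indices `n ≥ 1` with `a n² + b n ≤ X`. -/
def altSumIndices (a b X : ℝ) : Set ℕ :=
  {n : ℕ | 1 ≤ n ∧ a * (n : ℝ) ^ 2 + b * (n : ℝ) ≤ X}

/-- The index set is finite for `a > 0`, so that the sum below is a genuine finite sum. -/
theorem altSumIndices_finite {a : ℝ} (ha : 0 < a) (b X : ℝ) : (altSumIndices a b X).Finite := by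
  refine (Set.finite_Iic ⌈(|b| + |X|) / a⌉₊).subset ?_
  rintro n ⟨hn, h⟩
  have hn' : (1 : ℝ) ≤ n := by exact_mod_cast hn
  have h2 : (n : ℝ) ≤ (|b| + |X|) / a := by
    rw [le_div_iff₀ ha]
    by_contra! hlt
    nlinarith [neg_abs_le b, le_abs_self X, abs_nonneg X, abs_nonneg b]
  exact_mod_cast h2.trans (Nat.le_ceil _)

/-- `S_f(a, b; X) = ∑_{n ≥ 1, a n² + b n ≤ X} (-1)^{n-1} f(X - (a n² + b n))`. -/
noncomputable def altSum (f : ℝ → ℝ) (a b X : ℝ) : ℝ :=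
  ∑ᶠ n ∈ altSumIndices a b X, (-1 : ℝ) ^ (n - 1) * f (X - (a * (n : ℝ) ^ 2 + b * (n : ℝ)))

/-! Put T = X + b and v = b + uμ. The sum becomes S(v) = ∑ (-1)^(n-1) f(T - a n² - v n), and a unit
difference in u is a difference of step μ in v. Indices well beyond X^(3/8) are negligible, because
the quadratic term costs a factor exp(-c n²/√X). On the remaining range f may be replaced by eight
terms φ of its expansion, with total error O(X^(-2)) relative to the weight of f at X
(`exists_altSum_approx`). The parameter t = X^(1/8) makes all the exponents that occur integers.

Since φ(X - y) behaves like φ(X) exp(-βy/(2√X)), the terms are nearly geometric with ratio -q, where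
q = exp(-βb/(2√X)), and each difference brings down a factor -μ(j+1)β/(2√X). This suggests the
series ∑ (-1)^j (-(j+1))^J q^j, whose value is `fermiLim J q`. To allow arbitrary b one passes to
ultrafilters, along which q converges in [0,1].

If the limit is below 1, dominated convergence applies (`tendsto_fwdDiff_windowSum`). If it is 1,
then b = o(√X) and no geometric majorant exists. The summand is however a holomorphic function of n
that varies slowly on a scale R → ∞, so Cauchy's estimate gains a factor 1/R per difference, and
Euler's transformation leaves the Abel value of ∑ (-1)^j (j+1)^k (`tendsto_alternating_sum`). This
settles J = 0, 1.

For J = 2 that value is 0, matching the zero of `fermiLim 2` at 1, and one more order is needed. The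
alternating sum of φ(T - a n² - v n) over all integers n is tiny for v = 0 and v = μ, so S(μ) -
2S(0) + S(-μ) is O(X^(-2)) in relative size (`abs_fwdDiff_two_altDerivSum_le`). Moving the centre
from 0 to b + μ produces (b + μ) μ² S''' at an intermediate point, and S''' is governed by the Abel
value -1/8 of ∑ (-1)^j (j+1)³. This main term has relative size |b + μ| X^(-3/2); it beats the error
X^(-2) exactly when √X |b + μ| → ∞. -/

/-! ### Exponential weights and their finite sums. -/

/-- The basic scale `e^{β √x} x^{-κ}`. -/
noncomputable def expWeight (β κ x : ℝ) : ℝ := Real.exp (β * √x) * x ^ (-κ)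

/-- Finite linear combinations of `expWeight β (κ + n / 2)` with leading coefficient `g`. -/
def IsExpSum (β κ g : ℝ) (h : ℝ → ℝ) : Prop :=
  ∃ (N : ℕ) (γ : ℕ → ℝ), γ 0 = g ∧
    ∀ x, 0 < x → h x = ∑ n ∈ Finset.range (N + 1), γ n * expWeight β (κ + (n : ℝ) / 2) x

lemma expWeight_pos {β κ x : ℝ} (hx : 0 < x) : 0 < expWeight β κ x := by
  unfold expWeight; positivity

lemma expWeight_add {β κ r x : ℝ} (hx : 0 < x) :
    expWeight β (κ + r) x = x ^ (-r) * expWeight β κ x := by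
  unfold expWeight
  rw [neg_add, Real.rpow_add hx]; ring

lemma sqrt_le_tangent {X x : ℝ} (hX : 0 < X) (hx : 0 ≤ x) :
    √x ≤ √X + (x - X) / (2 * √X) := by
  have h1 : 0 < √X := Real.sqrt_pos.2 hX
  have h2 : √x * √x = x := Real.mul_self_sqrt hx
  have h3 : √X * √X = X := Real.mul_self_sqrt hX.le
  rw [← sub_nonneg]
  have : √X + (x - X) / (2 * √X) - √x = (√x - √X) ^ 2 / (2 * √X) := by
    field_simp
    nlinarith
  rw [this]; positivity

lemma rpow_le_of_comparable {X x s : ℝ} (hX : 0 < X) (h1 : X / 2 ≤ x) (h2 : x ≤ 2 * X) :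
    x ^ s ≤ 2 ^ |s| * X ^ s := by
  have hx : 0 < x := by linarith
  have : x ^ s = (x / X) ^ s * X ^ s := by
    rw [← Real.mul_rpow (by positivity) hX.le]; congr 1; field_simp
  rw [this]
  gcongr
  rcases le_total 0 s with hs | hs
  · rw [abs_of_nonneg hs]
    apply Real.rpow_le_rpow (by positivity) _ hs
    rw [div_le_iff₀ hX]; linarith
  · rw [abs_of_nonpos hs, Real.rpow_neg (by norm_num), ← Real.inv_rpow (by norm_num)]
    apply Real.rpow_le_rpow_of_nonpos (by norm_num) _ hs
    rw [le_div_iff₀ hX]; linarith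

/-- Concavity of the square root: the tangent at X bounds β√x by a linear function of slope β/(2√X),
and the power factor is comparable throughout [X/2, 2X]. -/
lemma expWeight_le {β κ X x : ℝ} (hβ : 0 < β) (hX : 0 < X) (h1 : X / 2 ≤ x) (h2 : x ≤ 2 * X) :
    expWeight β κ x ≤ 2 ^ |κ| * (expWeight β κ X * Real.exp (β / (2 * √X) * (x - X))) := by
  have hs := rpow_le_of_comparable (s := -κ) hX h1 h2
  rw [abs_neg] at hs
  unfold expWeight
  have h3 : Real.exp (β * √x) ≤ Real.exp (β * √X) * Real.exp (β / (2 * √X) * (x - X)) := by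
    rw [← Real.exp_add]
    apply Real.exp_le_exp.2
    have := mul_le_mul_of_nonneg_left (sqrt_le_tangent (x := x) hX (by linarith)) hβ.le
    calc _ ≤ _ := this
      _ = _ := by ring
  have hx : 0 < x := by linarith
  calc _ ≤ (Real.exp (β * √X) * Real.exp (β / (2 * √X) * (x - X))) * (2 ^ |κ| * X ^ (-κ)) := by
        gcongr
    _ = _ := by ring

lemma hasDerivAt_expWeight {β κ x : ℝ} (hx : 0 < x) :
    HasDerivAt (expWeight β κ)
      (β / 2 * expWeight β (κ + 1 / 2) x - κ * expWeight β (κ + 1) x) x := by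
  unfold expWeight
  have h1 : HasDerivAt (fun x => Real.exp (β * √x)) (Real.exp (β * √x) * (β * (1 / (2 * √x)))) x :=
    ((Real.hasDerivAt_sqrt hx.ne').const_mul β).exp
  have h2 : HasDerivAt (fun x : ℝ => x ^ (-κ)) (-κ * x ^ (-κ - 1)) x :=
    Real.hasDerivAt_rpow_const (Or.inl hx.ne')
  refine (h1.mul h2).congr_deriv ?_
  have h3 : x ^ (-(κ + 1 / 2)) = x ^ (-κ) / √x := by
    rw [Real.sqrt_eq_rpow, neg_add, ← sub_eq_add_neg, Real.rpow_sub hx]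
  have h4 : -(κ + 1) = -κ - 1 := by ring
  rw [h3, h4]
  field_simp
  ring

/-- Differentiating the exponential lowers the power by 1/2 and gives the factor β/2;
differentiating the power lowers it by 1, so it never touches the leading coefficient. -/
lemma IsExpSum.exists_hasDerivAt {β κ g : ℝ} {h : ℝ → ℝ} (hh : IsExpSum β κ g h) :
    ∃ h', IsExpSum β (κ + 1 / 2) (g * (β / 2)) h' ∧ ∀ x, 0 < x → HasDerivAt h (h' x) x := by
  obtain ⟨N, γ, hg, hh⟩ := hh
  refine ⟨fun x => ∑ n ∈ Finset.range (N + 1), γ n * (β / 2 * expWeight β (κ + n / 2 + 1 / 2) x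
      - (κ + n / 2) * expWeight β (κ + n / 2 + 1) x), ?_, ?_⟩
  -- The derivative of the power lies one half-power lower, so its coefficients are shifted by one
  -- index. At n = 0 only the exponential part contributes.
  · refine ⟨N + 1, fun n => (if n < N + 1 then γ n * (β / 2) else 0) -
      (if 1 ≤ n then γ (n - 1) * (κ + ((n - 1 : ℕ) : ℝ) / 2) else 0), by simp [hg], fun x hx => ?_⟩
    simp only [sub_mul, Finset.sum_sub_distrib, mul_sub]
    congr 1
    · rw [Finset.sum_range_succ _ (N + 1)]
      simp only [lt_irrefl, if_false, zero_mul, add_zero]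
      refine Finset.sum_congr rfl fun n hn => ?_
      rw [if_pos (Finset.mem_range.1 hn), add_right_comm κ]
      ring
    · rw [Finset.sum_range_succ' _ (N + 1)]
      simp only [Nat.le_add_left, if_true, Nat.add_sub_cancel, Nat.cast_add, Nat.cast_one,
        nonpos_iff_eq_zero, one_ne_zero, if_false, zero_mul, add_zero]
      refine Finset.sum_congr rfl fun n hn => ?_
      rw [show κ + 1 / 2 + ((n : ℝ) + 1) / 2 = κ + n / 2 + 1 by ring]
      ring
  · intro x hx
    have := HasDerivAt.fun_sum (u := Finset.range (N + 1)) fun n _ =>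
      (hasDerivAt_expWeight (β := β) (κ := κ + (n : ℝ) / 2) hx).const_mul (γ n)
    refine this.congr_of_eventuallyEq ?_
    filter_upwards [lt_mem_nhds hx] with y hy using hh y hy

/-- Successive derivatives of a sum of exponential weights. -/
lemma IsExpSum.exists_derivs {β κ g : ℝ} {h : ℝ → ℝ} (hh : IsExpSum β κ g h) :
    ∃ D : ℕ → ℝ → ℝ, D 0 = h ∧ (∀ j : ℕ, IsExpSum β (κ + j / 2) (g * (β / 2) ^ j) (D j)) ∧
      ∀ j x, 0 < x → HasDerivAt (D j) (D (j + 1) x) x := by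
  choose! d hd1 hd2 using
    fun (p : ℝ × ℝ) (h : ℝ → ℝ) => IsExpSum.exists_hasDerivAt (β := β) (κ := p.1) (g := p.2) (h := h)
  let D : ℕ → ℝ → ℝ := fun j => Nat.rec h (fun j r => d (κ + (j : ℝ) / 2, g * (β / 2) ^ j) r) j
  have hD : ∀ j : ℕ, IsExpSum β (κ + j / 2) (g * (β / 2) ^ j) (D j) := by
    intro j
    induction j with
    | zero => simpa [D] using hh
    | succ j ih =>
      have := hd1 (κ + (j : ℝ) / 2, g * (β / 2) ^ j) (D j) ih
      convert this using 1
      · push_cast; ring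
      · ring
  exact ⟨D, rfl, hD, fun j x hx => hd2 (κ + (j : ℝ) / 2, g * (β / 2) ^ j) (D j) (hD j) x hx⟩

/-- Holomorphic extension with the expected bound. -/
lemma IsExpSum.exists_complex {β κ g : ℝ} {h : ℝ → ℝ} (hβ : 0 < β) (hh : IsExpSum β κ g h) :
    ∃ (H : ℂ → ℂ) (C : ℝ), 0 < C ∧ DifferentiableOn ℂ H {w | 0 < w.re} ∧
      (∀ x : ℝ, 0 < x → H x = h x) ∧
      ∀ w : ℂ, 0 < w.re → 1 ≤ ‖w‖ → ‖H w‖ ≤ C * expWeight β κ ‖w‖ := by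
  obtain ⟨N, γ, hg, hh⟩ := hh
  refine ⟨fun w => ∑ n ∈ Finset.range (N + 1), (γ n : ℂ) * (Complex.exp (β * w ^ ((1 / 2 : ℝ) : ℂ)) *
      w ^ ((-(κ + n / 2) : ℝ) : ℂ)), ∑ n ∈ Finset.range (N + 1), |γ n| + 1, ?_, ?_, ?_, ?_⟩
  · have := Finset.sum_nonneg fun n (_ : n ∈ Finset.range (N + 1)) => abs_nonneg (γ n)
    linarith
  · have hs : ∀ w : ℂ, w ∈ {w : ℂ | 0 < w.re} → w ∈ Complex.slitPlane := fun w hw => Or.inl hw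
    refine DifferentiableOn.fun_sum fun n _ => ?_
    refine DifferentiableOn.const_mul (DifferentiableOn.mul ?_ ?_) _
    · refine DifferentiableOn.cexp (DifferentiableOn.const_mul ?_ _)
      exact differentiableOn_id.cpow_const hs
    · exact differentiableOn_id.cpow_const hs
  · intro x hx
    rw [hh x hx]
    push_cast
    refine Finset.sum_congr rfl fun n _ => ?_
    unfold expWeight
    push_cast
    rw [Real.sqrt_eq_rpow, Complex.ofReal_cpow hx.le, Complex.ofReal_cpow hx.le]
    push_cast
    rfl
  · intro w hw h1
    have hw0 : w ≠ 0 := by rintro rfl; simp at hw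
    have hwp : 0 < ‖w‖ := by linarith
    have hW : 0 ≤ expWeight β κ ‖w‖ := (expWeight_pos hwp).le
    refine (norm_sum_le _ _).trans ?_
    rw [add_mul, Finset.sum_mul]
    refine le_trans (Finset.sum_le_sum fun n _ => ?_) (le_add_of_nonneg_right (by simpa using hW))
    rw [norm_mul, norm_mul, Complex.norm_real, Real.norm_eq_abs]
    refine mul_le_mul_of_nonneg_left ?_ (abs_nonneg _)
    unfold expWeight
    rw [Complex.norm_cpow_real]
    refine mul_le_mul ?_ ?_ (by positivity) (by positivity)
    · rw [Complex.norm_exp]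
      apply Real.exp_le_exp.2
      rw [Complex.re_ofReal_mul]
      refine mul_le_mul_of_nonneg_left ?_ hβ.le
      refine (Complex.re_le_norm _).trans ?_
      rw [Complex.norm_cpow_real, Real.sqrt_eq_rpow]
    · apply Real.rpow_le_rpow_of_exponent_le h1
      have : (0 : ℝ) ≤ n := n.cast_nonneg
      linarith

lemma IsExpSum.exists_bound {β κ g : ℝ} {h : ℝ → ℝ} (hβ : 0 < β) (hh : IsExpSum β κ g h) :
    ∃ C : ℝ, 0 < C ∧ ∀ x, 1 ≤ x → |h x| ≤ C * expWeight β κ x := by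
  obtain ⟨H, C, hC, -, hH, hb⟩ := hh.exists_complex hβ
  refine ⟨C, hC, fun x hx => ?_⟩
  have := hb x (by simpa using by linarith) (by simp [abs_of_nonneg (by linarith : 0 ≤ x), hx])
  rwa [hH x (by linarith), Complex.norm_real, Complex.norm_real, Real.norm_eq_abs, Real.norm_eq_abs,
    abs_of_nonneg (by linarith : 0 ≤ x)] at this

/-- Here √y - √X = ((y - X)/√X) / (√(y/X) + 1) tends to t/2, while y/X → 1 makes the power factor
disappear. -/
lemma tendsto_expWeight_div {ι : Type*} {l : Filter ι} {β κ t : ℝ} {X y : ι → ℝ}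
    (hX : Tendsto X l atTop) (hy : Tendsto (fun i => (y i - X i) / √(X i)) l (nhds t)) :
    Tendsto (fun i => expWeight β κ (y i) / expWeight β κ (X i)) l
      (nhds (Real.exp (β / 2 * t))) := by
  have hs : Tendsto (fun i => √(X i)) l atTop := Real.tendsto_sqrt_atTop.comp hX
  have hinv : Tendsto (fun i => (√(X i))⁻¹) l (nhds 0) := hs.inv_tendsto_atTop
  have hr : Tendsto (fun i => y i / X i) l (nhds 1) := by
    have := (hy.mul hinv).const_add 1
    simp only [mul_zero, add_zero] at this
    refine this.congr' ?_
    filter_upwards [hX.eventually_gt_atTop 0] with i hi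
    have := Real.sqrt_pos.2 hi
    have h3 : √(X i) * √(X i) = X i := Real.mul_self_sqrt hi.le
    rw [div_mul_eq_mul_div, mul_comm, ← div_eq_inv_mul, div_div, h3]
    field_simp; ring
  have hsr : Tendsto (fun i => √(y i) / √(X i)) l (nhds 1) := by
    have := (Real.continuous_sqrt.tendsto 1).comp hr
    simp only [Real.sqrt_one] at this
    refine this.congr' ?_
    filter_upwards [hX.eventually_gt_atTop 0] with i hi
    simp [Real.sqrt_div' _ hi.le]
  have hd : Tendsto (fun i => √(y i) - √(X i)) l (nhds (t / 2)) := by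
    have := hy.div (hsr.add_const 1) (by norm_num)
    rw [show t / (1 + 1) = t / 2 by norm_num] at this
    refine this.congr' ?_
    filter_upwards [hX.eventually_gt_atTop 0, hr.eventually_const_lt one_half_lt_one] with i hi h1
    have hyi : 0 < y i := by
      by_contra! hneg
      have := div_nonpos_of_nonpos_of_nonneg hneg hi.le
      linarith
    have := Real.sqrt_pos.2 hi
    have h3 : √(X i) * √(X i) = X i := Real.mul_self_sqrt hi.le
    have h4 : √(y i) * √(y i) = y i := Real.mul_self_sqrt hyi.le
    have := Real.sqrt_pos.2 hyi
    simp only [Pi.div_apply]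
    field_simp
    nlinarith
  have h5 : Tendsto (fun i => Real.exp (β * (√(y i) - √(X i))) * (y i / X i) ^ (-κ)) l
      (nhds (Real.exp (β * (t / 2)) * 1 ^ (-κ))) :=
    ((Real.continuous_exp.tendsto _).comp (hd.const_mul β)).mul
      (hr.rpow_const (Or.inl one_ne_zero))
  rw [Real.one_rpow, mul_one, show β * (t / 2) = β / 2 * t by ring] at h5
  refine h5.congr' ?_
  filter_upwards [hX.eventually_gt_atTop 0, hr.eventually_const_lt one_half_lt_one] with i hi h1
  have hyi : 0 < y i := by
    by_contra! hneg
    have := div_nonpos_of_nonpos_of_nonneg hneg hi.le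
    linarith
  unfold expWeight
  rw [mul_sub, Real.exp_sub, Real.div_rpow hyi.le hi.le]
  have : 0 < X i ^ (-κ) := by positivity
  field_simp

lemma IsExpSum.tendsto_div_self {β κ g : ℝ} {h : ℝ → ℝ} (hh : IsExpSum β κ g h) :
    Tendsto (fun x => h x / expWeight β κ x) atTop (nhds g) := by
  obtain ⟨N, γ, hg, hh⟩ := hh
  have : Tendsto (fun x : ℝ => ∑ n ∈ Finset.range (N + 1), γ n * x ^ (-((n : ℝ) / 2))) atTop
      (nhds (∑ n ∈ Finset.range (N + 1), if n = 0 then g else 0)) := by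
    refine tendsto_finsetSum _ fun n _ => ?_
    rcases Nat.eq_zero_or_pos n with rfl | hn
    · simp [hg]
    · rw [if_neg hn.ne', ← mul_zero (γ n)]
      exact (tendsto_rpow_neg_atTop (by positivity)).const_mul _
  rw [Finset.sum_ite_eq' _ _ _, if_pos (by simp)] at this
  refine this.congr' ?_
  filter_upwards [eventually_gt_atTop 0] with x hx
  rw [hh x hx, Finset.sum_div]
  refine Finset.sum_congr rfl fun n _ => ?_
  rw [expWeight_add hx]
  have := expWeight_pos (β := β) (κ := κ) hx
  field_simp

lemma IsExpSum.tendsto_div {ι : Type*} {l : Filter ι} {β κ g t : ℝ} {h : ℝ → ℝ}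
    (hh : IsExpSum β κ g h) {X y : ι → ℝ}
    (hX : Tendsto X l atTop) (hy : Tendsto (fun i => (y i - X i) / √(X i)) l (nhds t)) :
    Tendsto (fun i => h (y i) / expWeight β κ (X i)) l (nhds (g * Real.exp (β / 2 * t))) := by
  have hs : Tendsto (fun i => √(X i)) l atTop := Real.tendsto_sqrt_atTop.comp hX
  have hy' : Tendsto y l atTop := by
    have h1 : Tendsto (fun i => √(X i) * (√(X i) + (y i - X i) / √(X i))) l atTop :=
      hs.atTop_mul_atTop₀ (hs.atTop_add hy)
    refine h1.congr' ?_
    filter_upwards [hX.eventually_gt_atTop 0] with i hi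
    have := Real.sqrt_pos.2 hi
    have h3 : √(X i) * √(X i) = X i := Real.mul_self_sqrt hi.le
    field_simp
    nlinarith
  refine ((hh.tendsto_div_self.comp hy').mul (tendsto_expWeight_div (β := β) (κ := κ) hX hy)).congr' ?_
  filter_upwards [hy'.eventually_gt_atTop 0] with i hi
  have := expWeight_pos (β := β) (κ := κ) hi
  simp only [Function.comp]
  field_simp

/-! ### Iterated differences: Cauchy estimates and Euler's transformation. -/

/-- Cauchy's estimate for iterated forward differences. -/
lemma norm_fwdDiff_iter_le {G : ℂ → ℂ} {x₀ : ℂ} {ρ d M : ℝ} (hd : 0 < d)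
    (hG : DifferentiableOn ℂ G (Metric.ball x₀ ρ)) (hM : ∀ z ∈ Metric.ball x₀ ρ, ‖G z‖ ≤ M) (k : ℕ) :
    DifferentiableOn ℂ ((fwdDiff (1 : ℂ))^[k] G) (Metric.ball x₀ (ρ - k * (d + 1))) ∧
      ∀ z ∈ Metric.ball x₀ (ρ - k * (d + 1)), ‖(fwdDiff (1 : ℂ))^[k] G z‖ ≤ M / d ^ k := by
  induction k with
  | zero => simpa using ⟨hG, hM⟩
  | succ k ih =>
    obtain ⟨h1, h2⟩ := ih
    set Q := (fwdDiff (1 : ℂ))^[k] G with hQ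
    have hsub : Metric.ball x₀ (ρ - (k + 1 : ℕ) * (d + 1)) ⊆ Metric.ball x₀ (ρ - k * (d + 1)) := by
      apply Metric.ball_subset_ball; push_cast; nlinarith
    have hshift : ∀ z ∈ Metric.ball x₀ (ρ - (k + 1 : ℕ) * (d + 1)), ∀ w, ‖w - z‖ ≤ d + 1 →
        w ∈ Metric.ball x₀ (ρ - k * (d + 1)) := by
      intro z hz w hw
      rw [Metric.mem_ball, dist_eq_norm] at hz ⊢
      have : ‖w - x₀‖ ≤ ‖w - z‖ + ‖z - x₀‖ := by
        simpa using norm_add_le (w - z) (z - x₀)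
      push_cast at hz
      linarith
    rw [Function.iterate_succ_apply', ← hQ]
    constructor
    · have h3 : DifferentiableOn ℂ (fun z => Q (z + 1))
          (Metric.ball x₀ (ρ - (k + 1 : ℕ) * (d + 1))) := by
        refine h1.comp (differentiableOn_id.add_const 1) fun z hz => ?_
        exact hshift z hz _ (by simpa using hd.le)
      exact h3.sub (h1.mono hsub)
    · intro z hz
      have hseg : ∀ w ∈ Metric.closedBall z 1, ‖deriv Q w‖ ≤ M / d ^ k / d := by
        intro w hw
        rw [Metric.mem_closedBall, dist_eq_norm] at hw
        have hin : Metric.closedBall w d ⊆ Metric.ball x₀ (ρ - k * (d + 1)) := by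
          intro v hv
          rw [Metric.mem_closedBall, dist_eq_norm] at hv
          refine hshift z hz v ?_
          have : ‖v - z‖ ≤ ‖v - w‖ + ‖w - z‖ := by simpa using norm_add_le (v - w) (w - z)
          linarith
        refine Complex.norm_deriv_le_of_forall_mem_sphere_norm_le hd ?_ fun v hv =>
          h2 v (hin (Metric.sphere_subset_closedBall hv))
        refine DifferentiableOn.diffContOnCl ?_
        rw [closure_ball _ hd.ne']
        exact h1.mono hin
      have := (convex_closedBall z 1).norm_image_sub_le_of_norm_deriv_le (𝕜 := ℂ) (f := Q)
        (x := z) (y := z + 1) (fun w hw => ?_) hseg (by simp) (by simp)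
      · simpa [fwdDiff, pow_succ, div_div] using this
      · refine (h1.differentiableAt (Metric.isOpen_ball.mem_nhds (hshift z hz w ?_)))
        rw [Metric.mem_closedBall, dist_eq_norm] at hw
        linarith

/-- Euler's transformation of a finite alternating sum. -/
lemma alternating_sum_euler (G : ℂ → ℂ) (p : ℂ) (L K : ℕ) :
    ∑ j ∈ Finset.range L, (-1 : ℂ) ^ j * G (p + j) =
      ∑ k ∈ Finset.range K, (-1) ^ k / 2 ^ (k + 1) * (fwdDiff (1 : ℂ))^[k] G p
      - (-1) ^ L * ∑ k ∈ Finset.range K, (-1) ^ k / 2 ^ (k + 1) * (fwdDiff (1 : ℂ))^[k] G (p + L)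
      + (-1) ^ K / 2 ^ K * ∑ j ∈ Finset.range L, (-1 : ℂ) ^ j * (fwdDiff (1 : ℂ))^[K] G (p + j) := by
  induction K with
  | zero => simp
  | succ K ih =>
    rw [ih, Finset.sum_range_succ, Finset.sum_range_succ]
    set Q := (fwdDiff (1 : ℂ))^[K] G
    have key : 2 * ∑ j ∈ Finset.range L, (-1 : ℂ) ^ j * Q (p + j) = Q p - (-1) ^ L * Q (p + L)
        - ∑ j ∈ Finset.range L, (-1 : ℂ) ^ j * (fwdDiff (1 : ℂ))^[K + 1] G (p + j) := by
      rw [Function.iterate_succ_apply']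
      change _ = Q p - (-1) ^ L * Q (p + L) - ∑ j ∈ Finset.range L, (-1 : ℂ) ^ j * fwdDiff 1 Q (p + j)
      clear ih
      induction L with
      | zero => simp
      | succ L ih =>
        rw [Finset.sum_range_succ, Finset.sum_range_succ, mul_add, ih]
        simp only [fwdDiff]
        push_cast
        rw [← add_assoc p]
        ring
    have h2 : (2 : ℂ) ^ K ≠ 0 := pow_ne_zero _ two_ne_zero
    have : ∑ j ∈ Finset.range L, (-1 : ℂ) ^ j * Q (p + j) = (Q p - (-1) ^ L * Q (p + L)
        - ∑ j ∈ Finset.range L, (-1 : ℂ) ^ j * (fwdDiff (1 : ℂ))^[K + 1] G (p + j)) / 2 := by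
      rw [← key]; ring
    rw [this]
    field_simp
    ring

/-- In Euler's transformation only the differences at the left end survive as a main term: those at
the right end and the remainder of K-th differences are to be made small. -/
lemma norm_alternating_sum_sub_le {G : ℂ → ℂ} {p : ℂ} {L K : ℕ} {ε : ℝ} {δ : ℕ → ℝ}
    (hend : ∀ k < K, ‖(fwdDiff (1 : ℂ))^[k] G (p + L)‖ ≤ ε)
    (hδ : ∀ j < L, ‖(fwdDiff (1 : ℂ))^[K] G (p + j)‖ ≤ δ j) :
    ‖∑ j ∈ Finset.range L, (-1 : ℂ) ^ j * G (p + j) -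
      ∑ k ∈ Finset.range K, (-1) ^ k / 2 ^ (k + 1) * (fwdDiff (1 : ℂ))^[k] G p‖ ≤
      K * ε + ∑ j ∈ Finset.range L, δ j := by
  rw [alternating_sum_euler G p L K]
  have hc : ∀ k : ℕ, ‖((-1 : ℂ)) ^ k / 2 ^ (k + 1)‖ ≤ 1 := by
    intro k
    simp only [norm_div, norm_pow, norm_neg, norm_one, one_pow, Complex.norm_ofNat]
    rw [div_le_one (by positivity)]
    exact one_le_pow₀ (by norm_num)
  have h1 : ‖∑ k ∈ Finset.range K, (-1) ^ k / 2 ^ (k + 1) * (fwdDiff (1 : ℂ))^[k] G (p + L)‖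
      ≤ K * ε := by
    refine (norm_sum_le _ _).trans ?_
    rw [← nsmul_eq_mul, ← Finset.card_range K, ← Finset.sum_const, Finset.card_range]
    refine Finset.sum_le_sum fun k hk => ?_
    rw [norm_mul]
    have := hend k (Finset.mem_range.1 hk)
    nlinarith [hc k, norm_nonneg ((fwdDiff (1 : ℂ))^[k] G (p + L)), norm_nonneg (((-1 : ℂ)) ^ k / 2 ^ (k + 1))]
  have h2 : ‖∑ j ∈ Finset.range L, (-1 : ℂ) ^ j * (fwdDiff (1 : ℂ))^[K] G (p + j)‖ ≤
      ∑ j ∈ Finset.range L, δ j := by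
    refine (norm_sum_le _ _).trans (Finset.sum_le_sum fun j hj => ?_)
    simpa using hδ j (Finset.mem_range.1 hj)
  have h3 : ‖(-1 : ℂ) ^ K / 2 ^ K‖ ≤ 1 := by
    simp only [norm_div, norm_pow, norm_neg, norm_one, one_pow, Complex.norm_ofNat]
    rw [div_le_one (by positivity)]
    exact one_le_pow₀ (by norm_num)
  rw [add_sub_right_comm, sub_sub_cancel_left]
  refine (norm_add_le _ _).trans (add_le_add ?_ ?_)
  · simpa using h1
  · rw [norm_mul]
    have := norm_nonneg (∑ j ∈ Finset.range L, (-1 : ℂ) ^ j * (fwdDiff (1 : ℂ))^[K] G (p + j))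
    nlinarith

/-! ### Difference estimates for the summand. -/

/-- The conditions R² ≤ √T and |B|R ≤ √T say that moving z by R changes the argument of H by O(√T)
beyond what half of the quadratic term absorbs. The exponent β√w then changes by O(1), so the
complex disc costs only a constant. -/
lemma norm_le_near_real {β κ C a T R B x₀ : ℝ} {H : ℂ → ℂ} {z : ℂ} (hβ : 0 < β) (hC : 0 < C)
    (ha : 0 < a)
    (hH : ∀ w : ℂ, 0 < w.re → 1 ≤ ‖w‖ → ‖H w‖ ≤ C * expWeight β κ ‖w‖) (hT : 2 ≤ T) (hR : 0 ≤ R)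
    (hz : ‖z - x₀‖ ≤ R) (hsmall : (|x₀| + R) * (a * (|x₀| + R) + |B|) ≤ T / 2)
    (hR2 : R ^ 2 ≤ √T) (hBR : |B| * R ≤ √T) :
    0 < ((T : ℂ) - a * z ^ 2 - B * z).re ∧ ‖H (T - a * z ^ 2 - B * z)‖ ≤
      C * 2 ^ |κ| * Real.exp (β / 2 * (3 * a + 1)) *
        (expWeight β κ T * Real.exp (-(β / (2 * √T)) * (a * x₀ ^ 2 / 2 + B * x₀))) := by
  set w : ℂ := (T : ℂ) - a * z ^ 2 - B * z with hw
  have hx0 := abs_nonneg x₀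
  have hB0 := abs_nonneg B
  have hzn : ‖z‖ ≤ |x₀| + R := by
    have : ‖z‖ ≤ ‖z - x₀‖ + ‖(x₀ : ℂ)‖ := by simpa using norm_add_le (z - x₀) (x₀ : ℂ)
    rw [Complex.norm_real, Real.norm_eq_abs] at this
    linarith
  have h1 : ‖(a : ℂ) * z ^ 2 + B * z‖ ≤ T / 2 := by
    rw [show (a : ℂ) * z ^ 2 + B * z = z * (a * z + B) by ring, norm_mul]
    refine le_trans ?_ hsmall
    have : ‖(a : ℂ) * z + B‖ ≤ a * ‖z‖ + |B| := by
      refine (norm_add_le _ _).trans ?_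
      rw [norm_mul, Complex.norm_real, Complex.norm_real, Real.norm_eq_abs, Real.norm_eq_abs,
        abs_of_pos ha]
    refine mul_le_mul hzn (this.trans ?_) (norm_nonneg _) (by positivity)
    gcongr
  have h2 : T / 2 ≤ w.re := by
    have := Complex.re_le_norm ((a : ℂ) * z ^ 2 + B * z)
    have h3 : w.re = T - ((a : ℂ) * z ^ 2 + B * z).re := by
      rw [hw, sub_sub, Complex.sub_re, Complex.ofReal_re]
    linarith
  have h3 : T / 2 ≤ ‖w‖ := h2.trans (Complex.re_le_norm _)
  have h4 : ‖w‖ ≤ 2 * T := by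
    rw [hw, sub_sub]
    refine (norm_sub_le _ _).trans ?_
    rw [Complex.norm_real, Real.norm_eq_abs, abs_of_nonneg (by linarith : 0 ≤ T)]
    linarith
  have hsT : 0 < √T := Real.sqrt_pos.2 (by linarith)
  have h5 : ‖w‖ - T ≤ -(a * x₀ ^ 2 / 2 + B * x₀) + (3 * a + 1) * √T := by
    have e1 : w = ((T - a * x₀ ^ 2 - B * x₀ : ℝ) : ℂ) - (z - x₀) * (a * (z + x₀) + B) := by
      rw [hw]; push_cast; ring
    have e2 : 0 ≤ T - a * x₀ ^ 2 - B * x₀ := by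
      have f1 : a * x₀ ^ 2 + B * x₀ ≤ |x₀| * (a * |x₀| + |B|) := by
        have := le_abs_self (B * x₀)
        rw [abs_mul] at this
        nlinarith [sq_abs x₀]
      have f2 : |x₀| * (a * |x₀| + |B|) ≤ (|x₀| + R) * (a * (|x₀| + R) + |B|) := by
        gcongr <;> linarith
      linarith
    have e3 : ‖(a : ℂ) * (z + x₀) + B‖ ≤ a * (2 * |x₀| + R) + |B| := by
      refine (norm_add_le _ _).trans ?_
      rw [norm_mul, Complex.norm_real, Complex.norm_real, Real.norm_eq_abs, Real.norm_eq_abs,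
        abs_of_pos ha]
      have : ‖z + x₀‖ ≤ ‖z‖ + ‖(x₀ : ℂ)‖ := norm_add_le _ _
      rw [Complex.norm_real, Real.norm_eq_abs] at this
      gcongr
      linarith
    have e4 : ‖w‖ ≤ (T - a * x₀ ^ 2 - B * x₀) + R * (a * (2 * |x₀| + R) + |B|) := by
      rw [e1]
      refine (norm_sub_le _ _).trans ?_
      rw [Complex.norm_real, Real.norm_eq_abs, abs_of_nonneg e2, norm_mul]
      gcongr
    -- The cross term obeys 2a|x₀|R ≤ a x₀²/2 + 2aR². This is why only half of a x₀² remains in the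
    -- exponent.
    nlinarith [sq_abs x₀, mul_nonneg ha.le (sq_nonneg (|x₀| - 2 * R)), mul_le_mul_of_nonneg_left hR2 ha.le]
  refine ⟨by linarith, (hH w (by linarith) (by linarith)).trans ?_⟩
  have h6 := expWeight_le (κ := κ) hβ (by linarith) h3 h4
  have h7 : Real.exp (β / (2 * √T) * (‖w‖ - T)) ≤ Real.exp (β / 2 * (3 * a + 1)) *
      Real.exp (-(β / (2 * √T)) * (a * x₀ ^ 2 / 2 + B * x₀)) := by
    rw [← Real.exp_add]
    apply Real.exp_le_exp.2
    have := mul_le_mul_of_nonneg_left h5 (by positivity : 0 ≤ β / (2 * √T))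
    refine this.trans (le_of_eq ?_)
    field_simp
    ring
  have hF := expWeight_pos (β := β) (κ := κ) (by linarith : 0 < T)
  calc C * expWeight β κ ‖w‖ ≤ C * (2 ^ |κ| * (expWeight β κ T * (Real.exp (β / 2 * (3 * a + 1)) *
      Real.exp (-(β / (2 * √T)) * (a * x₀ ^ 2 / 2 + B * x₀))))) := by
        gcongr
        exact h6.trans (by gcongr)
    _ = _ := by ring

lemma norm_fwdDiff_le_near_real {β κ C a T R B x₀ : ℝ} {H : ℂ → ℂ} (hβ : 0 < β) (hC : 0 < C)
    (ha : 0 < a) (hd : DifferentiableOn ℂ H {w | 0 < w.re})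
    (hH : ∀ w : ℂ, 0 < w.re → 1 ≤ ‖w‖ → ‖H w‖ ≤ C * expWeight β κ ‖w‖) (hT : 2 ≤ T)
    (hsmall : (|x₀| + R) * (a * (|x₀| + R) + |B|) ≤ T / 2)
    (hR2 : R ^ 2 ≤ √T) (hBR : |B| * R ≤ √T) {J K k : ℕ} (hK : 0 < K) (hKR : 2 * (K : ℝ) < R)
    (hk : k ≤ K) :
    ‖(fwdDiff (1 : ℂ))^[k] (fun z => z ^ J * H (T - a * z ^ 2 - B * z)) x₀‖ ≤
      (|x₀| + R) ^ J * (C * 2 ^ |κ| * Real.exp (β / 2 * (3 * a + 1)) *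
        (expWeight β κ T * Real.exp (-(β / (2 * √T)) * (a * x₀ ^ 2 / 2 + B * x₀)))) *
        (2 * K / R) ^ k := by
  have hK' : (0 : ℝ) < K := by exact_mod_cast hK
  have hR : 0 < R := by linarith
  have key : ∀ z ∈ Metric.ball (x₀ : ℂ) R, _ := fun z hz =>
    norm_le_near_real (κ := κ) (x₀ := x₀) (z := z) hβ hC ha hH hT hR.le
      (by rw [Metric.mem_ball, dist_eq_norm] at hz; exact hz.le) hsmall hR2 hBR
  have hdiff : DifferentiableOn ℂ (fun z : ℂ => z ^ J * H (T - a * z ^ 2 - B * z))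
      (Metric.ball (x₀ : ℂ) R) := by
    refine DifferentiableOn.mul (by fun_prop) ?_
    exact hd.comp (f := fun z : ℂ => (T : ℂ) - a * z ^ 2 - B * z) (by fun_prop)
      fun z hz => (key z hz).1
  have hF := expWeight_pos (β := β) (κ := κ) (by linarith : 0 < T)
  set M := C * 2 ^ |κ| * Real.exp (β / 2 * (3 * a + 1)) *
    (expWeight β κ T * Real.exp (-(β / (2 * √T)) * (a * x₀ ^ 2 / 2 + B * x₀)))
  -- With d = R/(2K), at most K differences use up K(d + 1) = R/2 + K < R of the radius.
  have := (norm_fwdDiff_iter_le (d := R / (2 * K)) (M := (|x₀| + R) ^ J * M) (by positivity) hdiff (fun z hz => ?_) k).2 x₀ ?_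
  · refine this.trans (le_of_eq ?_)
    rw [div_eq_mul_inv _ ((R / (2 * K)) ^ k), ← inv_pow, inv_div]
  · rw [norm_mul, norm_pow]
    refine mul_le_mul ?_ (key z hz).2 (norm_nonneg _) (by positivity)
    rw [Metric.mem_ball, dist_eq_norm] at hz
    have : ‖z‖ ≤ ‖z - x₀‖ + ‖(x₀ : ℂ)‖ := by simpa using norm_add_le (z - x₀) (x₀ : ℂ)
    rw [Complex.norm_real, Real.norm_eq_abs] at this
    gcongr
    linarith
  · apply Metric.mem_ball_self
    have h1 : (k : ℝ) ≤ K := by exact_mod_cast hk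
    have h2 : (k : ℝ) * (R / (2 * K) + 1) ≤ K * (R / (2 * K) + 1) := by gcongr
    have h3 : (K : ℝ) * (R / (2 * K) + 1) = R / 2 + K := by field_simp
    linarith

/-! ### The one-sided sum when the linear coefficient is o(√X). -/

/-- The value attached by Euler's method to `∑ (-1)^j (j + 1)^J`. -/
noncomputable def eulerConst (J : ℕ) : ℂ :=
  ∑ k ∈ Finset.range (J + 3), (-1) ^ k / 2 ^ (k + 1) * (fwdDiff (1 : ℂ))^[k] (fun z => z ^ J) 1

lemma eulerConst_zero : eulerConst 0 = 1 / 2 := by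
  simp [eulerConst, Finset.sum_range_succ, fwdDiff]

lemma eulerConst_one : eulerConst 1 = 1 / 4 := by
  simp [eulerConst, Finset.sum_range_succ, fwdDiff]
  norm_num

/-- The value for J = 2 is 0, so the second difference has to be read off from the cubic value
instead. -/
lemma eulerConst_three : eulerConst 3 = -1 / 8 := by
  simp [eulerConst, Finset.sum_range_succ, fwdDiff]
  norm_num

lemma tendsto_fwdDiff_iter {ι : Type*} {l : Filter ι} {G : ι → ℂ → ℂ} {G₀ : ℂ → ℂ} {p : ℂ}
    (h : ∀ m : ℕ, Tendsto (fun i => G i (p + m)) l (nhds (G₀ (p + m)))) (k : ℕ) :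
    Tendsto (fun i => (fwdDiff (1 : ℂ))^[k] (G i) p) l (nhds ((fwdDiff (1 : ℂ))^[k] G₀ p)) := by
  simp only [fwdDiff_iter_eq_sum_shift, zsmul_eq_mul, nsmul_eq_mul, mul_one]
  exact tendsto_finsetSum _ fun m _ => (h m).const_mul _

lemma fwdDiff_iter_div_const (G : ℂ → ℂ) (c p : ℂ) (k : ℕ) :
    (fwdDiff (1 : ℂ))^[k] (fun z => G z / c) p = (fwdDiff (1 : ℂ))^[k] G p / c := by
  simp only [fwdDiff_iter_eq_sum_shift, zsmul_eq_mul, Finset.sum_div, mul_div_assoc]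

lemma one_add_pow_mul_exp_le {b : ℝ} (hb : 0 < b) (m : ℕ) {y : ℝ} (hy : 0 ≤ y) :
    (1 + y) ^ m * Real.exp (-(b * y)) ≤ m.factorial / b ^ m * Real.exp b := by
  have h := Real.pow_div_factorial_le_exp (b * (1 + y)) (by positivity) m
  rw [div_le_iff₀ (by positivity), mul_pow] at h
  rw [Real.exp_neg, div_mul_eq_mul_div, le_div_iff₀ (by positivity), ← div_eq_mul_inv,
    div_mul_eq_mul_div, div_le_iff₀ (by positivity), mul_assoc, ← Real.exp_add,
    show b + b * y = b * (1 + y) by ring]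
  linarith

lemma sqrt_pow_eight (t : ℝ) : √(t ^ 8) = t ^ 4 := by
  rw [show t ^ 8 = (t ^ 4) ^ 2 by ring, Real.sqrt_sq (by positivity)]

/-- At a fixed number of integer points the argument moves by o(√T), so the normalised summand tends
to g z^J there. The finitely many differences at 1 converge with it. -/
lemma tendsto_euler_expansion {ι : Type*} {l : Filter ι} {β κ g a : ℝ} {h : ℝ → ℝ} {H : ℂ → ℂ}
    (hh : IsExpSum β κ g h) (hHh : ∀ x : ℝ, 0 < x → H x = h x) {τ B : ι → ℝ}
    (hτ : Tendsto τ l atTop) (hB : Tendsto (fun i => B i / τ i ^ 4) l (nhds 0)) (J : ℕ) :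
    Tendsto (fun i => ∑ k ∈ Finset.range (J + 3), (-1) ^ k / 2 ^ (k + 1) *
      (fwdDiff (1 : ℂ))^[k] (fun z => z ^ J * H ((τ i ^ 8 : ℝ) - a * z ^ 2 - B i * z) /
        (expWeight β κ (τ i ^ 8) : ℝ)) 1) l (nhds (g * eulerConst J)) := by
  have hX : Tendsto (fun i => τ i ^ 8) l atTop := (tendsto_pow_atTop (by norm_num)).comp hτ
  have e : (g : ℂ) * eulerConst J = ∑ k ∈ Finset.range (J + 3), (-1) ^ k / 2 ^ (k + 1) *
      (fwdDiff (1 : ℂ))^[k] (fun z => g * z ^ J) 1 := by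
    rw [eulerConst, Finset.mul_sum]
    refine Finset.sum_congr rfl fun k _ => ?_
    simp only [fwdDiff_iter_eq_sum_shift, zsmul_eq_mul, Finset.mul_sum]
    refine Finset.sum_congr rfl fun m _ => by ring
  rw [e]
  refine tendsto_finsetSum _ fun k _ => (tendsto_fwdDiff_iter (fun m => ?_) k).const_mul _
  have hy : Tendsto (fun i => ((τ i ^ 8 - a * (1 + m) ^ 2 - B i * (1 + m)) - τ i ^ 8) / √(τ i ^ 8)) l
      (nhds 0) := by
    have h1 : Tendsto (fun i => (τ i ^ 4)⁻¹) l (nhds 0) :=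
      ((tendsto_pow_atTop (by norm_num)).comp hτ).inv_tendsto_atTop
    have := (h1.const_mul (-(a * (1 + (m : ℝ)) ^ 2))).sub (hB.mul_const (1 + (m : ℝ)))
    simp only [mul_zero, zero_mul, sub_zero] at this
    refine this.congr fun i => ?_
    rw [sqrt_pow_eight]
    ring
  have h2 := hh.tendsto_div hX hy
  rw [mul_zero, Real.exp_zero, mul_one] at h2
  have h3 := (Complex.continuous_ofReal.tendsto _).comp (h2.const_mul ((1 + (m : ℝ)) ^ J))
  have h4 : ((((1 + (m : ℝ)) ^ J * g : ℝ)) : ℂ) = g * (1 + m) ^ J := by push_cast; ring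
  rw [h4] at h3
  refine h3.congr' ?_
  have hpos : ∀ᶠ i in l, (0 : ℝ) < τ i ^ 8 - a * (1 + m) ^ 2 - B i * (1 + m) := by
    have := hy.eventually_const_lt (by norm_num : (-1 / 2 : ℝ) < 0)
    filter_upwards [this, hτ.eventually_gt_atTop 1] with i hi hi1
    rw [sqrt_pow_eight, lt_div_iff₀ (by positivity)] at hi
    have : τ i ^ 4 ≤ τ i ^ 8 := pow_le_pow_right₀ hi1.le (by norm_num)
    have : 0 < τ i ^ 4 := by positivity
    linarith
  filter_upwards [hpos] with i hi
  have := hHh _ hi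
  simp only [Function.comp]
  push_cast at this ⊢
  rw [this]
  ring

lemma quadratic_small {a t x B : ℝ} (ha : 0 < a) (ht2 : 2 ≤ t) (hta : 16 + 64 * a ≤ t)
    (hx0 : 0 ≤ x) (hx : x ≤ 4 * t ^ 3) (hB : |B| ≤ t ^ 4) : x * (a * x + |B|) ≤ t ^ 8 / 2 := by
  have htp : 0 < t := by linarith
  have hBn := abs_nonneg B
  calc _ ≤ (4 * t ^ 3) * (a * (4 * t ^ 3) + t ^ 4) := by gcongr
    _ = 16 * a * t ^ 6 + 4 * t ^ 7 := by ring
    _ ≤ 16 * a * t ^ 7 + 4 * t ^ 7 := by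
      gcongr
      · linarith
      · norm_num
    _ = (16 * a + 4) * t ^ 7 := by ring
    _ ≤ t / 2 * t ^ 7 := by gcongr; linarith
    _ = _ := by ring

/-- The decay is expressed through the single scale R = t⁴/(t² + |B|), for which 1/R = 1/t² +
|B|/t⁴. The part x/t² comes from the quadratic term by completing a square, the part |B|x/t⁴ from
the linear one; the bound B ≥ -C₀ makes its wrong sign cost a constant only. -/
lemma exp_neg_quadratic_le {β a t x B C₀ : ℝ} (hβ : 0 < β) (ha : 0 < a) (ht : 1 ≤ t)
    (hB0 : -C₀ ≤ B) (hx0 : 0 ≤ x) (hx : x ≤ 3 * t ^ 3) :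
    Real.exp (-(β / (2 * t ^ 4)) * (a * x ^ 2 / 2 + B * x)) ≤
      Real.exp (β / (4 * a) + 3 * β * |C₀|) *
        Real.exp (-(β / 2 * (x / (t ^ 4 / (t ^ 2 + |B|))))) := by
  have htp : 0 < t := by linarith
  have hBn := abs_nonneg B
  rw [← Real.exp_add]
  apply Real.exp_le_exp.2
  have e1 : x / (t ^ 4 / (t ^ 2 + |B|)) = x / t ^ 2 + |B| * x / t ^ 4 := by
    field_simp
  have e2 : -(β / (2 * t ^ 4)) * (a * x ^ 2 / 2 + B * x) =
      -(a * β / 4) * (x / t ^ 2) ^ 2 - β / 2 * (B * x / t ^ 4) := by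
    field_simp
    ring
  rw [e1, e2]
  have e3 : |B| ≤ B + 2 * |C₀| := by
    rcases abs_cases B with ⟨h, _⟩ | ⟨h, _⟩ <;> rcases abs_cases C₀ with ⟨h', _⟩ | ⟨h', _⟩ <;>
      linarith
  have e4 : |B| * x / t ^ 4 ≤ B * x / t ^ 4 + 6 * |C₀| := by
    have f1 : x / t ^ 4 ≤ 3 := by
      rw [div_le_iff₀ (by positivity)]
      have : t ^ 3 ≤ t ^ 4 := pow_le_pow_right₀ ht (by norm_num)
      linarith
    have f0 : 0 ≤ x / t ^ 4 := by positivity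
    have := mul_le_mul_of_nonneg_right e3 f0
    have := mul_le_mul_of_nonneg_left f1 (by positivity : 0 ≤ 2 * |C₀|)
    rw [mul_div_assoc, mul_div_assoc]
    nlinarith
  have e5 : β / 2 * (x / t ^ 2) ≤ a * β / 4 * (x / t ^ 2) ^ 2 + β / (4 * a) := by
    have : a * β / 4 * (x / t ^ 2) ^ 2 + β / (4 * a) - β / 2 * (x / t ^ 2) =
        β / (4 * a) * (a * (x / t ^ 2) - 1) ^ 2 := by
      field_simp; ring
    have h0 : 0 ≤ β / (4 * a) * (a * (x / t ^ 2) - 1) ^ 2 := by positivity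
    linarith
  have e6 := mul_le_mul_of_nonneg_left e4 (by positivity : 0 ≤ β / 2)
  linarith

/-- The radius R = t⁴/(t² + |B|) satisfies R ≤ t² and |B|R ≤ t⁴, as the holomorphic bound requires,
and is also the decay length of the summand. -/
lemma norm_fwdDiff_le_decay {β κ C a t B C₀ x₀ : ℝ} {H : ℂ → ℂ} (hβ : 0 < β) (hC : 0 < C)
    (ha : 0 < a) (hd : DifferentiableOn ℂ H {w | 0 < w.re})
    (hH : ∀ w : ℂ, 0 < w.re → 1 ≤ ‖w‖ → ‖H w‖ ≤ C * expWeight β κ ‖w‖)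
    (ht2 : 2 ≤ t) (hta : 16 + 64 * a ≤ t) (hB : |B| ≤ t ^ 4) (hB0 : -C₀ ≤ B)
    (hx0 : 0 ≤ x₀) (hx3 : x₀ ≤ 3 * t ^ 3) {J K k : ℕ} (hK : 0 < K)
    (hKR : 2 * (K : ℝ) < t ^ 4 / (t ^ 2 + |B|)) (hk : k ≤ K) :
    ‖(fwdDiff (1 : ℂ))^[k] (fun z => z ^ J * H ((t ^ 8 : ℝ) - a * z ^ 2 - B * z) /
        (expWeight β κ (t ^ 8) : ℝ)) x₀‖ ≤
      (C * 2 ^ |κ| * Real.exp (β / 2 * (3 * a + 1)) * Real.exp (β / (4 * a) + 3 * β * |C₀|)) *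
        ((x₀ + t ^ 4 / (t ^ 2 + |B|)) ^ J *
          Real.exp (-(β / 2 * (x₀ / (t ^ 4 / (t ^ 2 + |B|)))))) *
        (2 * K / (t ^ 4 / (t ^ 2 + |B|))) ^ k := by
  have htp : 0 < t := by linarith
  have hBn := abs_nonneg B
  have hexp := exp_neg_quadratic_le hβ ha (by linarith : 1 ≤ t) hB0 hx0 hx3
  set R := t ^ 4 / (t ^ 2 + |B|) with hR
  have hRp : 0 < R := by positivity
  have hden : 0 < t ^ 2 + |B| := by positivity
  have hRle : R ≤ t ^ 2 := by
    rw [hR, div_le_iff₀ hden]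
    nlinarith [pow_pos htp 2]
  have hBR : |B| * R ≤ t ^ 4 := by
    rw [hR, mul_div_assoc', div_le_iff₀ hden]
    nlinarith [pow_pos htp 2, pow_pos htp 4, pow_pos htp 6]
  have h23 : t ^ 2 ≤ t ^ 3 := pow_le_pow_right₀ (by linarith) (by norm_num)
  have hxabs : |x₀| = x₀ := abs_of_nonneg hx0
  have hsmall : (|x₀| + R) * (a * (|x₀| + R) + |B|) ≤ t ^ 8 / 2 :=
    quadratic_small ha ht2 hta (by positivity) (by rw [hxabs]; linarith) hB
  have hFp : 0 < expWeight β κ (t ^ 8) := expWeight_pos (by positivity)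
  have hb := norm_fwdDiff_le_near_real (κ := κ) (T := t ^ 8) (x₀ := x₀) (J := J) (K := K) hβ hC ha hd hH
    (by nlinarith [pow_le_pow_left₀ (by norm_num) ht2 8]) hsmall
    (by rw [sqrt_pow_eight]; nlinarith [pow_pos htp 2]) (by rw [sqrt_pow_eight]; exact hBR)
    hK hKR hk
  rw [fwdDiff_iter_div_const, norm_div, Complex.norm_real, Real.norm_eq_abs, abs_of_pos hFp,
    div_le_iff₀ hFp]
  refine hb.trans ?_
  rw [sqrt_pow_eight, hxabs]
  calc _ ≤ (x₀ + R) ^ J * (C * 2 ^ |κ| * Real.exp (β / 2 * (3 * a + 1)) *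
        (expWeight β κ (t ^ 8) * (Real.exp (β / (4 * a) + 3 * β * |C₀|) *
          Real.exp (-(β / 2 * (x₀ / R)))))) * (2 * K / R) ^ k := by
        gcongr
    _ = _ := by ring

/-- With K = J + 3 differences, J + 2 powers of R go to the factor (x + R)^J and to a convergent
majorant 1/(j+1)², leaving 1/R. At the right end x/R ≥ t/2, whence the term exponentially small in
t. -/
lemma norm_alternating_sum_sub_euler_le {β κ C a C₀ : ℝ} {H : ℂ → ℂ} (hβ : 0 < β) (hC : 0 < C)
    (ha : 0 < a) (hd : DifferentiableOn ℂ H {w | 0 < w.re})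
    (hH : ∀ w : ℂ, 0 < w.re → 1 ≤ ‖w‖ → ‖H w‖ ≤ C * expWeight β κ ‖w‖) (J : ℕ) :
    ∃ C₁ C₂ : ℝ, ∀ (t B : ℝ) (N : ℕ), 2 ≤ t → 16 + 64 * a ≤ t → |B| ≤ t ^ 4 → -C₀ ≤ B →
      t ^ 3 / 2 ≤ N → N ≤ 2 * t ^ 3 → 2 * ((J + 3 : ℕ) : ℝ) < t ^ 4 / (t ^ 2 + |B|) →
      ‖∑ j ∈ Finset.range N, (-1 : ℂ) ^ j *
          ((fun z : ℂ => z ^ J * H ((t ^ 8 : ℝ) - a * z ^ 2 - B * z) /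
            (expWeight β κ (t ^ 8) : ℝ)) (1 + j)) -
        ∑ k ∈ Finset.range (J + 3), (-1) ^ k / 2 ^ (k + 1) *
          (fwdDiff (1 : ℂ))^[k] (fun z : ℂ => z ^ J * H ((t ^ 8 : ℝ) - a * z ^ 2 - B * z) /
            (expWeight β κ (t ^ 8) : ℝ)) 1‖ ≤
      C₁ * (t ^ (3 * J) * Real.exp (-(β / 4) * t)) + C₂ * (t ^ 4 / (t ^ 2 + |B|))⁻¹ := by
  set K := J + 3 with hK
  set A := C * 2 ^ |κ| * Real.exp (β / 2 * (3 * a + 1)) * Real.exp (β / (4 * a) + 3 * β * |C₀|)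
    with hA
  have hAp : 0 < A := by positivity
  set D := ((J + 2).factorial / (β / 2) ^ (J + 2) * Real.exp (β / 2) : ℝ) with hDdef
  have hD : 0 < D := by positivity
  set C2 := A * D * (2 * K) ^ K with hC2
  have hC2p : 0 < C2 := by positivity
  have hsummable : Summable (fun j : ℕ => 1 / ((j : ℝ) + 1) ^ 2) := by
    have := (summable_nat_add_iff 1).2 (Real.summable_one_div_nat_pow.2 one_lt_two)
    simpa using this
  refine ⟨K * (A * 4 ^ J), C2 * ∑' j : ℕ, 1 / ((j : ℝ) + 1) ^ 2, ?_⟩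
  intro t B N ht2 hta hB hB0 hN1 hN2 hKR
  have htp : 0 < t := by linarith
  have hBn := abs_nonneg B
  have h3 : (1 : ℝ) ≤ t ^ 3 := one_le_pow₀ (by linarith)
  have h23 : t ^ 2 ≤ t ^ 3 := pow_le_pow_right₀ (by linarith) (by norm_num)
  have hmain : ∀ x₀ : ℝ, 0 ≤ x₀ → x₀ ≤ N + 1 → ∀ k ≤ K, _ := fun x₀ hx0 hx1 k hk =>
    norm_fwdDiff_le_decay (κ := κ) (x₀ := x₀) (J := J) (K := K) hβ hC ha hd hH ht2 hta hB hB0 hx0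
      (by linarith) (by omega) hKR hk
  have hRle : t ^ 4 / (t ^ 2 + |B|) ≤ t ^ 2 := by
    rw [div_le_iff₀ (by positivity)]
    nlinarith [pow_pos htp 2]
  have hRp : 0 < t ^ 4 / (t ^ 2 + |B|) := by positivity
  rw [← hA] at hmain
  set G : ℂ → ℂ := fun z => z ^ J * H ((t ^ 8 : ℝ) - a * z ^ 2 - B * z) /
    (expWeight β κ (t ^ 8) : ℝ)
  generalize t ^ 4 / (t ^ 2 + |B|) = R at *
  have hsumle : ∑ j ∈ Finset.range N, C2 * R⁻¹ * (1 / ((j : ℝ) + 1) ^ 2) ≤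
      C2 * R⁻¹ * ∑' j : ℕ, 1 / ((j : ℝ) + 1) ^ 2 := by
    rw [← Finset.mul_sum]
    exact mul_le_mul_of_nonneg_left (hsummable.sum_le_tsum _ fun j _ => by positivity)
      (by positivity)
  have hfin := norm_alternating_sum_sub_le (G := G) (p := 1) (L := N) (K := K)
    (ε := A * (4 ^ J * (t ^ (3 * J) * Real.exp (-(β / 4) * t))))
    (δ := fun j => C2 * R⁻¹ * (1 / ((j : ℝ) + 1) ^ 2)) (fun k hk => ?_) (fun j hj => ?_)
  · refine (hfin.trans (add_le_add_right hsumle _)).trans (le_of_eq ?_)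
    ring
  · have := hmain (1 + N) (by positivity) (by linarith) k hk.le
    push_cast at this
    refine this.trans ?_
    have f1 : (2 * K / R) ^ k ≤ 1 := by
      apply pow_le_one₀ (by positivity)
      rw [div_le_one hRp]; exact hKR.le
    have f2 : (1 + (N : ℝ) + R) ^ J ≤ 4 ^ J * t ^ (3 * J) := by
      rw [pow_mul, ← mul_pow]
      gcongr
      linarith [pow_le_pow_right₀ (by linarith : 1 ≤ t) (by norm_num : 2 ≤ 3),
        pow_le_pow_left₀ (by norm_num) ht2 3]
    have f3 : Real.exp (-(β / 2 * ((1 + (N : ℝ)) / R))) ≤ Real.exp (-(β / 4) * t) := by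
      apply Real.exp_le_exp.2
      have : t / 2 ≤ (1 + (N : ℝ)) / R := by
        rw [le_div_iff₀ hRp]
        have := mul_le_mul_of_nonneg_left hRle (by positivity : 0 ≤ t / 2)
        have e : t / 2 * t ^ 2 = t ^ 3 / 2 := by ring
        linarith
      nlinarith
    calc _ ≤ A * ((4 ^ J * t ^ (3 * J)) * Real.exp (-(β / 4) * t)) * 1 := by gcongr
      _ = _ := by ring
  · have := hmain (1 + j) (by positivity) (by
      have : (j : ℝ) ≤ N := by exact_mod_cast hj.le
      linarith) K le_rfl
    push_cast at this
    refine this.trans ?_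
    have f1 := one_add_pow_mul_exp_le (b := β / 2) (by positivity) (J + 2)
      (y := (1 + (j : ℝ)) / R) (by positivity)
    rw [← hDdef] at f1
    have f2 : (1 + (j : ℝ) + R) ^ J * Real.exp (-(β / 2 * ((1 + (j : ℝ)) / R))) ≤
        D * R ^ (J + 2) / ((j : ℝ) + 1) ^ 2 := by
      have e1 : 1 + (1 + (j : ℝ)) / R = (1 + (j : ℝ) + R) / R := by field_simp; ring
      rw [e1, div_pow, div_mul_eq_mul_div, div_le_iff₀ (by positivity), pow_add _ J 2] at f1
      rw [le_div_iff₀ (by positivity)]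
      refine le_trans ?_ f1
      have : ((j : ℝ) + 1) ^ 2 ≤ (1 + (j : ℝ) + R) ^ 2 := by
        apply pow_le_pow_left₀ (by positivity)
        linarith
      have hp : 0 ≤ (1 + (j : ℝ) + R) ^ J * Real.exp (-(β / 2 * ((1 + (j : ℝ)) / R))) := by
        positivity
      calc _ ≤ (1 + (j : ℝ) + R) ^ J * Real.exp (-(β / 2 * ((1 + (j : ℝ)) / R))) *
            (1 + (j : ℝ) + R) ^ 2 := mul_le_mul_of_nonneg_left this hp
        _ = _ := by ring
    calc _ ≤ A * (D * R ^ (J + 2) / ((j : ℝ) + 1) ^ 2) * (2 * K / R) ^ K := by gcongr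
      _ = _ := by
        simp only [hC2]
        rw [div_pow, show R ^ K = R ^ (J + 2) * R by rw [hK, ← pow_succ]]
        field_simp

/-- B = o(τ⁴) is exactly what sends the scale τ⁴/(τ² + |B|) to infinity, so the sum differs from its
Euler expansion at 1 by o(1). -/
lemma tendsto_alternating_sum {ι : Type*} {l : Filter ι} {β κ g a C₀ : ℝ} {h : ℝ → ℝ}
    (hβ : 0 < β) (ha : 0 < a) (hh : IsExpSum β κ g h) {τ B : ι → ℝ} {N : ι → ℕ}
    (hτ : Tendsto τ l atTop) (hB : Tendsto (fun i => B i / τ i ^ 4) l (nhds 0))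
    (hB0 : ∀ᶠ i in l, -C₀ ≤ B i) (hN1 : ∀ᶠ i in l, τ i ^ 3 / 2 ≤ N i)
    (hN2 : ∀ᶠ i in l, (N i : ℝ) ≤ 2 * τ i ^ 3) (J : ℕ) :
    Tendsto (fun i => (((∑ j ∈ Finset.range (N i), (-1 : ℝ) ^ j * (((j : ℝ) + 1) ^ J *
      h (τ i ^ 8 - a * ((j : ℝ) + 1) ^ 2 - B i * ((j : ℝ) + 1)))) / expWeight β κ (τ i ^ 8) : ℝ) : ℂ))
      l (nhds (g * eulerConst J)) := by
  obtain ⟨H, C, hC, hd, hHh, hH⟩ := hh.exists_complex hβ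
  have hlim := tendsto_euler_expansion (a := a) hh hHh hτ hB J
  have hRtop : Tendsto (fun i => τ i ^ 4 / (τ i ^ 2 + |B i|)) l atTop := by
    have h1 : Tendsto (fun i => (τ i ^ 2)⁻¹ + |B i / τ i ^ 4|) l (nhds 0) := by
      have := ((tendsto_pow_atTop (two_ne_zero)).comp hτ).inv_tendsto_atTop.add hB.abs
      simpa using this
    have h2 : Tendsto (fun i => (τ i ^ 2)⁻¹ + |B i / τ i ^ 4|) l (nhdsWithin 0 (Set.Ioi 0)) := by
      refine tendsto_nhdsWithin_iff.2 ⟨h1, ?_⟩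
      filter_upwards [hτ.eventually_gt_atTop 0] with i hi
      have : 0 < (τ i ^ 2)⁻¹ := by positivity
      have := abs_nonneg (B i / τ i ^ 4)
      simp only [Set.mem_Ioi]; linarith
    refine h2.inv_tendsto_nhdsGT_zero.congr' ?_
    filter_upwards [hτ.eventually_gt_atTop 0] with i hi
    simp only [Pi.inv_apply]
    rw [abs_div, abs_of_pos (by positivity : 0 < τ i ^ 4)]
    have := abs_nonneg (B i)
    field_simp
  have hBle : ∀ᶠ i in l, 2 ≤ τ i ∧ |B i| ≤ τ i ^ 4 := by
    have := hB.abs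
    rw [abs_zero] at this
    filter_upwards [this.eventually_lt_const one_pos, hτ.eventually_ge_atTop 2] with i hBi ht2
    have htp : 0 < τ i := by linarith
    rw [abs_div, abs_of_pos (by positivity : 0 < τ i ^ 4), div_lt_one (by positivity)] at hBi
    exact ⟨ht2, hBi.le⟩
  obtain ⟨C₁, C₂, hbd⟩ := norm_alternating_sum_sub_euler_le (C₀ := C₀) hβ hC ha hd hH J
  have herr : Tendsto (fun i => C₁ * (τ i ^ (3 * J) * Real.exp (-(β / 4) * τ i)) +
        C₂ * (τ i ^ 4 / (τ i ^ 2 + |B i|))⁻¹) l (nhds 0) := by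
    have h1 : Tendsto (fun i => τ i ^ (3 * J) * Real.exp (-(β / 4) * τ i)) l (nhds 0) := by
      have := (tendsto_rpow_mul_exp_neg_mul_atTop_nhds_zero ((3 * J : ℕ) : ℝ) (β / 4) (by positivity)).comp hτ
      refine this.congr fun i => ?_
      simp only [Function.comp]
      rw [Real.rpow_natCast]
    have := (h1.const_mul C₁).add (hRtop.inv_tendsto_atTop.const_mul C₂)
    simpa using this
  have hz := squeeze_zero_norm' (a := fun i => C₁ * (τ i ^ (3 * J) * Real.exp (-(β / 4) * τ i)) +
        C₂ * (τ i ^ 4 / (τ i ^ 2 + |B i|))⁻¹) (f := fun i => ∑ j ∈ Finset.range (N i), (-1 : ℂ) ^ j *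
          ((fun z : ℂ => z ^ J * H ((τ i ^ 8 : ℝ) - a * z ^ 2 - B i * z) /
            (expWeight β κ (τ i ^ 8) : ℝ)) (1 + j)) -
        ∑ k ∈ Finset.range (J + 3), (-1) ^ k / 2 ^ (k + 1) *
          (fwdDiff (1 : ℂ))^[k] (fun z : ℂ => z ^ J * H ((τ i ^ 8 : ℝ) - a * z ^ 2 - B i * z) /
            (expWeight β κ (τ i ^ 8) : ℝ)) 1) ?_ herr
  · have := hz.add hlim
    simp only [sub_add_cancel, zero_add] at this
    refine this.congr' ?_
    filter_upwards [hτ.eventually_ge_atTop (16 + 64 * a), hBle, hN2] with i hta hBi hN2i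
    obtain ⟨ht2, hBi⟩ := hBi
    have htp : 0 < τ i := by linarith
    push_cast
    rw [Finset.sum_div]
    refine Finset.sum_congr rfl fun j hj => ?_
    have hj' : (j : ℝ) + 1 ≤ N i := by exact_mod_cast Finset.mem_range.1 hj
    have hj0 : (0 : ℝ) < (j : ℝ) + 1 := by positivity
    have hpos : (0 : ℝ) < τ i ^ 8 - a * ((j : ℝ) + 1) ^ 2 - B i * ((j : ℝ) + 1) := by
      have e := quadratic_small ha ht2 hta hj0.le
        (by linarith [pow_pos htp 3] : (j : ℝ) + 1 ≤ 4 * τ i ^ 3) hBi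
      have e2 : B i * ((j : ℝ) + 1) ≤ |B i| * ((j : ℝ) + 1) := by gcongr; exact le_abs_self _
      have : 0 < τ i ^ 8 := by positivity
      nlinarith
    have := hHh _ hpos
    push_cast at this ⊢
    rw [add_comm (1 : ℂ), this]
    ring
  · filter_upwards [hτ.eventually_ge_atTop (16 + 64 * a), hBle, hB0, hN1, hN2,
      hRtop.eventually_gt_atTop (2 * ((J + 3 : ℕ) : ℝ))] with i hta hBi hB0i hN1i hN2i hRi
    exact hbd _ _ _ hBi.1 hta hBi.2 hB0i hN1i hN2i hRi

/-! ### Cancellation in the sum over all integers. -/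

lemma exp_neg_mul_sq_le {δ : ℝ} (hδ : 0 < δ) (m : ℕ) {t : ℝ} (ht : 0 < t) :
    Real.exp (-(δ * t ^ 2)) ≤ m.factorial / δ ^ m / t ^ (2 * m) := by
  have h := Real.pow_div_factorial_le_exp (δ * t ^ 2) (by positivity) m
  rw [div_le_iff₀ (by positivity), mul_pow, ← pow_mul] at h
  rw [Real.exp_neg, div_div, inv_le_iff_one_le_mul₀ (by positivity), div_mul_eq_mul_div,
    le_div_iff₀ (by positivity)]
  linarith

/-- Folding the range -N, …, N about 0 links the two-sided sum, where Euler's method leaves no main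
term, to one-sided sums with opposite linear coefficients. -/
lemma sum_range_symm (g : ℝ → ℝ) (N : ℕ) :
    ∑ j ∈ Finset.range (2 * N + 1), (-1 : ℝ) ^ j * g (-N + j) =
      (-1) ^ N * (g 0 - ∑ j ∈ Finset.range N, (-1 : ℝ) ^ j * (g (j + 1) + g (-(j + 1)))) := by
  induction N with
  | zero => simp
  | succ N ih =>
    rw [show 2 * (N + 1) + 1 = (2 * N + 1) + 1 + 1 by ring, Finset.sum_range_succ,
      Finset.sum_range_succ' _ (2 * N + 1), Finset.sum_range_succ _ N]
    have e : ∑ k ∈ Finset.range (2 * N + 1), (-1 : ℝ) ^ (k + 1) * g (-((N + 1 : ℕ) : ℝ) + ((k + 1 : ℕ) : ℝ))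
        = -∑ j ∈ Finset.range (2 * N + 1), (-1 : ℝ) ^ j * g (-N + j) := by
      rw [← Finset.sum_neg_distrib]
      refine Finset.sum_congr rfl fun k _ => ?_
      push_cast
      rw [show -((N : ℝ) + 1) + (k + 1) = -N + k by ring]
      ring
    rw [e, ih]
    push_cast
    rw [show -((N : ℝ) + 1) + (2 * N + 2) = N + 1 by ring,
      show (-1 : ℝ) ^ (2 * N + 2) = 1 by rw [show 2 * N + 2 = 2 * (N + 1) by ring, pow_mul]; simp]
    have h2 : ((-1 : ℝ) ^ N) * (-1) ^ N = 1 := by rw [← mul_pow]; simp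
    simp only [add_zero, pow_zero, one_mul, pow_succ]
    linear_combination (-(g (↑N + 1) + g (-(↑N + 1)))) * h2

lemma exp_neg_quadratic_le_const {β a t : ℝ} (hβ : 0 < β) (ha : 0 < a) (ht : 1 ≤ t) (B x : ℝ) :
    Real.exp (-(β / (2 * t ^ 4)) * (a * x ^ 2 / 2 + B * x)) ≤ Real.exp (β * B ^ 2 / (4 * a)) := by
  have ht4 : 1 ≤ t ^ 4 := one_le_pow₀ ht
  apply Real.exp_le_exp.2
  have e1 : -(B ^ 2 / (2 * a)) ≤ a * x ^ 2 / 2 + B * x := by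
    have : a * x ^ 2 / 2 + B * x + B ^ 2 / (2 * a) = (a * x + B) ^ 2 / (2 * a) := by
      field_simp; ring
    have : 0 ≤ (a * x + B) ^ 2 / (2 * a) := by positivity
    linarith
  have e2 : β / (2 * t ^ 4) ≤ β / 2 := by
    apply div_le_div_of_nonneg_left hβ.le (by norm_num); linarith
  have e3 : 0 ≤ β / (2 * t ^ 4) := by positivity
  have e4 : 0 ≤ B ^ 2 / (2 * a) := by positivity
  calc _ ≤ β / (2 * t ^ 4) * (B ^ 2 / (2 * a)) := by nlinarith
    _ ≤ β / 2 * (B ^ 2 / (2 * a)) := by gcongr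
    _ = _ := by field_simp; ring

/-- A quarter of a x² absorbs B x, and the other quarter is at least a t⁶/16. After division by t⁴
the exponent is of order -t², which beats the power t¹⁶ wanted below. -/
lemma exp_neg_quadratic_le_pow {β a t : ℝ} (hβ : 0 < β) (ha : 0 < a) (ht : 1 ≤ t) (B : ℝ) {x : ℝ}
    (hx : t ^ 3 / 2 ≤ |x|) :
    Real.exp (-(β / (2 * t ^ 4)) * (a * x ^ 2 / 2 + B * x)) ≤
      Nat.factorial 8 / (β * a / 32) ^ 8 * Real.exp (β * B ^ 2 / (2 * a)) / t ^ 16 := by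
  have htp : 0 < t := by linarith
  have ht4 : 1 ≤ t ^ 4 := one_le_pow₀ ht
  have hx2 : t ^ 6 / 4 ≤ x ^ 2 := by
    have := pow_le_pow_left₀ (by positivity) hx 2
    rw [sq_abs] at this
    linarith [show (t ^ 3 / 2) ^ 2 = t ^ 6 / 4 by ring]
  have e1 : a * t ^ 6 / 16 - (B ^ 2 / a) ≤ a * x ^ 2 / 2 + B * x := by
    have : a * x ^ 2 / 4 + B * x + B ^ 2 / a = (a * x + 2 * B) ^ 2 / (4 * a) := by
      field_simp; ring
    have : 0 ≤ (a * x + 2 * B) ^ 2 / (4 * a) := by positivity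
    nlinarith
  have e2 : β / (2 * t ^ 4) ≤ β / 2 := by
    apply div_le_div_of_nonneg_left hβ.le (by norm_num); linarith
  have e3 : 0 ≤ β / (2 * t ^ 4) := by positivity
  have e4 : 0 ≤ B ^ 2 / a := by positivity
  have e5 : -(β / (2 * t ^ 4)) * (a * x ^ 2 / 2 + B * x) ≤
      -(β * a / 32 * t ^ 2) + β * B ^ 2 / (2 * a) := by
    calc _ ≤ β / (2 * t ^ 4) * (B ^ 2 / a) - β / (2 * t ^ 4) * (a * t ^ 6 / 16) := by nlinarith
      _ ≤ β / 2 * (B ^ 2 / a) - β / (2 * t ^ 4) * (a * t ^ 6 / 16) := by gcongr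
      _ = _ := by field_simp; ring
  refine (Real.exp_le_exp.2 e5).trans ?_
  rw [Real.exp_add]
  refine (mul_le_mul_of_nonneg_right (exp_neg_mul_sq_le (δ := β * a / 32) (by positivity) 8 htp)
    (Real.exp_pos _).le).trans (le_of_eq ?_)
  ring

lemma norm_fwdDiff_le_symm {β κ C a t B x₀ : ℝ} {H : ℂ → ℂ} (hβ : 0 < β) (hC : 0 < C)
    (ha : 0 < a) (hd : DifferentiableOn ℂ H {w | 0 < w.re})
    (hH : ∀ w : ℂ, 0 < w.re → 1 ≤ ‖w‖ → ‖H w‖ ≤ C * expWeight β κ ‖w‖) (ht5 : 5 ≤ t)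
    (hta : 16 + 64 * a ≤ t) (hB : |B| ≤ t) (hx : |x₀| ≤ 3 * t ^ 3) {k : ℕ} (hk : k ≤ 10) :
    ‖(fwdDiff (1 : ℂ))^[k] (fun z : ℂ => H ((t ^ 8 : ℝ) - a * z ^ 2 - B * z)) x₀‖ ≤
      C * 2 ^ |κ| * Real.exp (β / 2 * (3 * a + 1)) *
        (expWeight β κ (t ^ 8) * Real.exp (-(β / (2 * t ^ 4)) * (a * x₀ ^ 2 / 2 + B * x₀))) *
        (20 / t ^ 2) ^ k := by
  have htp : 0 < t := by linarith
  have h23 : t ^ 2 ≤ t ^ 3 := pow_le_pow_right₀ (by linarith) (by norm_num)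
  have hB2 : |B| ≤ t ^ 2 := by nlinarith
  have hB4 : |B| ≤ t ^ 4 := hB2.trans (pow_le_pow_right₀ (by linarith) (by norm_num))
  have := norm_fwdDiff_le_near_real (κ := κ) (T := t ^ 8) (R := t ^ 2) (x₀ := x₀) (J := 0) (K := 10)
    hβ hC ha hd hH (by nlinarith [pow_le_pow_left₀ (by norm_num) ht5 8])
    (quadratic_small ha (by linarith) hta (by positivity) (by linarith) hB4)
    (by rw [sqrt_pow_eight]; nlinarith)
    (by rw [sqrt_pow_eight]; nlinarith [mul_le_mul_of_nonneg_right hB2 (sq_nonneg t)])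
    (by norm_num) (by push_cast; nlinarith) hk
  rw [sqrt_pow_eight, pow_zero, one_mul] at this
  simp only [pow_zero, one_mul] at this
  refine this.trans (le_of_eq ?_)
  norm_num

/-- Both ends lie near ±t³, where the summand is negligible, so all boundary terms of Euler's
transformation are small. In the remainder each tenth difference gains (20/t²)^10 and there are
O(t⁴) terms, giving t^(-16). -/
lemma abs_two_sided_sum_le {β κ g a : ℝ} {h : ℝ → ℝ} (hβ : 0 < β) (ha : 0 < a)
    (hh : IsExpSum β κ g h) (B : ℝ) :
    ∃ C₁ : ℝ, ∀ (t : ℝ) (N : ℕ), 5 ≤ t → 16 + 64 * a ≤ t → |B| ≤ t →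
      t ^ 3 / 2 ≤ N → N ≤ 2 * t ^ 3 →
      |∑ j ∈ Finset.range (2 * N + 1), (-1 : ℝ) ^ j *
          h (t ^ 8 - a * (-N + j) ^ 2 - B * (-N + j))| ≤ C₁ * (expWeight β κ (t ^ 8) / t ^ 16) := by
  obtain ⟨H, C, hC, hd, hHh, hH⟩ := hh.exists_complex hβ
  obtain ⟨A, hA⟩ : ∃ A, A = C * 2 ^ |κ| * Real.exp (β / 2 * (3 * a + 1)) := ⟨_, rfl⟩
  have hAp : 0 < A := by rw [hA]; positivity
  obtain ⟨D, hD⟩ : ∃ D, D = Nat.factorial 8 / (β * a / 32) ^ 8 * Real.exp (β * B ^ 2 / (2 * a)) :=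
    ⟨_, rfl⟩
  obtain ⟨E, hE⟩ : ∃ E, E = Real.exp (β * B ^ 2 / (4 * a)) := ⟨_, rfl⟩
  have hDp : 0 < D := by rw [hD]; positivity
  -- The 20 counts ten boundary terms at each end; the 5 comes from 2N + 1 ≤ 5t⁴.
  refine ⟨20 * (A * D) + 5 * (A * E * 20 ^ 10), ?_⟩
  intro t N ht5 hta hB hN1 hN2
  have htp : 0 < t := by linarith
  have h3 : (1 : ℝ) ≤ t ^ 3 := one_le_pow₀ (by linarith)
  have hB4 : |B| ≤ t ^ 4 := hB.trans (le_self_pow₀ (by linarith) (by norm_num))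
  have hmain : ∀ x₀ : ℝ, |x₀| ≤ 3 * t ^ 3 → ∀ k ≤ 10, _ := fun x₀ hx k hk =>
    norm_fwdDiff_le_symm (κ := κ) hβ hC ha hd hH ht5 hta hB hx hk
  rw [← hA] at hmain
  have hFp : 0 < expWeight β κ (t ^ 8) := expWeight_pos (by positivity)
  have hexp1 := exp_neg_quadratic_le_const hβ ha (by linarith : 1 ≤ t) B
  rw [← hE] at hexp1
  have hexp2 : ∀ x₀ : ℝ, t ^ 3 / 2 ≤ |x₀| → _ := fun x₀ hx =>
    exp_neg_quadratic_le_pow hβ ha (by linarith : 1 ≤ t) B hx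
  rw [← hD] at hexp2
  obtain ⟨G, hG⟩ : ∃ G : ℂ → ℂ, G = fun z => H ((t ^ 8 : ℝ) - a * z ^ 2 - B * z) := ⟨_, rfl⟩
  rw [← hG] at hmain
  have hsum : ((∑ j ∈ Finset.range (2 * N + 1), (-1 : ℝ) ^ j *
        h (t ^ 8 - a * (-N + j) ^ 2 - B * (-N + j)) : ℝ) : ℂ) =
      ∑ j ∈ Finset.range (2 * N + 1), (-1 : ℂ) ^ j * G (((-(N : ℝ) : ℝ) : ℂ) + j) := by
    push_cast
    refine Finset.sum_congr rfl fun j hj => ?_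
    have hjN : (j : ℝ) ≤ 2 * N := by
      have := Finset.mem_range.1 hj
      exact_mod_cast Nat.lt_succ_iff.1 this
    have hx : |(-(N : ℝ) + j)| ≤ 4 * t ^ 3 := by
      have : (0 : ℝ) ≤ j := j.cast_nonneg
      rw [abs_le]; constructor <;> linarith
    have hpos : (0 : ℝ) < t ^ 8 - a * (-N + j) ^ 2 - B * (-N + j) := by
      have e := quadratic_small ha (by linarith) hta (abs_nonneg _) hx hB4
      have e2 : B * (-(N : ℝ) + j) ≤ |B| * |(-(N : ℝ) + j)| := by
        rw [← abs_mul]; exact le_abs_self _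
      have : 0 < t ^ 8 := by positivity
      nlinarith [sq_abs (-(N : ℝ) + j)]
    have := hHh _ hpos
    simp only [hG]
    push_cast at this ⊢
    rw [this]
  rw [← Real.norm_eq_abs, ← Complex.norm_real, hsum]
  clear hsum hG
  generalize expWeight β κ (t ^ 8) = F at *
  have hbd : ∀ x₀ : ℝ, t ^ 3 / 2 ≤ |x₀| → |x₀| ≤ 3 * t ^ 3 → ∀ k < 10,
      ‖(fwdDiff (1 : ℂ))^[k] G x₀‖ ≤ A * (F * (D / t ^ 16)) := by
    intro x₀ h1 h2 k hk
    refine (hmain x₀ h2 k hk.le).trans ?_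
    have f1 : (20 / t ^ 2) ^ k ≤ 1 := by
      apply pow_le_one₀ (by positivity)
      rw [div_le_one (by positivity)]; nlinarith
    have := hexp2 x₀ h1
    calc _ ≤ A * (F * (D / t ^ 16)) * 1 := by gcongr
      _ = _ := mul_one _
  have hNabs : |(-(N : ℝ))| = N := by rw [abs_neg, abs_of_nonneg N.cast_nonneg]
  have hend : ∀ k < 10, ‖(fwdDiff (1 : ℂ))^[k] G (((-(N : ℝ) : ℝ) : ℂ) + (2 * N + 1 : ℕ))‖ ≤
      A * (F * (D / t ^ 16)) := by
    intro k hk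
    have hx : |(-(N : ℝ)) + ((2 * N + 1 : ℕ) : ℝ)| = N + 1 := by
      push_cast
      rw [show -(N : ℝ) + (2 * N + 1) = N + 1 by ring, abs_of_pos (by positivity)]
    have := hbd (-N + (2 * N + 1 : ℕ)) (by rw [hx]; linarith) (by rw [hx]; linarith) k hk
    rwa [Complex.ofReal_add, Complex.ofReal_natCast] at this
  have hmid : ∀ j < 2 * N + 1, ‖(fwdDiff (1 : ℂ))^[10] G (((-(N : ℝ) : ℝ) : ℂ) + j)‖ ≤
      A * (F * E) * (20 / t ^ 2) ^ 10 := by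
    intro j hj
    have hjN : (j : ℝ) ≤ 2 * N := by exact_mod_cast Nat.lt_succ_iff.1 hj
    have hx : |(-(N : ℝ) + j)| ≤ 3 * t ^ 3 := by
      have : (0 : ℝ) ≤ j := j.cast_nonneg
      rw [abs_le]; constructor <;> linarith
    have := hmain _ hx 10 le_rfl
    have h2 := hexp1 (-N + j)
    rw [Complex.ofReal_add, Complex.ofReal_natCast] at this
    refine this.trans ?_
    refine mul_le_mul_of_nonneg_right ?_ (by positivity)
    exact mul_le_mul_of_nonneg_left (mul_le_mul_of_nonneg_left h2 hFp.le) hAp.le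
  have hfin := norm_alternating_sum_sub_le (K := 10) hend hmid
  have hstart : ‖∑ k ∈ Finset.range 10, (-1) ^ k / 2 ^ (k + 1) *
      (fwdDiff (1 : ℂ))^[k] G ((-(N : ℝ) : ℝ) : ℂ)‖ ≤ 10 * (A * (F * (D / t ^ 16))) := by
    refine (norm_sum_le _ _).trans ?_
    have : ∀ k ∈ Finset.range 10, ‖(-1) ^ k / 2 ^ (k + 1) *
        (fwdDiff (1 : ℂ))^[k] G ((-(N : ℝ) : ℝ) : ℂ)‖ ≤ A * (F * (D / t ^ 16)) := by
      intro k hk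
      have h1 := hbd (-N) (by rw [hNabs]; exact hN1) (by rw [hNabs]; linarith) k (Finset.mem_range.1 hk)
      have h2 : ‖(-1 : ℂ) ^ k / 2 ^ (k + 1)‖ ≤ 1 := by
        simp only [norm_div, norm_pow, norm_neg, norm_one, one_pow, Complex.norm_ofNat]
        rw [div_le_one (by positivity)]
        exact one_le_pow₀ (by norm_num)
      rw [norm_mul]
      nlinarith [norm_nonneg ((fwdDiff (1 : ℂ))^[k] G ((-(N : ℝ) : ℝ) : ℂ))]
    refine (Finset.sum_le_sum this).trans (le_of_eq ?_)
    rw [Finset.sum_const, Finset.card_range, nsmul_eq_mul]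
    norm_num
  have htri : ∀ u v : ℂ, ‖u‖ ≤ ‖u - v‖ + ‖v‖ := fun u v => by simpa using norm_add_le (u - v) v
  refine (htri _ _).trans ((add_le_add hfin hstart).trans ?_)
  have hN5 : ((2 * N + 1 : ℕ) : ℝ) ≤ 5 * t ^ 4 := by
    have : t ^ 3 ≤ t ^ 4 := pow_le_pow_right₀ (by linarith) (by norm_num)
    push_cast; linarith
  rw [Finset.sum_const, Finset.card_range, nsmul_eq_mul]
  have hE0 : 0 ≤ E := by rw [hE]; positivity
  have h1 : ((2 * N + 1 : ℕ) : ℝ) * (A * (F * E) * (20 / t ^ 2) ^ 10) ≤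
      5 * t ^ 4 * (A * (F * E) * (20 / t ^ 2) ^ 10) :=
    mul_le_mul_of_nonneg_right hN5 (by positivity)
  have e : 5 * t ^ 4 * (A * (F * E) * (20 / t ^ 2) ^ 10) =
      5 * (A * E * 20 ^ 10) * (F / t ^ 16) := by
    rw [div_pow]
    generalize (20 : ℝ) ^ 10 = c
    field_simp
  rw [e] at h1
  refine (add_le_add_left (add_le_add_right h1 _) _).trans (le_of_eq ?_)
  generalize (20 : ℝ) ^ 10 = c
  push_cast
  ring

lemma abs_one_sided_symm_sum_le {β κ g a : ℝ} {h : ℝ → ℝ} (hβ : 0 < β) (ha : 0 < a)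
    (hh : IsExpSum β κ g h) (B : ℝ) :
    ∃ C₁ : ℝ, ∀ (t : ℝ) (N : ℕ), 5 ≤ t → 16 + 64 * a ≤ t → |B| ≤ t →
      t ^ 3 / 2 ≤ N → N ≤ 2 * t ^ 3 →
      |h (t ^ 8) - ∑ j ∈ Finset.range N, (-1 : ℝ) ^ j *
          (h (t ^ 8 - a * (j + 1) ^ 2 - B * (j + 1)) + h (t ^ 8 - a * (j + 1) ^ 2 + B * (j + 1)))|
        ≤ C₁ * (expWeight β κ (t ^ 8) / t ^ 16) := by
  obtain ⟨C₁, hC⟩ := abs_two_sided_sum_le hβ ha hh B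
  refine ⟨C₁, fun t N h1 h2 h3 h4 h5 => ?_⟩
  have := hC t N h1 h2 h3 h4 h5
  rw [sum_range_symm (fun x => h (t ^ 8 - a * x ^ 2 - B * x)), abs_mul, abs_pow, abs_neg, abs_one,
    one_pow, one_mul] at this
  simpa only [mul_neg, sub_neg_eq_add, neg_sq, ne_eq, OfNat.ofNat_ne_zero, not_false_eq_true,
    zero_pow, mul_zero, sub_zero] using this

/-! ### Replacing f by a finite exponential sum. -/

/-- Because f vanishes on the negative axis, any upper limit beyond the index set will do. One range
thus serves all shifts u, and differences can be taken termwise. -/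
lemma altSum_eq_sum_range {f : ℝ → ℝ} (hf : ∀ x, x < 0 → f x = 0) {a : ℝ} (ha : 0 < a) {b X : ℝ}
    {M : ℕ} (hM : ∀ n : ℕ, M < n → X < a * (n : ℝ) ^ 2 + b * n) :
    altSum f a b X = ∑ j ∈ Finset.range M, (-1 : ℝ) ^ j *
      f (X - (a * ((j : ℝ) + 1) ^ 2 + b * ((j : ℝ) + 1))) := by
  classical
  rw [altSum, finsum_mem_eq_finite_toFinset_sum _ (altSumIndices_finite ha b X)]
  have : (altSumIndices_finite ha b X).toFinset ⊆ (Finset.range M).image (· + 1) := by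
    intro n hn
    rw [Set.Finite.mem_toFinset] at hn
    obtain ⟨h1, h2⟩ := hn
    rw [Finset.mem_image]
    refine ⟨n - 1, ?_, by omega⟩
    rw [Finset.mem_range]
    by_contra! hle
    have := hM n (by omega)
    linarith
  rw [Finset.sum_subset this, Finset.sum_image (by simp)]
  · refine Finset.sum_congr rfl fun j _ => by simp
  · intro n hn hn'
    rw [Set.Finite.mem_toFinset] at hn'
    obtain ⟨j, -, rfl⟩ := Finset.mem_image.1 hn
    have : X < a * ((j + 1 : ℕ) : ℝ) ^ 2 + b * ((j + 1 : ℕ) : ℝ) := by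
      by_contra! hle
      exact hn' ⟨by omega, hle⟩
    rw [hf _ (by linarith), mul_zero]

lemma IsPartitionLike.exists_crude_bound {f : ℝ → ℝ} {β κ : ℝ} {γ : ℕ → ℝ}
    (hf : IsPartitionLike f β κ γ) :
    ∃ (C : ℝ) (m : ℕ) (X₀ : ℝ), 0 < C ∧ ∀ X, X₀ ≤ X → ∀ x, x ≤ 2 * X →
      |f x| ≤ C * X ^ m * (expWeight β κ X * Real.exp (β / (2 * √X) * (x - X))) := by
  have hβ := hf.beta_pos
  obtain ⟨c, hc⟩ := (hf.expansion 0).bound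
  obtain ⟨x₀, hx₀⟩ := eventually_atTop.1 hc
  set x₁ := max x₀ 1
  obtain ⟨C', hC'⟩ := hf.locally_bounded x₁ (by positivity)
  -- Far below X the powers x^(-κ) and X^(-κ) are not comparable. The factor X^m covers the
  -- discrepancy, since |κ| ≤ 2|κ| - κ.
  set m := ⌈2 * |κ|⌉₊ with hm
  refine ⟨|c| * 2 ^ |κ| + |C'| + 1, m, 1, by positivity, fun X hX x hx => ?_⟩
  have hXp : 0 < X := by linarith
  have hs : 0 < √X := Real.sqrt_pos.2 hXp
  have hsX : √X * √X = X := Real.mul_self_sqrt hXp.le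
  have hm2 : X ^ (2 * |κ|) ≤ X ^ m := by
    rw [← Real.rpow_natCast]
    exact Real.rpow_le_rpow_of_exponent_le hX (Nat.le_ceil _)
  have hκ : X ^ |κ| ≤ X ^ m * X ^ (-κ) := by
    calc X ^ |κ| ≤ X ^ (2 * |κ| + -κ) := by
          apply Real.rpow_le_rpow_of_exponent_le hX
          have := le_abs_self κ; linarith
      _ = X ^ (2 * |κ|) * X ^ (-κ) := Real.rpow_add hXp _ _
      _ ≤ _ := by gcongr
  have hFp : 0 < expWeight β κ X := expWeight_pos hXp
  set W := X ^ m * (expWeight β κ X * Real.exp (β / (2 * √X) * (x - X))) with hW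
  have hWp : 0 < W := by positivity
  have hWe : W = (X ^ m * X ^ (-κ)) * Real.exp (β * √X + β / (2 * √X) * (x - X)) := by
    rw [hW, Real.exp_add, expWeight]; ring
  have goal_of : ∀ K, 0 ≤ K → K ≤ |c| * 2 ^ |κ| + |C'| + 1 → |f x| ≤ K * W →
      |f x| ≤ (|c| * 2 ^ |κ| + |C'| + 1) * X ^ m * (expWeight β κ X * Real.exp (β / (2 * √X) * (x - X))) := by
    intro K _ h2 h3
    rw [mul_assoc]
    exact h3.trans (by gcongr)
  have hc2 : 0 ≤ |c| * 2 ^ |κ| := by positivity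
  rcases lt_or_ge x 0 with hneg | hnn
  · refine goal_of 0 le_rfl (by positivity) ?_
    rw [hf.eq_zero_of_neg x hneg]; simp
  rcases le_total x x₁ with hle | hge
  · refine goal_of |C'| (abs_nonneg _) (by linarith) ?_
    have h1 : |f x| ≤ |C'| := (hC' x (by rwa [abs_of_nonneg hnn])).trans (le_abs_self _)
    have h2 : 1 ≤ W := by
      rw [hWe]
      have e1 : 1 ≤ X ^ m * X ^ (-κ) := (Real.one_le_rpow hX (abs_nonneg κ)).trans hκ
      have e2 : 1 ≤ Real.exp (β * √X + β / (2 * √X) * (x - X)) := by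
        rw [Real.one_le_exp_iff]
        have : β * √X + β / (2 * √X) * (x - X) = β * (X + x) / (2 * √X) := by
          field_simp
          linear_combination 2 * hsX
        rw [this]; positivity
      nlinarith
    nlinarith [abs_nonneg C']
  · refine goal_of (|c| * 2 ^ |κ|) hc2 (by linarith [abs_nonneg C']) ?_
    have hx1 : 1 ≤ x := (le_max_right _ _).trans hge
    have hxp : 0 < x := by linarith
    have h1 := hx₀ x ((le_max_left _ _).trans hge)
    simp only [Finset.range_zero, Finset.sum_empty, mul_zero, sub_zero, CharP.cast_eq_zero, zero_div,
      neg_zero, Real.rpow_zero, mul_one, Real.norm_eq_abs] at h1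
    rw [abs_of_pos (by positivity : 0 < Real.exp (β * √x) / x ^ κ)] at h1
    have h2 : Real.exp (β * √x) / x ^ κ ≤ 2 ^ |κ| * W := by
      rw [hWe, div_eq_mul_inv, ← Real.rpow_neg hxp.le]
      have e1 : Real.exp (β * √x) ≤ Real.exp (β * √X + β / (2 * √X) * (x - X)) := by
        apply Real.exp_le_exp.2
        have := mul_le_mul_of_nonneg_left (sqrt_le_tangent hXp hnn) hβ.le
        calc _ ≤ _ := this
          _ = _ := by ring
      have e2 : x ^ (-κ) ≤ 2 ^ |κ| * (X ^ m * X ^ (-κ)) := by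
        calc x ^ (-κ) ≤ x ^ |κ| := Real.rpow_le_rpow_of_exponent_le hx1 (neg_le_abs κ)
          _ ≤ (2 * X) ^ |κ| := Real.rpow_le_rpow hxp.le hx (abs_nonneg κ)
          _ = 2 ^ |κ| * X ^ |κ| := Real.mul_rpow (by norm_num) hXp.le
          _ ≤ _ := by gcongr
      calc _ ≤ Real.exp (β * √X + β / (2 * √X) * (x - X)) * (2 ^ |κ| * (X ^ m * X ^ (-κ))) := by gcongr
        _ = _ := by ring
    calc |f x| ≤ c * (Real.exp (β * √x) / x ^ κ) := h1
      _ ≤ |c| * (Real.exp (β * √x) / x ^ κ) := by gcongr; exact le_abs_self c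
      _ ≤ |c| * (2 ^ |κ| * W) := by gcongr
      _ = _ := by ring

lemma HasSqrtExpExpansion.exists_isExpSum {f : ℝ → ℝ} {β κ : ℝ} {γ : ℕ → ℝ}
    (hf : HasSqrtExpExpansion f β κ γ) (N : ℕ) :
    ∃ φ, IsExpSum β κ (γ 0) φ ∧ ∃ C x₀ : ℝ, 0 < C ∧
      ∀ x, x₀ ≤ x → |f x - φ x| ≤ C * expWeight β (κ + ((N + 1 : ℕ) : ℝ) / 2) x := by
  refine ⟨fun x => ∑ n ∈ Finset.range (N + 1), γ n * expWeight β (κ + (n : ℝ) / 2) x,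
    ⟨N, γ, rfl, fun x _ => rfl⟩, ?_⟩
  obtain ⟨c, hc⟩ := (hf (N + 1)).bound
  obtain ⟨x₀, hx₀⟩ := eventually_atTop.1 hc
  refine ⟨|c| + 1, max x₀ 1, by positivity, fun x hx => ?_⟩
  have hxp : 0 < x := by linarith [le_max_right x₀ 1]
  have h1 := hx₀ x ((le_max_left _ _).trans hx)
  have e1 : Real.exp (β * √x) / x ^ κ = expWeight β κ x := by
    rw [expWeight, Real.rpow_neg hxp.le, div_eq_mul_inv]
  have hF := expWeight_pos (β := β) (κ := κ) hxp
  rw [Real.norm_eq_abs, Real.norm_eq_abs, e1, Finset.mul_sum] at h1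
  have e2 : ∑ n ∈ Finset.range (N + 1), γ n * expWeight β (κ + (n : ℝ) / 2) x =
      ∑ n ∈ Finset.range (N + 1), expWeight β κ x * (γ n / x ^ ((n : ℝ) / 2)) := by
    refine Finset.sum_congr rfl fun n _ => ?_
    rw [expWeight_add hxp, Real.rpow_neg hxp.le]; ring
  simp only [e2]
  rw [expWeight_add hxp, mul_comm (x ^ _)]
  have hp : 0 < expWeight β κ x * x ^ (-(((N + 1 : ℕ) : ℝ) / 2)) := by positivity
  rw [abs_of_pos hp] at h1
  exact h1.trans (by gcongr; linarith [le_abs_self c])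

/-- Inside the window the argument is comparable with t⁸, and eight terms of the expansion leave a
relative error t^(-32), of which t^(-24) is kept. Outside, the crude bound carries a factor
exp(-δt²). -/
lemma exists_term_approx {f φ : ℝ → ℝ} {β κ C₁ C₂ x₀ X₀ a : ℝ} {m : ℕ} (hβ : 0 < β) (hC₁ : 0 < C₁)
    (hC₂ : 0 < C₂)
    (hx₀ : ∀ x, x₀ ≤ x → |f x - φ x| ≤ C₁ * expWeight β (κ + ((7 + 1 : ℕ) : ℝ) / 2) x)
    (hX₀ : ∀ X, X₀ ≤ X → ∀ x, x ≤ 2 * X →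
      |f x| ≤ C₂ * X ^ m * (expWeight β κ X * Real.exp (β / (2 * √X) * (x - X))))
    (ha : 0 < a) (μ : ℝ) :
    ∃ C t₀ : ℝ, 0 < C ∧ 2 ≤ t₀ ∧ (1 + 2 * |μ|) / a ≤ t₀ ∧
      ∀ t, t₀ ≤ t → ∀ b, 0 ≤ b → ∀ u, |u| ≤ 2 → ∀ j : ℕ,
      |f (t ^ 8 - a * ((j : ℝ) + 1) ^ 2 - b * j - u * μ * ((j : ℝ) + 1)) -
        if j < ⌈t ^ 3⌉₊ ∧ b * j ≤ t ^ 8 / 8 then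
          φ (t ^ 8 - a * ((j : ℝ) + 1) ^ 2 - b * j - u * μ * ((j : ℝ) + 1)) else 0| ≤
      C * (expWeight β κ (t ^ 8) / t ^ 24) := by
  -- A term leaves the window in two ways: j ≥ t³ gives the rate aβ/4 through the quadratic term,
  -- and bj > t⁸/8 gives β/16 through the linear one.
  set δ := min (a * β / 4) (β / 16) with hδ
  have hδp : 0 < δ := by positivity
  set E := Real.exp (β * μ ^ 2 / a) with hE
  set D₁ := C₁ * 2 ^ |κ + ((7 + 1 : ℕ) : ℝ) / 2| * E with hD₁
  set D₂ := C₂ * (E * ((4 * m + 12).factorial / δ ^ (4 * m + 12))) with hD₂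
  have hD₁p : 0 < D₁ := by positivity
  have hD₂p : 0 < D₂ := by positivity
  refine ⟨D₁ + D₂, max (max 2 X₀) (max (max (2 * x₀) (32 * a + 32 * |μ|)) ((1 + 2 * |μ|) / a)), by positivity,
    (le_max_left _ _).trans (le_max_left _ _), (le_max_right _ _).trans (le_max_right _ _), ?_⟩
  intro t ht b hb u hu
  simp only [max_le_iff] at ht
  obtain ⟨⟨ht2, htX⟩, ⟨htx, hta⟩, htμ⟩ := ht
  have htp : 0 < t := by linarith
  have ht8 : t ≤ t ^ 8 := le_self_pow₀ (by linarith) (by norm_num)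
  have hF := expWeight_pos (β := β) (κ := κ) (by positivity : 0 < t ^ 8)
  have hμ0 := abs_nonneg μ
  have huμ : ∀ n : ℝ, 0 ≤ n → |u * μ * n| ≤ 2 * |μ| * n := by
    intro n hn
    rw [abs_mul, abs_mul, abs_of_nonneg hn]
    gcongr
  have hquad : ∀ n : ℝ, 0 ≤ n → -(2 * μ ^ 2 / a) + a * n ^ 2 / 2 ≤ a * n ^ 2 + u * μ * n := by
    intro n hn
    have h1 := (abs_le.1 (huμ n hn)).1
    have h2 : a * n ^ 2 / 2 - 2 * |μ| * n + 2 * μ ^ 2 / a = (a * n - 2 * |μ|) ^ 2 / (2 * a) := by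
      rw [← sq_abs μ]; field_simp; ring
    have h3 : 0 ≤ (a * n - 2 * |μ|) ^ 2 / (2 * a) := by positivity
    linarith
  have ht4 : 1 ≤ t ^ 4 := one_le_pow₀ (by linarith)
  have hc0 : 0 < β / (2 * t ^ 4) := by positivity
  have hc1 : β / (2 * t ^ 4) * (2 * μ ^ 2 / a) ≤ β * μ ^ 2 / a := by
    have : β / (2 * t ^ 4) ≤ β / 2 := by
      apply div_le_div_of_nonneg_left hβ.le (by norm_num); linarith
    calc _ ≤ β / 2 * (2 * μ ^ 2 / a) := by gcongr
      _ = _ := by field_simp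
  intro j
  set x := t ^ 8 - a * ((j : ℝ) + 1) ^ 2 - b * j - u * μ * ((j : ℝ) + 1) with hx
  have hj0 : (0 : ℝ) ≤ j := j.cast_nonneg
  have hq := hquad (j + 1) (by positivity)
  have hbj : 0 ≤ b * j := by positivity
  split_ifs with hcond
  · obtain ⟨hj, hbj'⟩ := hcond
    have hn : (j : ℝ) + 1 ≤ 2 * t ^ 3 := by
      have h1 : (j : ℝ) + 1 ≤ ⌈t ^ 3⌉₊ := by exact_mod_cast hj
      have h2 := (Nat.ceil_lt_add_one (by positivity : 0 ≤ t ^ 3)).le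
      have h3 : 1 ≤ t ^ 3 := one_le_pow₀ (by linarith)
      linarith
    have hbig : a * ((j : ℝ) + 1) ^ 2 + 2 * |μ| * ((j : ℝ) + 1) ≤ t ^ 8 / 8 := by
      have h36 : t ^ 3 ≤ t ^ 6 := pow_le_pow_right₀ (by linarith) (by norm_num)
      calc _ ≤ a * (2 * t ^ 3) ^ 2 + 2 * |μ| * (2 * t ^ 3) := by gcongr
        _ = 4 * a * t ^ 6 + 4 * |μ| * t ^ 3 := by ring
        _ ≤ 4 * a * t ^ 6 + 4 * |μ| * t ^ 6 := by gcongr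
        _ = (32 * a + 32 * |μ|) / 8 * t ^ 6 := by ring
        _ ≤ t / 8 * t ^ 6 := by gcongr
        _ = t ^ 7 / 8 := by ring
        _ ≤ _ := by gcongr <;> linarith
    have hm := abs_le.1 (huμ (j + 1) (by positivity))
    have ha' : 0 ≤ a * ((j : ℝ) + 1) ^ 2 := by positivity
    have h8 : 0 < t ^ 8 := by positivity
    have hxl : t ^ 8 / 2 ≤ x := by rw [hx]; linarith
    have hxu : x ≤ 2 * t ^ 8 := by rw [hx]; linarith
    have h1 := hx₀ x (by linarith)
    have h2 := expWeight_le (κ := κ + ((7 + 1 : ℕ) : ℝ) / 2) hβ h8 hxl hxu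
    rw [sqrt_pow_eight] at h2
    have h3 : Real.exp (β / (2 * t ^ 4) * (x - t ^ 8)) ≤ E := by
      apply Real.exp_le_exp.2
      refine le_trans ?_ hc1
      gcongr
      rw [hx]
      have : 0 ≤ a * ((j : ℝ) + 1) ^ 2 / 2 := by positivity
      linarith
    have h4 : expWeight β (κ + ((7 + 1 : ℕ) : ℝ) / 2) (t ^ 8) ≤ expWeight β κ (t ^ 8) / t ^ 24 := by
      rw [expWeight_add h8, show -(((7 + 1 : ℕ) : ℝ) / 2) = -((4 : ℕ) : ℝ) by norm_num,
        Real.rpow_neg h8.le, Real.rpow_natCast, inv_mul_eq_div, ← pow_mul]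
      gcongr <;> linarith
    have hp := expWeight_pos (β := β) (κ := κ + ((7 + 1 : ℕ) : ℝ) / 2) h8
    calc _ ≤ C₁ * (2 ^ |κ + ((7 + 1 : ℕ) : ℝ) / 2| * (expWeight β κ (t ^ 8) / t ^ 24 * E)) := by
          refine h1.trans ?_
          gcongr
          refine h2.trans ?_
          gcongr
      _ = D₁ * (expWeight β κ (t ^ 8) / t ^ 24) := by rw [hD₁]; ring
      _ ≤ _ := by gcongr; linarith
  · rw [sub_zero]
    have hxu : x ≤ 2 * t ^ 8 := by
      have h1 : 0 < t ^ 8 := by positivity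
      have h2 := hquad (j + 1) (by positivity)
      have h3 : 2 * μ ^ 2 / a ≤ t ^ 8 := by
        rw [div_le_iff₀ ha]
        have e1 : 2 * |μ| ≤ a * t := by
          rw [div_le_iff₀ ha] at htμ; linarith
        have e2 : |μ| ≤ t := by linarith
        have e3 : t ^ 2 ≤ t ^ 8 := pow_le_pow_right₀ (by linarith) (by norm_num)
        rw [← sq_abs]
        have e4 : 2 * |μ| * |μ| ≤ a * t * t := mul_le_mul e1 e2 hμ0 (by positivity)
        nlinarith
      have : 0 ≤ a * ((j : ℝ) + 1) ^ 2 / 2 := by positivity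
      rw [hx]; linarith
    have h1 := hX₀ (t ^ 8) (by linarith) x hxu
    rw [sqrt_pow_eight] at h1
    have h2 : Real.exp (β / (2 * t ^ 4) * (x - t ^ 8)) ≤ E * Real.exp (-(δ * t ^ 2)) := by
      rw [hE, ← Real.exp_add]
      apply Real.exp_le_exp.2
      have hlow : δ * t ^ 2 ≤ β / (2 * t ^ 4) * (a * ((j : ℝ) + 1) ^ 2 / 2 + b * j) := by
        rcases lt_or_ge j ⌈t ^ 3⌉₊ with hjl | hjg
        · have hb8 : t ^ 8 / 8 ≤ b * j := by
            by_contra! hlt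
            exact hcond ⟨hjl, hlt.le⟩
          have e1 : t ^ 2 ≤ t ^ 4 := pow_le_pow_right₀ (by linarith) (by norm_num)
          calc δ * t ^ 2 ≤ β / 16 * t ^ 4 := by gcongr; exact min_le_right _ _
            _ = β / (2 * t ^ 4) * (t ^ 8 / 8) := by field_simp; ring
            _ ≤ _ := by
              gcongr
              have : 0 ≤ a * ((j : ℝ) + 1) ^ 2 / 2 := by positivity
              linarith
        · have e1 : t ^ 3 ≤ (j : ℝ) + 1 := by
            have := Nat.le_of_ceil_le hjg
            linarith
          calc δ * t ^ 2 ≤ a * β / 4 * t ^ 2 := by gcongr; exact min_le_left _ _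
            _ = β / (2 * t ^ 4) * (a * (t ^ 3) ^ 2 / 2) := by field_simp; ring
            _ ≤ β / (2 * t ^ 4) * (a * ((j : ℝ) + 1) ^ 2 / 2) := by gcongr
            _ ≤ _ := by gcongr; linarith
      have e : x - t ^ 8 ≤ 2 * μ ^ 2 / a - (a * ((j : ℝ) + 1) ^ 2 / 2 + b * j) := by
        rw [hx]; linarith
      have := mul_le_mul_of_nonneg_left e hc0.le
      rw [mul_sub] at this
      linarith
    -- The exponent 2(4m + 12) = 8m + 24 pays for (t⁸)^m and for t²⁴.
    have h3 := exp_neg_mul_sq_le hδp (4 * m + 12) htp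
    calc _ ≤ C₂ * (t ^ 8) ^ m * (expWeight β κ (t ^ 8) * (E *
          ((4 * m + 12).factorial / δ ^ (4 * m + 12) / t ^ (2 * (4 * m + 12))))) := by
          refine h1.trans ?_
          gcongr
          refine h2.trans ?_
          gcongr
      _ = D₂ * (expWeight β κ (t ^ 8) / t ^ 24) := by
          rw [hD₂, ← pow_mul, show 2 * (4 * m + 12) = 8 * m + 24 by ring, pow_add t (8 * m) 24]
          field_simp
      _ ≤ _ := by gcongr; linarith

lemma exists_altSum_approx {f : ℝ → ℝ} {β κ : ℝ} {γ : ℕ → ℝ} (hf : IsPartitionLike f β κ γ)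
    {a : ℝ} (ha : 0 < a) (μ : ℝ) :
    ∃ φ, IsExpSum β κ (γ 0) φ ∧ Tendsto (fun x => f x / expWeight β κ x) atTop (nhds (γ 0)) ∧
      ∃ C t₀ : ℝ, ∀ t, t₀ ≤ t → ∀ b, 0 ≤ b → ∀ u, |u| ≤ 2 →
        |altSum f a (b + u * μ) (t ^ 8 + b) - ∑ j ∈ Finset.range ⌈t ^ 3⌉₊,
          if b * j ≤ t ^ 8 / 8 then (-1 : ℝ) ^ j * φ (t ^ 8 - a * ((j : ℝ) + 1) ^ 2 - b * j -
            u * μ * ((j : ℝ) + 1)) else 0| ≤ C * (expWeight β κ (t ^ 8) / t ^ 16) := by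
  have hβ := hf.beta_pos
  obtain ⟨φ, hφ, C₁, x₀, hC₁, hx₀⟩ := hf.expansion.exists_isExpSum 7
  obtain ⟨C₂, m, X₀, hC₂, hX₀⟩ := hf.exists_crude_bound
  refine ⟨φ, hφ, ?_, ?_⟩
  · have h1 : Tendsto (fun x => (f x - φ x) / expWeight β κ x) atTop (nhds 0) := by
      have h2 : Tendsto (fun x : ℝ => C₁ * x ^ (-(((7 + 1 : ℕ) : ℝ) / 2))) atTop (nhds 0) := by
        rw [← mul_zero C₁]
        exact (tendsto_rpow_neg_atTop (by positivity)).const_mul _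
      refine squeeze_zero_norm' ?_ h2
      filter_upwards [eventually_ge_atTop x₀, eventually_gt_atTop 0] with x hx hxp
      have hF := expWeight_pos (β := β) (κ := κ) hxp
      rw [norm_div, Real.norm_eq_abs, Real.norm_eq_abs, abs_of_pos hF, div_le_iff₀ hF]
      refine (hx₀ x hx).trans (le_of_eq ?_)
      rw [expWeight_add hxp]; ring
    have := h1.add hφ.tendsto_div_self
    simp only [← add_div, sub_add_cancel, zero_add] at this
    exact this
  obtain ⟨C, t₀, hCp, ht₀, htμ₀, hterm'⟩ := exists_term_approx hβ hC₁ hC₂ hx₀ hX₀ ha μ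
  refine ⟨2 * C, t₀, ?_⟩
  intro t ht b hb u hu
  have hterm := hterm' t ht b hb u hu
  have ht2 : 2 ≤ t := ht₀.trans ht
  have htμ := htμ₀.trans ht
  have htp : 0 < t := by linarith
  have ht8 : t ≤ t ^ 8 := le_self_pow₀ (by linarith) (by norm_num)
  have hF := expWeight_pos (β := β) (κ := κ) (by positivity : 0 < t ^ 8)
  have hμ0 := abs_nonneg μ
  have huμ : ∀ n : ℝ, 0 ≤ n → |u * μ * n| ≤ 2 * |μ| * n := by
    intro n hn
    rw [abs_mul, abs_mul, abs_of_nonneg hn]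
    gcongr
  -- A wasteful cutoff suffices: O(t⁸) terms with error t^(-24) each add up to t^(-16).
  set M := ⌈t ^ 8⌉₊ with hM
  have hNM : ⌈t ^ 3⌉₊ ≤ M := Nat.ceil_mono (pow_le_pow_right₀ (by linarith) (by norm_num))
  rw [altSum_eq_sum_range hf.eq_zero_of_neg ha (M := M)]
  · have e1 : ∑ j ∈ Finset.range ⌈t ^ 3⌉₊,
          (if b * j ≤ t ^ 8 / 8 then (-1 : ℝ) ^ j * φ (t ^ 8 - a * ((j : ℝ) + 1) ^ 2 - b * j -
            u * μ * ((j : ℝ) + 1)) else 0) = ∑ j ∈ Finset.range M,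
          (-1 : ℝ) ^ j * if j < ⌈t ^ 3⌉₊ ∧ b * j ≤ t ^ 8 / 8 then φ (t ^ 8 - a * ((j : ℝ) + 1) ^ 2 - b * j -
            u * μ * ((j : ℝ) + 1)) else 0 := by
      rw [← Finset.sum_subset (Finset.range_mono hNM)]
      · refine Finset.sum_congr rfl fun j hj => ?_
        simp only [Finset.mem_range.1 hj, true_and, mul_ite, mul_zero]
      · intro j _ hj
        rw [Finset.mem_range] at hj
        simp [hj]
    rw [e1, ← Finset.sum_sub_distrib]
    refine (Finset.abs_sum_le_sum_abs _ _).trans ?_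
    have e2 : ∀ j ∈ Finset.range M, |(-1 : ℝ) ^ j *
        f (t ^ 8 + b - (a * ((j : ℝ) + 1) ^ 2 + (b + u * μ) * ((j : ℝ) + 1))) -
        (-1 : ℝ) ^ j * (if j < ⌈t ^ 3⌉₊ ∧ b * j ≤ t ^ 8 / 8 then
          φ (t ^ 8 - a * ((j : ℝ) + 1) ^ 2 - b * j - u * μ * ((j : ℝ) + 1)) else 0)| ≤
        C * (expWeight β κ (t ^ 8) / t ^ 24) := by
      intro j _
      rw [← mul_sub, abs_mul, abs_pow, abs_neg, abs_one, one_pow, one_mul,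
        show t ^ 8 + b - (a * ((j : ℝ) + 1) ^ 2 + (b + u * μ) * ((j : ℝ) + 1)) =
          t ^ 8 - a * ((j : ℝ) + 1) ^ 2 - b * j - u * μ * ((j : ℝ) + 1) by ring]
      exact hterm j
    refine (Finset.sum_le_sum e2).trans ?_
    rw [Finset.sum_const, Finset.card_range, nsmul_eq_mul]
    have e3 : (M : ℝ) ≤ 2 * t ^ 8 := by
      have := (Nat.ceil_lt_add_one (by positivity : 0 ≤ t ^ 8)).le
      linarith
    calc _ ≤ 2 * t ^ 8 * (C * (expWeight β κ (t ^ 8) / t ^ 24)) := by gcongr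
      _ = _ := by field_simp
  · intro n hn
    have h1 : t ^ 8 ≤ n := (Nat.le_ceil _).trans (by exact_mod_cast hn.le)
    have hn1 : (1 : ℝ) ≤ n := by linarith
    have h2 := (abs_le.1 (huμ n (by linarith))).1
    have h3 : 1 + 2 * |μ| ≤ a * n := by
      rw [div_le_iff₀ ha] at htμ
      nlinarith
    have h4 : b ≤ b * n := by nlinarith
    have hlt : t ^ 8 < n := by
      have : t ^ 8 ≤ M := Nat.le_ceil _
      have h7 : (M : ℝ) < n := by exact_mod_cast hn
      linarith
    have h8 := mul_le_mul_of_nonneg_right h3 (by linarith : (0 : ℝ) ≤ n)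
    linarith [show a * (n : ℝ) * n = a * n ^ 2 by ring]

/-! ### Mean values, and the alternating sum as a function of its linear coefficient. -/

/-- Mean value theorem for iterated forward differences. -/
lemma exists_fwdDiff_iter_eq (J : ℕ) : ∀ (D : ℕ → ℝ → ℝ) (P : Set ℝ), Convex ℝ P →
    (∀ k < J, ∀ x ∈ P, HasDerivAt (D k) (D (k + 1) x) x) → ∀ x s : ℝ, x ∈ P → x + J * s ∈ P →
    ∃ θ ∈ Set.Icc (0 : ℝ) J, (fwdDiff s)^[J] (D 0) x = s ^ J * D J (x + θ * s) := by
  induction J with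
  | zero => intro D P _ _ x s _ _; exact ⟨0, by simp, by simp⟩
  | succ J ih =>
    intro D P hP hD x s hx hxs
    have hmem : ∀ r : ℝ, 0 ≤ r → r ≤ J + 1 → x + r * s ∈ P := by
      intro r h0 h1
      have hJ : (0 : ℝ) < J + 1 := by positivity
      have := hP.add_smul_sub_mem hx hxs (t := r / (J + 1))
        ⟨by positivity, (div_le_one hJ).2 h1⟩
      convert this using 2
      push_cast
      simp only [smul_eq_mul]
      field_simp
      ring
    have hJ0 : (0 : ℝ) ≤ J := J.cast_nonneg
    -- Induction is applied to the first differences of all the D k, on the convex set of points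
    -- whose translate by s also lies in P. The ordinary mean value theorem then handles the
    -- remaining difference of D J.
    obtain ⟨θ, ⟨hθ0, hθ1⟩, hθ⟩ := ih (fun k y => D k (y + s) - D k y) {y | y ∈ P ∧ y + s ∈ P}
      (by
        refine hP.inter ?_
        exact hP.translate_preimage_left s)
      (fun k hk y hy => ((hD k (by omega) (y + s) hy.2).comp_add_const y s).sub
        (hD k (by omega) y hy.1)) x s
      ⟨hx, by simpa using hmem 1 zero_le_one (by linarith)⟩
      ⟨hmem J hJ0 (by linarith), by
        have := hmem (J + 1) (by positivity) le_rfl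
        rwa [add_mul, one_mul, ← add_assoc] at this⟩
    obtain ⟨r, hr, hr'⟩ := exists_hasDerivAt_eq_slope (fun r => D J (x + θ * s + r * s))
      (fun r => D (J + 1) (x + θ * s + r * s) * s) (zero_lt_one' ℝ)
      (fun r hr => by
        have hm := hmem (θ + r) (by linarith [hr.1]) (by linarith [hr.2])
        rw [add_mul, ← add_assoc] at hm
        have h1 : HasDerivAt (fun r => x + θ * s + r * s) s r := by
          simpa using ((hasDerivAt_id r).mul_const s).const_add (x + θ * s)
        exact ((hD J (by omega) _ hm).comp r h1).continuousAt.continuousWithinAt)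
      (fun r hr => by
        have hm := hmem (θ + r) (by linarith [hr.1]) (by linarith [hr.2])
        rw [add_mul, ← add_assoc] at hm
        have h1 : HasDerivAt (fun r => x + θ * s + r * s) s r := by
          simpa using ((hasDerivAt_id r).mul_const s).const_add (x + θ * s)
        exact (hD J (by omega) _ hm).comp r h1)
    refine ⟨θ + r, ⟨by linarith [hr.1], by push_cast; linarith [hr.2]⟩, ?_⟩
    rw [Function.iterate_succ_apply]
    change (fwdDiff s)^[J] (fun y => D 0 (y + s) - D 0 y) x = _
    rw [hθ]
    simp only [one_mul, zero_mul, add_zero, sub_zero, div_one] at hr'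
    rw [← hr', add_mul, ← add_assoc]
    ring

/-- The `k`-th derivative in `v` of `∑ (-1)^j φ (T - a (j + 1)^2 - v (j + 1))`, where `D k` is the
`k`-th derivative of `φ`. -/
noncomputable def altDerivSum (D : ℕ → ℝ → ℝ) (a T : ℝ) (N k : ℕ) (v : ℝ) : ℝ :=
  ∑ j ∈ Finset.range N, (-1 : ℝ) ^ j *
    ((-((j : ℝ) + 1)) ^ k * D k (T - a * ((j : ℝ) + 1) ^ 2 - v * ((j : ℝ) + 1)))

lemma ceil_cube_le {t : ℝ} (ht : 1 ≤ t) : (⌈t ^ 3⌉₊ : ℝ) ≤ 2 * t ^ 3 := by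
  have h1 : 1 ≤ t ^ 3 := one_le_pow₀ ht
  have := (Nat.ceil_lt_add_one (by positivity : 0 ≤ t ^ 3)).le
  linarith

lemma hasDerivAt_altDerivSum {D : ℕ → ℝ → ℝ}
    (hD : ∀ j x, 0 < x → HasDerivAt (D j) (D (j + 1) x) x) {a t b v : ℝ} (ha : 0 < a) (ht2 : 2 ≤ t)
    (hta : 16 + 64 * a ≤ t) (hb : 0 ≤ b) (hv : |v| ≤ t ^ 4) (k : ℕ) :
    HasDerivAt (altDerivSum D a (t ^ 8 + b) ⌈t ^ 3⌉₊ k)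
      (altDerivSum D a (t ^ 8 + b) ⌈t ^ 3⌉₊ (k + 1) v) v := by
  unfold altDerivSum
  refine HasDerivAt.fun_sum fun j hj => ?_
  have hj' : (j : ℝ) + 1 ≤ ⌈t ^ 3⌉₊ := by exact_mod_cast Finset.mem_range.1 hj
  have hj0 : (0 : ℝ) ≤ (j : ℝ) + 1 := by positivity
  have hN := ceil_cube_le (by linarith : 1 ≤ t)
  have h3 : 0 < t ^ 3 := by positivity
  have hpos : 0 < t ^ 8 + b - a * ((j : ℝ) + 1) ^ 2 - v * ((j : ℝ) + 1) := by
    have e := quadratic_small ha ht2 hta hj0 (by linarith) hv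
    have e2 : v * ((j : ℝ) + 1) ≤ |v| * ((j : ℝ) + 1) := by gcongr; exact le_abs_self _
    have : 0 < t ^ 8 := by positivity
    nlinarith
  have h1 : HasDerivAt (fun v : ℝ => t ^ 8 + b - a * ((j : ℝ) + 1) ^ 2 - v * ((j : ℝ) + 1))
      (-((j : ℝ) + 1)) v := by
    simpa using ((hasDerivAt_id v).mul_const ((j : ℝ) + 1)).const_sub
      (t ^ 8 + b - a * ((j : ℝ) + 1) ^ 2)
  have h2 := (((hD k _ hpos).comp v h1).const_mul ((-((j : ℝ) + 1)) ^ k)).const_mul ((-1 : ℝ) ^ j)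
  refine h2.congr_deriv ?_
  ring

/-- The k-th derivative of φ has leading coefficient g(β/2)^k and a weight smaller by t^(-4k), and
the factors (j+1)^k are summed by Euler's method. -/
lemma tendsto_altDerivSum {ι : Type*} {l : Filter ι} {β κ g a C₀ A : ℝ} {D : ℕ → ℝ → ℝ}
    (hβ : 0 < β) (ha : 0 < a) (hD : ∀ j : ℕ, IsExpSum β (κ + j / 2) (g * (β / 2) ^ j) (D j))
    {t b v : ι → ℝ} (ht : Tendsto t l atTop) (hb0 : ∀ i, 0 ≤ b i)
    (hb : Tendsto (fun i => b i / t i ^ 4) l (nhds 0)) (hv0 : ∀ᶠ i in l, -C₀ ≤ v i)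
    (hv : Tendsto (fun i => v i / t i ^ 4) l (nhds 0)) {k : ℕ} (hA : eulerConst k = (A : ℂ)) :
    Tendsto (fun i => altDerivSum D a (t i ^ 8 + b i) ⌈t i ^ 3⌉₊ k (v i) * t i ^ (4 * k) /
      expWeight β κ (t i ^ 8)) l (nhds ((-(β / 2)) ^ k * g * A)) := by
  -- The base point is T = t⁸ + b = τ⁸. As b = o(t⁴), the cutoff ⌈t³⌉ stays comparable with τ³ and
  -- the weights at T and t⁸ are asymptotically equal.
  set τ : ι → ℝ := fun i => (t i ^ 8 + b i) ^ (1 / 8 : ℝ) with hτ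
  have hτ8 : ∀ i, τ i ^ 8 = t i ^ 8 + b i := by
    intro i
    have : 0 ≤ t i ^ 8 + b i := by have := hb0 i; positivity
    rw [hτ]
    simp only
    rw [← Real.rpow_natCast, ← Real.rpow_mul this]
    norm_num
  have hτ0 : ∀ i, 0 ≤ τ i := fun i => by
    have : 0 ≤ t i ^ 8 + b i := by have := hb0 i; positivity
    positivity
  have hτt : ∀ i, t i ≤ τ i := fun i =>
    le_of_pow_le_pow_left₀ (n := 8) (by norm_num) (hτ0 i) (by rw [hτ8]; linarith [hb0 i])
  have hτtop : Tendsto τ l atTop := tendsto_atTop_mono hτt ht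
  have hvτ : Tendsto (fun i => v i / τ i ^ 4) l (nhds 0) := by
    refine squeeze_zero_norm' ?_ (by simpa using hv.abs)
    filter_upwards [ht.eventually_gt_atTop 0] with i hi
    have : 0 < τ i := hi.trans_le (hτt i)
    rw [Real.norm_eq_abs, abs_div, abs_div, abs_of_pos (by positivity : 0 < t i ^ 4),
      abs_of_pos (by positivity : 0 < τ i ^ 4)]
    gcongr
    exact hτt i
  have hN1 : ∀ᶠ i in l, τ i ^ 3 / 2 ≤ (⌈t i ^ 3⌉₊ : ℝ) := by
    filter_upwards [ht.eventually_ge_atTop 1, hb.eventually_lt_const one_pos] with i hi hbi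
    have hp : 0 < t i := by linarith
    rw [div_lt_one (by positivity)] at hbi
    have h1 : τ i ^ 8 ≤ 2 * t i ^ 8 := by
      rw [hτ8]
      have : t i ^ 4 ≤ t i ^ 8 := pow_le_pow_right₀ hi (by norm_num)
      linarith
    have h2 : τ i ^ 3 ≤ 2 * t i ^ 3 := by
      refine le_of_pow_le_pow_left₀ (n := 8) (by norm_num) (by positivity) ?_
      calc (τ i ^ 3) ^ 8 = (τ i ^ 8) ^ 3 := by ring
        _ ≤ (2 * t i ^ 8) ^ 3 := by gcongr
        _ = 8 * t i ^ 24 := by ring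
        _ ≤ 256 * t i ^ 24 := by gcongr; norm_num
        _ = _ := by ring
    have := Nat.le_ceil (t i ^ 3)
    linarith
  have hN2 : ∀ᶠ i in l, (⌈t i ^ 3⌉₊ : ℝ) ≤ 2 * τ i ^ 3 := by
    filter_upwards [ht.eventually_ge_atTop 1] with i hi
    have h1 := ceil_cube_le hi
    have h2 : t i ^ 3 ≤ τ i ^ 3 := by gcongr; exact hτt i
    linarith
  have hmain := tendsto_alternating_sum hβ ha (hD k) hτtop hvτ hv0 hN1 hN2 k
  rw [hA, ← Complex.ofReal_mul] at hmain
  have hre := (Complex.continuous_re.tendsto _).comp hmain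
  simp only [Function.comp_def, Complex.ofReal_re] at hre
  have hX : Tendsto (fun i => t i ^ 8) l atTop := (tendsto_pow_atTop (by norm_num)).comp ht
  have hratio := tendsto_expWeight_div (β := β) (κ := κ + k / 2) (t := 0) (X := fun i => t i ^ 8)
    (y := fun i => τ i ^ 8) hX (by
      refine hb.congr fun i => ?_
      rw [hτ8, sqrt_pow_eight]; ring)
  rw [mul_zero, Real.exp_zero] at hratio
  have := (hre.mul hratio).const_mul ((-1) ^ k)
  rw [show (-1) ^ k * (g * (β / 2) ^ k * A * 1) = (-(β / 2)) ^ k * g * A by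
    rw [neg_pow (β / 2)]; ring] at this
  refine this.congr' ?_
  filter_upwards [ht.eventually_ge_atTop 1] with i hi
  have hp : 0 < t i := by linarith
  have hpτ : 0 < τ i := hp.trans_le (hτt i)
  have h8 : 0 < t i ^ 8 := by positivity
  have hF1 := expWeight_pos (β := β) (κ := κ + k / 2) (by positivity : 0 < τ i ^ 8)
  have hF2 := expWeight_pos (β := β) (κ := κ + k / 2) h8
  have e1 : expWeight β (κ + k / 2) (t i ^ 8) = expWeight β κ (t i ^ 8) / t i ^ (4 * k) := by
    rw [expWeight_add h8, Real.rpow_neg h8.le, inv_mul_eq_div, ← Real.rpow_natCast (t i) 8,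
      ← Real.rpow_mul hp.le, ← Real.rpow_natCast (t i) (4 * k)]
    congr 2
    push_cast; ring
  have e2 : altDerivSum D a (t i ^ 8 + b i) ⌈t i ^ 3⌉₊ k (v i) = (-1) ^ k *
      ∑ j ∈ Finset.range ⌈t i ^ 3⌉₊, (-1 : ℝ) ^ j * (((j : ℝ) + 1) ^ k *
      D k (τ i ^ 8 - a * ((j : ℝ) + 1) ^ 2 - v i * ((j : ℝ) + 1))) := by
    rw [altDerivSum, Finset.mul_sum, hτ8]
    refine Finset.sum_congr rfl fun j _ => ?_
    rw [neg_pow ((j : ℝ) + 1)]; ring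
  rw [e1] at hF2
  rw [e1, e2]
  generalize (∑ j ∈ Finset.range ⌈t i ^ 3⌉₊, (-1 : ℝ) ^ j * (((j : ℝ) + 1) ^ k *
      D k (τ i ^ 8 - a * ((j : ℝ) + 1) ^ 2 - v i * ((j : ℝ) + 1)))) = S
  generalize expWeight β (κ + k / 2) (τ i ^ 8) = F₁ at *
  field_simp

/-! ### The window sum when q has a limit below 1. -/

/-- The terms of the alternating sum, as a function of the shift `u`, whose argument stays
comparable with `t ^ 8`. -/
noncomputable def windowSum (φ : ℝ → ℝ) (a μ t b u : ℝ) : ℝ :=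
  ∑ j ∈ Finset.range ⌈t ^ 3⌉₊, if b * j ≤ t ^ 8 / 8 then
    (-1 : ℝ) ^ j * φ (t ^ 8 - a * ((j : ℝ) + 1) ^ 2 - b * j - u * μ * ((j : ℝ) + 1)) else 0

/-- The mean value theorem in u pulls out (-μ(j+1))^J. In the bound the quadratic term absorbs the
shift θμ(j+1) at the cost of a constant, so that only the geometric decay in b j is left. -/
lemma exists_window_term {β κ g a : ℝ} {D : ℕ → ℝ → ℝ} (hβ : 0 < β) (ha : 0 < a)
    (hD : ∀ j : ℕ, IsExpSum β (κ + j / 2) (g * (β / 2) ^ j) (D j))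
    (hD' : ∀ j x, 0 < x → HasDerivAt (D j) (D (j + 1) x) x) (μ : ℝ) (J : ℕ) :
    ∃ C t₀ : ℝ, 0 < C ∧ ∀ t, t₀ ≤ t → ∀ b, 0 ≤ b → ∀ j : ℕ, j < ⌈t ^ 3⌉₊ → b * j ≤ t ^ 8 / 8 →
      ∃ ξ, |ξ - (t ^ 8 - b * j)| ≤ a * ((j : ℝ) + 1) ^ 2 + J * |μ| * ((j : ℝ) + 1) ∧
      (fwdDiff (1 : ℝ))^[J] (fun u => D 0 (t ^ 8 - a * ((j : ℝ) + 1) ^ 2 - b * j -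
        u * μ * ((j : ℝ) + 1))) 0 = (-(μ * ((j : ℝ) + 1))) ^ J * D J ξ ∧
      |D J ξ| ≤ C * (expWeight β κ (t ^ 8) / t ^ (4 * J)) * Real.exp (-(β / (2 * t ^ 4)) * b) ^ j := by
  obtain ⟨C, hC, hbd⟩ := (hD J).exists_bound hβ
  refine ⟨C * 2 ^ |κ + J / 2| * Real.exp (β * J ^ 2 * μ ^ 2 / (8 * a)),
    max 2 (32 * a + 16 * J * |μ|), by positivity, ?_⟩
  intro t ht b hb j hj hbj
  obtain ⟨ht2, hta⟩ := max_le_iff.1 ht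
  have htp : 0 < t := by linarith
  have h8 : 0 < t ^ 8 := by positivity
  have hn := ceil_cube_le (by linarith : 1 ≤ t)
  have hj' : (j : ℝ) + 1 ≤ 2 * t ^ 3 := by
    have : (j : ℝ) + 1 ≤ ⌈t ^ 3⌉₊ := by exact_mod_cast hj
    linarith
  set n : ℝ := (j : ℝ) + 1 with hndef
  have hn0 : 0 < n := by positivity
  have hμ0 := abs_nonneg μ
  have hJ0 : (0 : ℝ) ≤ J := J.cast_nonneg
  have hbig : a * n ^ 2 + J * |μ| * n ≤ t ^ 8 / 8 := by
    have h36 : t ^ 3 ≤ t ^ 6 := pow_le_pow_right₀ (by linarith) (by norm_num)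
    calc _ ≤ a * (2 * t ^ 3) ^ 2 + J * |μ| * (2 * t ^ 3) := by gcongr
      _ = 4 * a * t ^ 6 + 2 * J * |μ| * t ^ 3 := by ring
      _ ≤ 4 * a * t ^ 6 + 2 * J * |μ| * t ^ 6 := by gcongr
      _ = (32 * a + 16 * J * |μ|) / 8 * t ^ 6 := by ring
      _ ≤ t / 8 * t ^ 6 := by gcongr
      _ = t ^ 7 / 8 := by ring
      _ ≤ _ := by gcongr <;> linarith
  have harg : ∀ u : ℝ, 0 ≤ u → u ≤ J → |u * μ * n| ≤ J * |μ| * n := by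
    intro u h0 h1
    rw [abs_mul, abs_mul, abs_of_nonneg h0, abs_of_pos hn0]
    gcongr
  have han : 0 ≤ a * n ^ 2 := by positivity
  have hpos : ∀ u ∈ Set.Icc (0 : ℝ) J, t ^ 8 / 2 ≤ t ^ 8 - a * n ^ 2 - b * j - u * μ * n := by
    intro u hu
    have := (abs_le.1 (harg u hu.1 hu.2)).2
    linarith
  obtain ⟨θ, hθ, hmv⟩ := exists_fwdDiff_iter_eq J
    (fun k u => (-(μ * n)) ^ k * D k (t ^ 8 - a * n ^ 2 - b * j - u * μ * n)) (Set.Icc 0 J)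
    (convex_Icc _ _) (fun k _ u hu => by
      have h1 : HasDerivAt (fun u : ℝ => t ^ 8 - a * n ^ 2 - b * j - u * μ * n) (-(μ * n)) u := by
        simpa [mul_assoc] using (((hasDerivAt_id u).mul_const (μ * n)).const_sub
          (t ^ 8 - a * n ^ 2 - b * j))
      refine (((hD' k _ (by linarith [hpos u hu])).comp u h1).const_mul _).congr_deriv ?_
      ring) 0 1 ⟨le_rfl, hJ0⟩ (by simp)
  simp only [pow_zero, one_mul, one_pow, zero_add, mul_one] at hmv
  have habs := harg θ hθ.1 hθ.2
  set ξ := t ^ 8 - a * n ^ 2 - b * j - θ * μ * n with hξ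
  refine ⟨ξ, ?_, hmv, ?_⟩
  · rw [show ξ - (t ^ 8 - b * j) = -(a * n ^ 2 + θ * μ * n) by rw [hξ]; ring, abs_neg]
    refine (abs_add_le _ _).trans ?_
    rw [abs_of_nonneg han]
    gcongr
  · have hl := hpos θ hθ
    have hbj0 : 0 ≤ b * j := by positivity
    have hu : ξ ≤ 2 * t ^ 8 := by
      have := (abs_le.1 habs).1
      rw [hξ]; linarith
    have h1 : 1 ≤ ξ := by
      have : (2 : ℝ) ^ 8 ≤ t ^ 8 := pow_le_pow_left₀ (by norm_num) ht2 8
      linarith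
    have h2 := expWeight_le (κ := κ + J / 2) hβ h8 hl hu
    rw [sqrt_pow_eight] at h2
    have e1 : expWeight β (κ + J / 2) (t ^ 8) = expWeight β κ (t ^ 8) / t ^ (4 * J) := by
      rw [expWeight_add h8, Real.rpow_neg h8.le, inv_mul_eq_div, ← Real.rpow_natCast t 8,
        ← Real.rpow_mul htp.le, ← Real.rpow_natCast t (4 * J)]
      congr 2
      push_cast; ring
    have h3 : Real.exp (β / (2 * t ^ 4) * (ξ - t ^ 8)) ≤
        Real.exp (β * J ^ 2 * μ ^ 2 / (8 * a)) * Real.exp (-(β / (2 * t ^ 4)) * b) ^ j := by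
      rw [← Real.exp_nat_mul, ← Real.exp_add]
      apply Real.exp_le_exp.2
      have e2 : ξ - t ^ 8 ≤ J ^ 2 * μ ^ 2 / (4 * a) - b * j := by
        have f1 := (abs_le.1 habs).1
        have f2 : J ^ 2 * μ ^ 2 / (4 * a) + a * n ^ 2 - J * |μ| * n =
            (2 * a * n - J * |μ|) ^ 2 / (4 * a) := by
          rw [← sq_abs μ]; field_simp; ring
        have f3 : 0 ≤ (2 * a * n - J * |μ|) ^ 2 / (4 * a) := by positivity
        rw [hξ]; linarith
      have ht4 : 1 ≤ t ^ 4 := one_le_pow₀ (by linarith)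
      have e3 : β / (2 * t ^ 4) ≤ β / 2 := by
        apply div_le_div_of_nonneg_left hβ.le (by norm_num); linarith
      calc β / (2 * t ^ 4) * (ξ - t ^ 8) ≤ β / (2 * t ^ 4) * (J ^ 2 * μ ^ 2 / (4 * a) - b * j) := by
            gcongr
        _ = β / (2 * t ^ 4) * (J ^ 2 * μ ^ 2 / (4 * a)) + j * (-(β / (2 * t ^ 4)) * b) := by ring
        _ ≤ β / 2 * (J ^ 2 * μ ^ 2 / (4 * a)) + j * (-(β / (2 * t ^ 4)) * b) := by gcongr
        _ = _ := by congr 1; field_simp; ring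
    rw [e1] at h2
    have hF := expWeight_pos (β := β) (κ := κ) h8
    calc |D J ξ| ≤ C * expWeight β (κ + J / 2) ξ := hbd ξ h1
      _ ≤ C * (2 ^ |κ + J / 2| * (expWeight β κ (t ^ 8) / t ^ (4 * J) *
          (Real.exp (β * J ^ 2 * μ ^ 2 / (8 * a)) * Real.exp (-(β / (2 * t ^ 4)) * b) ^ j))) := by
          gcongr
          refine h2.trans ?_
          gcongr
      _ = _ := by ring

lemma fwdDiff_iter_windowSum (φ : ℝ → ℝ) (a μ t b : ℝ) (J : ℕ) :
    (fwdDiff (1 : ℝ))^[J] (windowSum φ a μ t b) 0 = ∑ j ∈ Finset.range ⌈t ^ 3⌉₊,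
      if b * j ≤ t ^ 8 / 8 then (-1 : ℝ) ^ j * (fwdDiff (1 : ℝ))^[J] (fun u =>
        φ (t ^ 8 - a * ((j : ℝ) + 1) ^ 2 - b * j - u * μ * ((j : ℝ) + 1))) 0 else 0 := by
  simp only [fwdDiff_iter_eq_sum_shift, windowSum, Finset.smul_sum]
  rw [Finset.sum_comm]
  refine Finset.sum_congr rfl fun j _ => ?_
  split_ifs
  · rw [Finset.mul_sum]
    refine Finset.sum_congr rfl fun k _ => ?_
    rw [mul_smul_comm]
  · simp

lemma tendsto_window_term {ι : Type*} {l : Filter ι} {β κ g q : ℝ} {D : ℕ → ℝ → ℝ} (hβ : 0 < β)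
    (hD : ∀ j : ℕ, IsExpSum β (κ + j / 2) (g * (β / 2) ^ j) (D j)) {t b ξ : ι → ℝ} {c : ℝ}
    (ht : Tendsto t l atTop)
    (hbq : Tendsto (fun i => Real.exp (-(β / (2 * t i ^ 4)) * b i)) l (nhds q)) (j J : ℕ)
    (hq : j = 0 ∨ 0 < q) (hξ : ∀ᶠ i in l, |ξ i - (t i ^ 8 - b i * j)| ≤ c) :
    Tendsto (fun i => D J (ξ i) * t i ^ (4 * J) / expWeight β κ (t i ^ 8)) l
      (nhds (g * (β / 2) ^ J * q ^ j)) := by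
  have hX : Tendsto (fun i => t i ^ 8) l atTop := (tendsto_pow_atTop (by norm_num)).comp ht
  have hinv : Tendsto (fun i => (t i ^ 4)⁻¹) l (nhds 0) :=
    ((tendsto_pow_atTop (by norm_num)).comp ht).inv_tendsto_atTop
  -- For j ≥ 1 and q > 0 the limit of b/t⁴ is recovered as -(2/β) log q. For j = 0 the shift is 0
  -- and b may grow freely.
  obtain ⟨s, hs, hsq⟩ : ∃ s, Tendsto (fun i => b i * j / t i ^ 4) l (nhds s) ∧
      Real.exp (β / 2 * -s) = q ^ j := by
    rcases Nat.eq_zero_or_pos j with rfl | hj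
    · exact ⟨0, by simpa using tendsto_const_nhds, by simp⟩
    · have hq0 : 0 < q := hq.resolve_left hj.ne'
      have h1 := ((Real.continuousAt_log hq0.ne').tendsto.comp hbq).const_mul (-(2 / β) * j)
      refine ⟨-(2 / β) * j * Real.log q, h1.congr fun i => ?_, ?_⟩
      · simp only [Function.comp, Real.log_exp]
        field_simp
      · rw [show β / 2 * -(-(2 / β) * j * Real.log q) = j * Real.log q by field_simp,
          Real.exp_nat_mul, Real.exp_log hq0]
  have hy : Tendsto (fun i => (ξ i - t i ^ 8) / √(t i ^ 8)) l (nhds (-s)) := by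
    have h1 : Tendsto (fun i => (ξ i - (t i ^ 8 - b i * j)) * (t i ^ 4)⁻¹) l (nhds 0) := by
      refine squeeze_zero_norm' (a := fun i => c * (t i ^ 4)⁻¹) ?_ (by simpa using hinv.const_mul c)
      filter_upwards [hξ, ht.eventually_gt_atTop 0] with i hi hti
      rw [norm_mul, Real.norm_eq_abs, Real.norm_eq_abs,
        abs_of_pos (by positivity : 0 < (t i ^ 4)⁻¹)]
      gcongr
    have h2 := h1.sub hs
    rw [zero_sub] at h2
    refine h2.congr fun i => ?_
    rw [sqrt_pow_eight]
    ring
  have := (hD J).tendsto_div hX hy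
  rw [hsq] at this
  refine this.congr' ?_
  filter_upwards [ht.eventually_gt_atTop 0] with i hti
  have h8 : 0 < t i ^ 8 := by positivity
  have e1 : expWeight β (κ + J / 2) (t i ^ 8) = expWeight β κ (t i ^ 8) / t i ^ (4 * J) := by
    rw [expWeight_add h8, Real.rpow_neg h8.le, inv_mul_eq_div, ← Real.rpow_natCast (t i) 8,
      ← Real.rpow_mul hti.le, ← Real.rpow_natCast (t i) (4 * J)]
    congr 2
    push_cast; ring
  rw [e1]
  field_simp

/-- Dominated convergence with majorant (j+1)^J r^j for some q < r < 1, up to a constant. The bound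
on b j implicit in q > 0 puts every fixed j eventually inside the window. -/
lemma tendsto_fwdDiff_windowSum {ι : Type*} {l : Filter ι} {β κ g a q : ℝ} {D : ℕ → ℝ → ℝ}
    (hβ : 0 < β) (ha : 0 < a) (hD : ∀ j : ℕ, IsExpSum β (κ + j / 2) (g * (β / 2) ^ j) (D j))
    (hD' : ∀ j x, 0 < x → HasDerivAt (D j) (D (j + 1) x) x) (μ : ℝ) (J : ℕ) {t b : ι → ℝ}
    (ht : Tendsto t l atTop) (hb0 : ∀ i, 0 ≤ b i)
    (hbq : Tendsto (fun i => Real.exp (-(β / (2 * t i ^ 4)) * b i)) l (nhds q)) (hq0 : 0 ≤ q)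
    (hq1 : q < 1) :
    Tendsto (fun i => (fwdDiff (1 : ℝ))^[J] (windowSum (D 0) a μ (t i) (b i)) 0 * t i ^ (4 * J) /
      expWeight β κ (t i ^ 8)) l
      (nhds (∑' j : ℕ, (-1) ^ j * ((-(μ * ((j : ℝ) + 1))) ^ J * (g * (β / 2) ^ J * q ^ j)))) := by
  obtain ⟨C, t₀, hC, hterm⟩ := exists_window_term hβ ha hD hD' μ J
  set T : ι → ℕ → ℝ := fun i j => if j < ⌈t i ^ 3⌉₊ ∧ b i * j ≤ t i ^ 8 / 8 then
    (-1 : ℝ) ^ j * (fwdDiff (1 : ℝ))^[J] (fun u =>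
        D 0 (t i ^ 8 - a * ((j : ℝ) + 1) ^ 2 - b i * j - u * μ * ((j : ℝ) + 1))) 0 * t i ^ (4 * J) /
          expWeight β κ (t i ^ 8) else 0 with hT
  have hTb : ∀ᶠ i in l, ∀ j, |T i j| ≤ C * |μ| ^ J * ((j : ℝ) + 1) ^ J *
      Real.exp (-(β / (2 * t i ^ 4)) * b i) ^ j := by
    filter_upwards [ht.eventually_ge_atTop t₀, ht.eventually_gt_atTop 0] with i hi hti j
    simp only [hT]
    have hF := expWeight_pos (β := β) (κ := κ) (by positivity : 0 < t i ^ 8)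
    split_ifs with hc
    · obtain ⟨ξ, -, h2, h3⟩ := hterm (t i) hi (b i) (hb0 i) j hc.1 hc.2
      rw [h2, abs_div, abs_mul, abs_mul, abs_mul, abs_pow, abs_neg, abs_one, one_pow, one_mul,
        abs_pow, abs_neg, abs_mul, abs_of_pos hF, abs_of_pos (by positivity : 0 < t i ^ (4 * J)),
        abs_of_pos (by positivity : (0 : ℝ) < (j : ℝ) + 1), div_le_iff₀ hF]
      calc _ ≤ (|μ| * ((j : ℝ) + 1)) ^ J * (C * (expWeight β κ (t i ^ 8) / t i ^ (4 * J)) *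
            Real.exp (-(β / (2 * t i ^ 4)) * b i) ^ j) * t i ^ (4 * J) := by gcongr
        _ = _ := by rw [mul_pow]; field_simp
    · rw [abs_zero]; positivity
  obtain ⟨r, hqr, hr1⟩ := exists_between hq1
  have hr0 : 0 < r := hq0.trans_lt hqr
  have hsum : Summable (fun j : ℕ => C * |μ| ^ J * ((j : ℝ) + 1) ^ J * r ^ j) := by
    have h1 := summable_pow_mul_geometric_of_norm_lt_one (R := ℝ) J (r := r)
      (by rwa [Real.norm_eq_abs, abs_of_pos hr0])
    have h2 := ((summable_nat_add_iff 1).2 h1).mul_left (C * |μ| ^ J / r)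
    refine h2.congr fun j => ?_
    push_cast
    rw [pow_succ]
    field_simp
  have hlim : Tendsto (fun i => ∑' j, T i j) l
      (nhds (∑' j : ℕ, (-1) ^ j * ((-(μ * ((j : ℝ) + 1))) ^ J * (g * (β / 2) ^ J * q ^ j)))) := by
    refine tendsto_tsum_of_dominated_convergence hsum (fun j => ?_) ?_
    · by_cases hj : j = 0 ∨ 0 < q
      · have hmem : ∀ᶠ i in l, j < ⌈t i ^ 3⌉₊ ∧ b i * j ≤ t i ^ 8 / 8 := by
          have h1 : Tendsto (fun i => t i ^ 3) l atTop := (tendsto_pow_atTop (by norm_num)).comp ht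
          have h2 : ∀ᶠ i in l, b i * j ≤ t i ^ 8 / 8 := by
            rcases Nat.eq_zero_or_pos j with rfl | hjp
            · filter_upwards [ht.eventually_gt_atTop 0] with i hi
              simp only [CharP.cast_eq_zero, mul_zero]
              positivity
            · have hqp := hj.resolve_left hjp.ne'
              have h4 : Tendsto (fun i => t i ^ 4) l atTop := (tendsto_pow_atTop (by norm_num)).comp ht
              filter_upwards [hbq.eventually_const_lt (half_lt_self hqp), ht.eventually_gt_atTop 0,
                h4.eventually_ge_atTop (8 * (-(2 / β) * Real.log (q / 2)) * j)] with i hi hti h4i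
              have h5 := Real.log_lt_log (by positivity) hi
              rw [Real.log_exp] at h5
              have h6 : b i ≤ (-(2 / β) * Real.log (q / 2)) * t i ^ 4 := by
                have : b i = -(2 / β) * (-(β / (2 * t i ^ 4)) * b i) * t i ^ 4 := by field_simp
                rw [this]
                have h7 : 0 < 2 / β := by positivity
                have h8 : -(2 / β) * (-(β / (2 * t i ^ 4)) * b i) ≤ -(2 / β) * Real.log (q / 2) := by
                  nlinarith
                gcongr
              calc b i * j ≤ (-(2 / β) * Real.log (q / 2)) * t i ^ 4 * j := by gcongr
                _ = 8 * (-(2 / β) * Real.log (q / 2)) * j * t i ^ 4 / 8 := by ring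
                _ ≤ t i ^ 4 * t i ^ 4 / 8 := by gcongr
                _ = _ := by ring
          filter_upwards [h1.eventually_gt_atTop (j : ℝ), h2] with i hi1 hi2
          exact ⟨Nat.lt_ceil.2 hi1, hi2⟩
        have hex : ∀ i, ∃ ξ, t₀ ≤ t i → (j < ⌈t i ^ 3⌉₊ ∧ b i * j ≤ t i ^ 8 / 8) →
            |ξ - (t i ^ 8 - b i * j)| ≤ a * ((j : ℝ) + 1) ^ 2 + J * |μ| * ((j : ℝ) + 1) ∧
            T i j = (-1) ^ j * ((-(μ * ((j : ℝ) + 1))) ^ J *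
              (D J ξ * t i ^ (4 * J) / expWeight β κ (t i ^ 8))) := by
          intro i
          by_cases hc : t₀ ≤ t i ∧ (j < ⌈t i ^ 3⌉₊ ∧ b i * j ≤ t i ^ 8 / 8)
          · obtain ⟨ξ, h1, h2, -⟩ := hterm (t i) hc.1 (b i) (hb0 i) j hc.2.1 hc.2.2
            refine ⟨ξ, fun _ _ => ⟨h1, ?_⟩⟩
            simp only [hT]
            rw [if_pos hc.2, h2]
            ring
          · exact ⟨0, fun h1 h2 => absurd ⟨h1, h2⟩ hc⟩
        choose ξ hξ using hex
        have hev := hmem.and (ht.eventually_ge_atTop t₀)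
        have := tendsto_window_term (ξ := ξ) hβ hD ht hbq j J hj
          (hev.mono fun i hi => (hξ i hi.2 hi.1).1)
        refine ((this.const_mul _).const_mul _).congr' ?_
        filter_upwards [hev] with i hi
        exact ((hξ i hi.2 hi.1).2).symm
      -- When q = 0 the terms with j ≥ 1 need no asymptotics: their own majorant tends to 0.
      · push Not at hj
        have hq : q = 0 := le_antisymm hj.2 hq0
        subst hq
        rw [zero_pow hj.1, mul_zero, mul_zero, mul_zero]
        have h1 := (hbq.pow j).const_mul (C * |μ| ^ J * ((j : ℝ) + 1) ^ J)
        rw [zero_pow hj.1, mul_zero] at h1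
        exact squeeze_zero_norm' (hTb.mono fun i hi => hi j) h1
    · filter_upwards [hTb, hbq.eventually_lt_const hqr] with i hi hri j
      refine (hi j).trans ?_
      gcongr
  refine hlim.congr fun i => ?_
  rw [fwdDiff_iter_windowSum, tsum_eq_sum (s := Finset.range ⌈t i ^ 3⌉₊)]
  · rw [Finset.sum_mul, Finset.sum_div]
    refine Finset.sum_congr rfl fun j hj => ?_
    simp only [hT, Finset.mem_range.1 hj, true_and]
    split_ifs <;> simp
  · intro j hj
    rw [Finset.mem_range] at hj
    simp [hT, hj]

/-! ### The limiting factor. -/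

/-- `e^α ∂_α^J (1 / (1 + e^α))` for `J ≤ 2`, in terms of `Q = e^{-α}`. -/
noncomputable def fermiLim : ℕ → ℝ → ℝ
  | 0, Q => 1 / (1 + Q)
  | 1, Q => -(1 / (1 + Q) ^ 2)
  | _, Q => (1 - Q) / (1 + Q) ^ 3

lemma exp_mul_iteratedDeriv_fermi {J : ℕ} (hJ : J ≤ 2) (α : ℝ) :
    Real.exp α * iteratedDeriv J (fun t : ℝ => 1 / (1 + Real.exp t)) α =
      fermiLim J (Real.exp (-α)) := by
  have hpos : ∀ t : ℝ, 0 < 1 + Real.exp t := fun t => by positivity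
  have h1 : deriv (fun t : ℝ => 1 / (1 + Real.exp t)) =
      fun t => -Real.exp t / (1 + Real.exp t) ^ 2 := by
    funext t
    have := ((Real.hasDerivAt_exp t).const_add 1).fun_inv (hpos t).ne'
    simpa [one_div] using this.deriv
  have h2 : deriv (fun t : ℝ => -Real.exp t / (1 + Real.exp t) ^ 2) α =
      -(Real.exp α * (1 - Real.exp α)) / (1 + Real.exp α) ^ 3 := by
    have := ((Real.hasDerivAt_exp α).fun_neg).fun_div
      (((Real.hasDerivAt_exp α).const_add 1).fun_pow 2) (pow_pos (hpos α) 2).ne'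
    rw [this.deriv]
    have := hpos α
    field_simp
    ring
  have he := Real.exp_pos α
  have := hpos α
  interval_cases J
  · simp only [iteratedDeriv_zero, fermiLim, Real.exp_neg]
    field_simp
    ring
  · simp only [iteratedDeriv_one, h1, fermiLim, Real.exp_neg]
    field_simp
    ring
  · simp only [iteratedDeriv_succ, iteratedDeriv_zero, h1, h2, fermiLim, Real.exp_neg]
    field_simp
    ring

lemma fermiLim_ne_zero {J : ℕ} (hJ : J ≤ 2) {Q : ℝ} (hQ : 0 ≤ Q) (h : J = 2 → Q ≠ 1) :
    fermiLim J Q ≠ 0 := by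
  have : 0 < 1 + Q := by linarith
  interval_cases J
  · simp only [fermiLim]; positivity
  · simp only [fermiLim, ne_eq, neg_eq_zero]; positivity
  · simp only [fermiLim]
    have := sub_ne_zero.2 (h rfl).symm
    positivity

lemma continuousAt_fermiLim {J : ℕ} (hJ : J ≤ 2) {Q : ℝ} (hQ : 0 ≤ Q) :
    ContinuousAt (fermiLim J) Q := by
  have : 1 + Q ≠ 0 := by linarith
  have h2 : (1 + Q) ^ 2 ≠ 0 := pow_ne_zero _ this
  have h3 : (1 + Q) ^ 3 ≠ 0 := pow_ne_zero _ this
  interval_cases J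
  · change ContinuousAt (fun Q : ℝ => 1 / (1 + Q)) Q
    fun_prop (disch := assumption)
  · change ContinuousAt (fun Q : ℝ => -(1 / (1 + Q) ^ 2)) Q
    fun_prop (disch := assumption)
  · change ContinuousAt (fun Q : ℝ => (1 - Q) / (1 + Q) ^ 3) Q
    fun_prop (disch := assumption)

/-- Binomial series in -q; for J = 2, (j+1)² = 2 C(j+2, 2) - C(j+1, 1). -/
lemma tsum_alternating_eq_fermiLim {J : ℕ} (hJ : J ≤ 2) {q : ℝ} (hq0 : 0 ≤ q) (hq1 : q < 1)
    (μ β g : ℝ) :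
    ∑' j : ℕ, (-1 : ℝ) ^ j * ((-(μ * ((j : ℝ) + 1))) ^ J * (g * (β / 2) ^ J * q ^ j)) =
      g * (μ * β / 2) ^ J * fermiLim J q := by
  have hn : ‖-q‖ < 1 := by rwa [norm_neg, Real.norm_eq_abs, abs_of_nonneg hq0]
  have s0 := hasSum_choose_mul_geometric_of_norm_lt_one 0 hn
  have s1 := hasSum_choose_mul_geometric_of_norm_lt_one 1 hn
  have s2 := hasSum_choose_mul_geometric_of_norm_lt_one 2 hn
  have hp : (0 : ℝ) < 1 + q := by linarith
  rw [sub_neg_eq_add] at s0 s1 s2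
  interval_cases J
  · have := s0.mul_left g
    simp only [fermiLim]
    convert this.tsum_eq using 1
    · refine tsum_congr fun j => ?_
      rw [neg_pow q]; simp; ring
    · ring
  · have := s1.mul_left (-(g * (μ * β / 2)))
    simp only [fermiLim]
    convert this.tsum_eq using 1
    · refine tsum_congr fun j => ?_
      rw [neg_pow q]; simp; ring
    · ring
  · have := ((s2.mul_left 2).sub s1).mul_left (g * (μ * β / 2) ^ 2)
    simp only [fermiLim]
    convert this.tsum_eq using 1
    · refine tsum_congr fun j => ?_
      have h2 : (((j + 2).choose 2 : ℕ) : ℝ) = ((j : ℝ) + 2) * (j + 1) / 2 := by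
        rw [Nat.cast_choose_two]; push_cast; ring
      rw [neg_pow q, h2]
      simp only [Nat.choose_one_right]
      push_cast
      ring
    · field_simp
      ring

/-! ### The window sum when b = o(√X). -/

lemma fwdDiff_iter_comp_affine (S : ℝ → ℝ) (b μ : ℝ) (J : ℕ) :
    (fwdDiff (1 : ℝ))^[J] (fun u => S (b + u * μ)) 0 = (fwdDiff μ)^[J] S b := by
  simp only [fwdDiff_iter_eq_sum_shift]
  refine Finset.sum_congr rfl fun k _ => ?_
  simp

/-- For b ≤ t⁴ the condition b j ≤ t⁸/8 holds throughout the range, so the cutoff depending on b is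
inactive and u enters only through b + uμ. -/
lemma windowSum_eq_altDerivSum {D : ℕ → ℝ → ℝ} {a μ t b : ℝ} (ht : 16 ≤ t) (hb : b ≤ t ^ 4) :
    windowSum (D 0) a μ t b = fun u => altDerivSum D a (t ^ 8 + b) ⌈t ^ 3⌉₊ 0 (b + u * μ) := by
  funext u
  unfold windowSum altDerivSum
  refine Finset.sum_congr rfl fun j hj => ?_
  have hj' : (j : ℝ) ≤ 2 * t ^ 3 := by
    have h1 : (j : ℝ) ≤ ⌈t ^ 3⌉₊ := by exact_mod_cast (Finset.mem_range.1 hj).le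
    exact h1.trans (ceil_cube_le (by linarith))
  have htp : 0 < t := by linarith
  rw [if_pos, pow_zero, one_mul]
  · congr 2; ring
  · calc b * j ≤ t ^ 4 * (2 * t ^ 3) := by gcongr
      _ = 16 * t ^ 7 / 8 := by ring
      _ ≤ t * t ^ 7 / 8 := by gcongr
      _ = _ := by ring

lemma exists_fwdDiff_windowSum_eq {D : ℕ → ℝ → ℝ}
    (hD : ∀ j x, 0 < x → HasDerivAt (D j) (D (j + 1) x) x) {a t b s x : ℝ} (ha : 0 < a)
    (ht2 : 2 ≤ t) (hta : 16 + 64 * a ≤ t) (hb : 0 ≤ b) (k J : ℕ) (h1 : |x| ≤ t ^ 4)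
    (h2 : |x + J * s| ≤ t ^ 4) :
    ∃ θ ∈ Set.Icc (0 : ℝ) J,
      (fwdDiff s)^[J] (altDerivSum D a (t ^ 8 + b) ⌈t ^ 3⌉₊ k) x =
      s ^ J * altDerivSum D a (t ^ 8 + b) ⌈t ^ 3⌉₊ (k + J) (x + θ * s) :=
  exists_fwdDiff_iter_eq J (fun m => altDerivSum D a (t ^ 8 + b) ⌈t ^ 3⌉₊ (k + m))
    (Set.Icc (-(t ^ 4)) (t ^ 4)) (convex_Icc _ _)
    (fun m _ _ hv => hasDerivAt_altDerivSum hD ha ht2 hta hb (abs_le.2 hv) (k + m)) x s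
    (abs_le.1 h1) (abs_le.1 h2)

/-- The J-th difference is μ^J times a J-th derivative at a point within J|μ| of b, which is still
o(t⁴) and bounded below. -/
lemma tendsto_fwdDiff_windowSum_one {ι : Type*} {l : Filter ι} {β κ g a A : ℝ} {D : ℕ → ℝ → ℝ}
    (hβ : 0 < β) (ha : 0 < a) (hD : ∀ j : ℕ, IsExpSum β (κ + j / 2) (g * (β / 2) ^ j) (D j))
    (hD' : ∀ j x, 0 < x → HasDerivAt (D j) (D (j + 1) x) x) (μ : ℝ) (J : ℕ) {t b : ι → ℝ}
    (ht : Tendsto t l atTop) (hb0 : ∀ i, 0 ≤ b i)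
    (hb : Tendsto (fun i => b i / t i ^ 4) l (nhds 0)) (hA : eulerConst J = (A : ℂ)) :
    Tendsto (fun i => (fwdDiff (1 : ℝ))^[J] (windowSum (D 0) a μ (t i) (b i)) 0 * t i ^ (4 * J) /
      expWeight β κ (t i ^ 8)) l (nhds (μ ^ J * ((-(β / 2)) ^ J * g * A))) := by
  have hinv : Tendsto (fun i => (t i ^ 4)⁻¹) l (nhds 0) :=
    ((tendsto_pow_atTop (by norm_num)).comp ht).inv_tendsto_atTop
  have hJ0 : (0 : ℝ) ≤ J := J.cast_nonneg
  have hbig : ∀ᶠ i in l, 16 ≤ t i ∧ 16 + 64 * a ≤ t i ∧ b i ≤ t i ^ 4 ∧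
      |b i + J * μ| ≤ t i ^ 4 := by
    have h1 := (hb.add (hinv.const_mul (J * |μ|)))
    rw [mul_zero, add_zero] at h1
    filter_upwards [ht.eventually_ge_atTop 16, ht.eventually_ge_atTop (16 + 64 * a),
      h1.eventually_lt_const one_pos] with i h16 h64 hi
    have hp : 0 < t i := by linarith
    rw [← div_eq_mul_inv, ← add_div, div_lt_one (by positivity)] at hi
    have hμ := abs_nonneg μ
    have : 0 ≤ J * |μ| := by positivity
    refine ⟨h16, h64, by linarith, ?_⟩
    refine (abs_add_le _ _).trans ?_
    rw [abs_of_nonneg (hb0 i), abs_mul, abs_of_nonneg hJ0]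
    exact hi.le
  have hex : ∀ i, ∃ θ, θ ∈ Set.Icc (0 : ℝ) J ∧ ((16 ≤ t i ∧ 16 + 64 * a ≤ t i ∧ b i ≤ t i ^ 4 ∧
      |b i + J * μ| ≤ t i ^ 4) → (fwdDiff (1 : ℝ))^[J] (windowSum (D 0) a μ (t i) (b i)) 0 =
        μ ^ J * altDerivSum D a (t i ^ 8 + b i) ⌈t i ^ 3⌉₊ J (b i + θ * μ)) := by
    intro i
    by_cases hc : 16 ≤ t i ∧ 16 + 64 * a ≤ t i ∧ b i ≤ t i ^ 4 ∧ |b i + J * μ| ≤ t i ^ 4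
    · obtain ⟨θ, h1, h2⟩ := exists_fwdDiff_windowSum_eq (s := μ) (x := b i) hD' ha
        (by linarith [hc.1]) hc.2.1 (hb0 i) 0 J (by rw [abs_of_nonneg (hb0 i)]; exact hc.2.2.1)
        hc.2.2.2
      refine ⟨θ, h1, fun _ => ?_⟩
      rw [windowSum_eq_altDerivSum hc.1 hc.2.2.1, fwdDiff_iter_comp_affine, h2, zero_add]
    · exact ⟨0, ⟨le_rfl, hJ0⟩, fun h => absurd h hc⟩
  choose θ hθ hθ' using hex
  have habs : ∀ i, |θ i * μ| ≤ J * |μ| := fun i => by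
    rw [abs_mul, abs_of_nonneg (hθ i).1]
    gcongr
    exact (hθ i).2
  have hv : Tendsto (fun i => (b i + θ i * μ) / t i ^ 4) l (nhds 0) := by
    have h1 : Tendsto (fun i => θ i * μ / t i ^ 4) l (nhds 0) := by
      refine squeeze_zero_norm' (a := fun i => J * |μ| * (t i ^ 4)⁻¹) ?_
        (by simpa using hinv.const_mul (J * |μ|))
      filter_upwards [ht.eventually_gt_atTop 0] with i hi
      rw [norm_div, Real.norm_eq_abs, Real.norm_eq_abs, abs_of_pos (by positivity : 0 < t i ^ 4),
        div_eq_mul_inv]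
      gcongr
      exact habs i
    simpa [add_div] using hb.add h1
  have := (tendsto_altDerivSum (κ := κ) (C₀ := J * |μ|) hβ ha hD ht hb0 hb
    (Eventually.of_forall fun i => by linarith [(abs_le.1 (habs i)).1, hb0 i]) hv hA).const_mul (μ ^ J)
  refine this.congr' ?_
  filter_upwards [hbig] with i hi
  rw [hθ' i hi]
  ring

/-- This is S(μ) - 2S(0) + S(-μ). The two-sided cancellation, used with linear coefficients μ and 0,
shows that both S(μ) + S(-μ) and 2S(0) are nearly φ(T), which drops out. -/
lemma abs_fwdDiff_two_altDerivSum_le {β κ g a : ℝ} {D : ℕ → ℝ → ℝ} (hβ : 0 < β) (ha : 0 < a)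
    (hD : IsExpSum β κ g (D 0)) (μ : ℝ) :
    ∃ C t₀ : ℝ, 0 ≤ C ∧ ∀ t, t₀ ≤ t → ∀ b, 0 ≤ b → b ≤ t ^ 4 →
      |(fwdDiff μ)^[2] (altDerivSum D a (t ^ 8 + b) ⌈t ^ 3⌉₊ 0) (-μ)| ≤
        C * (expWeight β κ (t ^ 8 + b) / t ^ 16) := by
  obtain ⟨C₁, h₁⟩ := abs_one_sided_symm_sum_le hβ ha hD μ
  obtain ⟨C₂, h₂⟩ := abs_one_sided_symm_sum_le hβ ha hD 0
  refine ⟨|C₁| + |C₂|, max (max 5 (16 + 64 * a)) |μ|, by positivity, ?_⟩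
  intro t ht b hb hbt
  simp only [max_le_iff] at ht
  obtain ⟨⟨ht5, hta⟩, htμ⟩ := ht
  have htp : 0 < t := by linarith
  have hT : 0 ≤ t ^ 8 + b := by positivity
  obtain ⟨τ, hτ0, hτ8⟩ : ∃ τ : ℝ, 0 ≤ τ ∧ τ ^ 8 = t ^ 8 + b := by
    refine ⟨(t ^ 8 + b) ^ (1 / 8 : ℝ), by positivity, ?_⟩
    rw [← Real.rpow_natCast, ← Real.rpow_mul hT]
    norm_num
  have hτt : t ≤ τ := le_of_pow_le_pow_left₀ (n := 8) (by norm_num) hτ0 (by rw [hτ8]; linarith)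
  have hcube : t ^ 3 ≤ τ ^ 3 := by gcongr
  have hτ3 : τ ^ 3 ≤ 2 * t ^ 3 := by
    refine le_of_pow_le_pow_left₀ (n := 8) (by norm_num) (by positivity) ?_
    have : t ^ 4 ≤ t ^ 8 := pow_le_pow_right₀ (by linarith) (by norm_num)
    calc (τ ^ 3) ^ 8 = (τ ^ 8) ^ 3 := by ring
      _ ≤ (2 * t ^ 8) ^ 3 := by rw [hτ8]; gcongr; linarith
      _ = 8 * t ^ 24 := by ring
      _ ≤ 256 * t ^ 24 := by gcongr; norm_num
      _ = _ := by ring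
  have hN1 : τ ^ 3 / 2 ≤ (⌈t ^ 3⌉₊ : ℝ) := by
    have := Nat.le_ceil (t ^ 3)
    linarith
  have hN2 : (⌈t ^ 3⌉₊ : ℝ) ≤ 2 * τ ^ 3 := by
    have := ceil_cube_le (by linarith : 1 ≤ t)
    linarith
  have b₁ := h₁ τ ⌈t ^ 3⌉₊ (by linarith) (by linarith) (by linarith) hN1 hN2
  have b₂ := h₂ τ ⌈t ^ 3⌉₊ (by linarith) (by linarith) (by rw [abs_zero]; exact hτ0) hN1 hN2
  have hF : 0 < expWeight β κ (t ^ 8 + b) := expWeight_pos (by positivity)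
  have h16 : expWeight β κ (t ^ 8 + b) / τ ^ 16 ≤ expWeight β κ (t ^ 8 + b) / t ^ 16 := by
    gcongr
  rw [hτ8] at b₁ b₂
  set N := ⌈t ^ 3⌉₊
  set T := t ^ 8 + b
  have key : (fwdDiff μ)^[2] (altDerivSum D a T N 0) (-μ) =
      (D 0 T - ∑ j ∈ Finset.range N, (-1 : ℝ) ^ j *
          (D 0 (T - a * (j + 1) ^ 2 - 0 * (j + 1)) + D 0 (T - a * (j + 1) ^ 2 + 0 * (j + 1)))) -
      (D 0 T - ∑ j ∈ Finset.range N, (-1 : ℝ) ^ j *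
          (D 0 (T - a * (j + 1) ^ 2 - μ * (j + 1)) + D 0 (T - a * (j + 1) ^ 2 + μ * (j + 1)))) := by
    simp only [Function.iterate_succ, Function.iterate_zero, Function.comp, id, fwdDiff]
    unfold altDerivSum
    rw [sub_sub_sub_cancel_left, ← Finset.sum_sub_distrib, ← Finset.sum_sub_distrib,
      ← Finset.sum_sub_distrib, ← Finset.sum_sub_distrib]
    refine Finset.sum_congr rfl fun j _ => ?_
    simp only [pow_zero, one_mul, neg_add_cancel, zero_add, zero_mul, sub_zero, add_zero, neg_mul,
      sub_neg_eq_add]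
    ring
  rw [key]
  refine (abs_sub _ _).trans ((add_le_add b₂ b₁).trans ?_)
  have hp : 0 ≤ expWeight β κ T / τ ^ 16 := by positivity
  have := le_abs_self C₁
  have := le_abs_self C₂
  calc _ = (C₁ + C₂) * (expWeight β κ T / τ ^ 16) := by ring
    _ ≤ (|C₁| + |C₂|) * (expWeight β κ T / τ ^ 16) := by gcongr
    _ ≤ _ := by gcongr

/-- The second difference centred at b + μ equals the one centred at 0 plus (b + μ) times its
derivative in the centre, which is μ² S''' at an intermediate point. The centre 0 contributes o(1)
after division by (b + μ)/t⁴, thanks to t⁴|b + μ| → ∞. -/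
lemma tendsto_fwdDiff_two_windowSum {ι : Type*} {l : Filter ι} {β κ g a : ℝ} {D : ℕ → ℝ → ℝ}
    (hβ : 0 < β) (ha : 0 < a) (hD : ∀ j : ℕ, IsExpSum β (κ + j / 2) (g * (β / 2) ^ j) (D j))
    (hD' : ∀ j x, 0 < x → HasDerivAt (D j) (D (j + 1) x) x) (μ : ℝ) {t b : ι → ℝ}
    (ht : Tendsto t l atTop) (hb0 : ∀ i, 0 ≤ b i)
    (hb : Tendsto (fun i => b i / t i ^ 4) l (nhds 0)) (hne : ∀ i, b i + μ ≠ 0)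
    (hsep : Tendsto (fun i => t i ^ 4 * |b i + μ|) l atTop) :
    Tendsto (fun i => (fwdDiff (1 : ℝ))^[2] (windowSum (D 0) a μ (t i) (b i)) 0 * t i ^ 8 /
      expWeight β κ (t i ^ 8) / ((b i + μ) / t i ^ 4)) l (nhds (g * μ ^ 2 * (β / 2) ^ 3 / 8)) := by
  have hinv : Tendsto (fun i => (t i ^ 4)⁻¹) l (nhds 0) :=
    ((tendsto_pow_atTop (by norm_num)).comp ht).inv_tendsto_atTop
  have hX : Tendsto (fun i => t i ^ 8) l atTop := (tendsto_pow_atTop (by norm_num)).comp ht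
  obtain ⟨C, t₀, hC, hE⟩ := abs_fwdDiff_two_altDerivSum_le hβ ha
    (by simpa using hD 0 : IsExpSum β κ g (D 0)) μ
  have hμ := abs_nonneg μ
  set good : ι → Prop := fun i => 16 ≤ t i ∧ 16 + 64 * a ≤ t i ∧ b i + 3 * |μ| ≤ t i ^ 4 with hgood
  have hgood_ev : ∀ᶠ i in l, good i := by
    have h1 := (hb.add (hinv.const_mul (3 * |μ|)))
    rw [mul_zero, add_zero] at h1
    filter_upwards [ht.eventually_ge_atTop 16, ht.eventually_ge_atTop (16 + 64 * a),
      h1.eventually_lt_const one_pos] with i h16 h64 hi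
    have hp : 0 < t i := by linarith
    rw [← div_eq_mul_inv, ← add_div, div_lt_one (by positivity)] at hi
    exact ⟨h16, h64, hi.le⟩
  have hex : ∀ i, ∃ v, (-(2 * |μ|) ≤ v ∧ v ≤ b i + 2 * |μ|) ∧ (good i →
      (fwdDiff (1 : ℝ))^[2] (windowSum (D 0) a μ (t i) (b i)) 0 =
        (fwdDiff μ)^[2] (altDerivSum D a (t i ^ 8 + b i) ⌈t i ^ 3⌉₊ 0) (-μ) +
        (b i + μ) * (μ ^ 2 * altDerivSum D a (t i ^ 8 + b i) ⌈t i ^ 3⌉₊ 3 v)) := by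
    intro i
    by_cases hc : good i
    · obtain ⟨h16, h64, hbi⟩ := hc
      have hbi0 := hb0 i
      set S := altDerivSum D a (t i ^ 8 + b i) ⌈t i ^ 3⌉₊ with hS
      have hder : ∀ k v, |v| ≤ t i ^ 4 → HasDerivAt (S k) (S (k + 1) v) v := fun k v hv =>
        hasDerivAt_altDerivSum hD' ha (by linarith) h64 hbi0 hv k
      set B := b i + μ with hB
      have hm1 := neg_abs_le μ
      have hm2 := le_abs_self μ
      -- the second difference centred at `x`, as a function of `x`
      obtain ⟨r, hr, hmv⟩ := exists_fwdDiff_iter_eq 1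
        (fun k x => (fwdDiff μ)^[2] (S k) (x - μ)) (Set.Icc (-|μ|) (b i + |μ|)) (convex_Icc _ _)
        (fun k _ x hx => by
          have e : ∀ k, (fun x => (fwdDiff μ)^[2] (S k) (x - μ)) =
              fun x => S k (x + μ) - S k x - (S k x - S k (x - μ)) := by
            intro k
            funext x
            simp only [Function.iterate_succ, Function.iterate_zero, Function.comp, id, fwdDiff]
            ring_nf
          rw [e k]
          have e' := congrFun (e (k + 1)) x
          rw [e']
          have m0 : |x| ≤ t i ^ 4 := abs_le.2 ⟨by linarith [hx.1], by linarith [hx.2]⟩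
          have m1 : |x + μ| ≤ t i ^ 4 := abs_le.2 ⟨by linarith [hx.1], by linarith [hx.2]⟩
          have m2 : |x - μ| ≤ t i ^ 4 := abs_le.2 ⟨by linarith [hx.1], by linarith [hx.2]⟩
          exact (((hder k _ m1).comp_add_const x μ).sub (hder k _ m0)).sub
            ((hder k _ m0).sub ((hder k _ m2).comp_sub_const x μ)))
        0 B ⟨by linarith, by linarith⟩ ⟨by push_cast; linarith, by push_cast; linarith⟩
      simp only [Nat.cast_one] at hr
      have hrB1 : -|μ| ≤ r * B := by
        rcases le_total 0 B with h | h
        · have := mul_nonneg hr.1 h; linarith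
        · nlinarith [hr.1, hr.2]
      have hrB2 : r * B ≤ b i + |μ| := by
        rcases le_total 0 B with h | h
        · nlinarith [hr.1, hr.2]
        · have := mul_nonpos_of_nonneg_of_nonpos hr.1 h; linarith
      obtain ⟨θ, hθ, hmv2⟩ := exists_fwdDiff_windowSum_eq (s := μ) (x := r * B - μ) hD' ha
        (by linarith) h64 hbi0 1 2
        (abs_le.2 ⟨by linarith, by linarith⟩)
        (abs_le.2 ⟨by push_cast; linarith, by push_cast; linarith⟩)
      rw [← hS] at hmv2
      push_cast at hθ
      have hθμ : |(θ - 1) * μ| ≤ |μ| := by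
        rw [abs_mul]
        have : |θ - 1| ≤ 1 := abs_le.2 ⟨by linarith [hθ.1], by linarith [hθ.2]⟩
        nlinarith
      have hθ' := abs_le.1 hθμ
      refine ⟨r * B - μ + θ * μ, ⟨by linarith [hθ'.1], by linarith [hθ'.2]⟩, fun _ => ?_⟩
      rw [windowSum_eq_altDerivSum h16 (by linarith), fwdDiff_iter_comp_affine]
      simp only [Function.iterate_one, pow_one, zero_add] at hmv
      rw [hmv2] at hmv
      have h0 : fwdDiff B (fun x => (fwdDiff μ)^[2] (S 0) (x - μ)) 0 =
          (fwdDiff μ)^[2] (S 0) (b i) - (fwdDiff μ)^[2] (S 0) (-μ) := by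
        rw [fwdDiff, zero_add, zero_sub, hB, add_sub_cancel_right]
      rw [h0] at hmv
      rw [← hS]
      linarith
    · exact ⟨0, ⟨by linarith, by linarith [hb0 i]⟩, fun h => absurd h hc⟩
  choose v hv hv' using hex
  have hvt : Tendsto (fun i => v i / t i ^ 4) l (nhds 0) := by
    have h1 := hb.add (hinv.const_mul (2 * |μ|))
    rw [mul_zero, add_zero] at h1
    refine squeeze_zero_norm' ?_ h1
    filter_upwards [ht.eventually_gt_atTop 0] with i hi
    rw [norm_div, Real.norm_eq_abs, Real.norm_eq_abs, abs_of_pos (by positivity : 0 < t i ^ 4),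
      ← div_eq_mul_inv, ← add_div]
    gcongr
    exact abs_le.2 ⟨by linarith [(hv i).1, hb0 i], (hv i).2⟩
  have hmain := (tendsto_altDerivSum (κ := κ) (C₀ := 2 * |μ|) (k := 3) (A := -1 / 8) hβ ha hD ht hb0 hb
    (Eventually.of_forall fun i => (hv i).1) hvt
    (by rw [eulerConst_three]; push_cast; ring)).const_mul (μ ^ 2)
  have hratio := tendsto_expWeight_div (β := β) (κ := κ) (t := 0) (X := fun i => t i ^ 8)
    (y := fun i => t i ^ 8 + b i) hX (by
      refine hb.congr fun i => ?_
      rw [sqrt_pow_eight]; ring)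
  rw [mul_zero, Real.exp_zero] at hratio
  have herr : Tendsto (fun i => (fwdDiff μ)^[2] (altDerivSum D a (t i ^ 8 + b i) ⌈t i ^ 3⌉₊ 0) (-μ) *
      t i ^ 8 / expWeight β κ (t i ^ 8) / ((b i + μ) / t i ^ 4)) l (nhds 0) := by
    have h1 := (hratio.const_mul C).mul hsep.inv_tendsto_atTop
    rw [mul_zero] at h1
    refine squeeze_zero_norm' ?_ h1
    filter_upwards [hgood_ev, ht.eventually_ge_atTop t₀] with i hi hti
    have hp : 0 < t i := by linarith [hi.1]
    have hF := expWeight_pos (β := β) (κ := κ) (by positivity : 0 < t i ^ 8)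
    have hB := abs_pos.2 (hne i)
    have h2 := hE (t i) hti (b i) (hb0 i) (by linarith [hi.2.2])
    rw [Real.norm_eq_abs, abs_div, abs_div, abs_mul, abs_div, abs_of_pos hF,
      abs_of_pos (by positivity : 0 < t i ^ 8), abs_of_pos (by positivity : 0 < t i ^ 4)]
    simp only [Pi.inv_apply]
    calc _ ≤ C * (expWeight β κ (t i ^ 8 + b i) / t i ^ 16) * t i ^ 8 / expWeight β κ (t i ^ 8) /
          (|b i + μ| / t i ^ 4) := by gcongr
      _ = _ := by field_simp
  have := herr.add hmain
  rw [show 0 + μ ^ 2 * ((-(β / 2)) ^ 3 * g * (-1 / 8)) = g * μ ^ 2 * (β / 2) ^ 3 / 8 by ring] at this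
  refine this.congr' ?_
  filter_upwards [hgood_ev] with i hi
  have hp : 0 < t i := by linarith [hi.1]
  have hF := expWeight_pos (β := β) (κ := κ) (by positivity : 0 < t i ^ 8)
  have hB := hne i
  rw [hv' i hi]
  generalize (fwdDiff μ)^[2] (altDerivSum D a (t i ^ 8 + b i) ⌈t i ^ 3⌉₊ 0) (-μ) = E
  generalize altDerivSum D a (t i ^ 8 + b i) ⌈t i ^ 3⌉₊ 3 (v i) = S
  field_simp
  ring

lemma tendsto_fermiLim_two_div {ι : Type*} {l : Filter ι} {α : ι → ℝ} (hα : Tendsto α l (nhds 0))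
    (hne : ∀ i, α i ≠ 0) :
    Tendsto (fun i => fermiLim 2 (Real.exp (-α i)) / α i) l (nhds (1 / 8)) := by
  have h1 : Tendsto (fun i => (1 - Real.exp (-α i)) / α i) l (nhds 1) := by
    have hd : HasDerivAt (fun x : ℝ => -Real.exp (-x)) 1 0 := by
      simpa using ((hasDerivAt_neg (0 : ℝ)).exp).fun_neg
    have := hd.tendsto_slope_zero.comp (tendsto_nhdsWithin_iff.2
      ⟨hα, Eventually.of_forall hne⟩)
    refine this.congr fun i => ?_
    simp only [Function.comp, smul_eq_mul, zero_add, neg_zero, Real.exp_zero, div_eq_inv_mul]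
    ring
  have h2 : Tendsto (fun i => (1 + Real.exp (-α i)) ^ 3) l (nhds 8) := by
    have h3 : Tendsto (fun i => Real.exp (-α i)) l (nhds 1) := by
      simpa [Function.comp_def] using (Real.continuous_exp.tendsto _).comp hα.neg
    have := (h3.const_add 1).pow 3
    norm_num at this
    exact this
  have := h1.div h2 (by norm_num)
  refine this.congr fun i => ?_
  simp only [Pi.div_apply, fermiLim]
  rw [div_right_comm]

/-! ### Combining the two regimes. -/

/-- The second limit is what later removes the error of replacing f by φ: that error, normalised, is
O(t^(-8)). Only J = 2 with q = 1 is singular; there `fermiLim 2` is asymptotic to α/8. -/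
lemma tendsto_windowSum_div_fermiLim {ι : Type*} {l : Filter ι} {β κ g a μ q : ℝ} {D : ℕ → ℝ → ℝ}
    (hβ : 0 < β) (ha : 0 < a) (hD : ∀ j : ℕ, IsExpSum β (κ + j / 2) (g * (β / 2) ^ j) (D j))
    (hD' : ∀ j x, 0 < x → HasDerivAt (D j) (D (j + 1) x) x) {J : ℕ} (hJ : J ≤ 2) {t b α : ι → ℝ}
    (ht : Tendsto t l atTop) (hb0 : ∀ i, 0 ≤ b i)
    (hα : ∀ i, α i = (2 * b i + μ * J) * β / (4 * t i ^ 4))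
    (hne : J = 2 → ∀ i, b i + μ ≠ 0)
    (hsep : J = 2 → Tendsto (fun i => t i ^ 4 * |b i + μ|) l atTop)
    (hbq : Tendsto (fun i => Real.exp (-(β / (2 * t i ^ 4)) * b i)) l (nhds q)) (hq0 : 0 ≤ q)
    (hq1 : q ≤ 1) :
    Tendsto (fun i => (fwdDiff (1 : ℝ))^[J] (windowSum (D 0) a μ (t i) (b i)) 0 * t i ^ (4 * J) /
      expWeight β κ (t i ^ 8) / fermiLim J (Real.exp (-α i))) l (nhds (g * (μ * β / 2) ^ J)) ∧
    Tendsto (fun i => (t i ^ 8)⁻¹ / fermiLim J (Real.exp (-α i))) l (nhds 0) := by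
  have hinv : Tendsto (fun i => (t i ^ 4)⁻¹) l (nhds 0) :=
    ((tendsto_pow_atTop (by norm_num)).comp ht).inv_tendsto_atTop
  have hinv8 : Tendsto (fun i => (t i ^ 8)⁻¹) l (nhds 0) :=
    ((tendsto_pow_atTop (by norm_num)).comp ht).inv_tendsto_atTop
  have hQ : Tendsto (fun i => Real.exp (-α i)) l (nhds q) := by
    have h1 : Tendsto (fun i => Real.exp (-(μ * J * β / 4) * (t i ^ 4)⁻¹)) l (nhds 1) := by
      have := (Real.continuous_exp.tendsto _).comp (hinv.const_mul (-(μ * J * β / 4)))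
      simpa [Function.comp_def] using this
    have := hbq.mul h1
    rw [mul_one] at this
    refine this.congr fun i => ?_
    rw [← Real.exp_add, hα]
    congr 1
    ring
  -- Away from the zero of `fermiLim`, both limits follow by continuity at q.
  have regular : (J = 2 → q ≠ 1) → Tendsto (fun i => (fwdDiff (1 : ℝ))^[J]
      (windowSum (D 0) a μ (t i) (b i)) 0 * t i ^ (4 * J) / expWeight β κ (t i ^ 8)) l
        (nhds (g * (μ * β / 2) ^ J * fermiLim J q)) →
      Tendsto (fun i => (fwdDiff (1 : ℝ))^[J] (windowSum (D 0) a μ (t i) (b i)) 0 * t i ^ (4 * J) /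
        expWeight β κ (t i ^ 8) / fermiLim J (Real.exp (-α i))) l (nhds (g * (μ * β / 2) ^ J)) ∧
      Tendsto (fun i => (t i ^ 8)⁻¹ / fermiLim J (Real.exp (-α i))) l (nhds 0) := fun hq h => by
    have hV := (continuousAt_fermiLim hJ hq0).tendsto.comp hQ
    have hV0 := fermiLim_ne_zero hJ hq0 hq
    have h1 := h.div hV hV0
    have h2 := hinv8.div hV hV0
    rw [mul_div_cancel_right₀ _ hV0] at h1
    rw [zero_div] at h2
    exact ⟨h1, h2⟩
  have hb_of_one : q = 1 → Tendsto (fun i => b i / t i ^ 4) l (nhds 0) := by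
    intro h
    rw [h] at hbq
    have := ((Real.continuousAt_log one_ne_zero).tendsto.comp hbq).const_mul (-(2 / β))
    rw [Real.log_one, mul_zero] at this
    refine this.congr fun i => ?_
    simp only [Function.comp, Real.log_exp]
    field_simp
  rcases hq1.lt_or_eq with hlt | heq
  · refine regular (fun _ => hlt.ne) ?_
    have := tendsto_fwdDiff_windowSum hβ ha hD hD' μ J ht hb0 hbq hq0 hlt
    rwa [tsum_alternating_eq_fermiLim hJ hq0 hlt] at this
  · have hb := hb_of_one heq
    subst heq
    have hcases : J = 0 ∨ J = 1 ∨ J = 2 := by omega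
    rcases hcases with rfl | rfl | rfl
    · refine regular (by norm_num) ?_
      have := tendsto_fwdDiff_windowSum_one (A := 1 / 2) hβ ha hD hD' μ 0 ht hb0 hb
        (by rw [eulerConst_zero]; push_cast; ring)
      convert this using 2
      simp only [fermiLim]
      ring
    · refine regular (by norm_num) ?_
      have := tendsto_fwdDiff_windowSum_one (A := 1 / 4) hβ ha hD hD' μ 1 ht hb0 hb
        (by rw [eulerConst_one]; push_cast; ring)
      convert this using 2
      simp only [fermiLim]
      ring
    · clear regular
      have hαb : ∀ i, α i = β / 2 * ((b i + μ) / t i ^ 4) := fun i => by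
        rw [hα]; push_cast; field_simp; ring
      have hα0 : Tendsto α l (nhds 0) := by
        have := ((hb.add (hinv.const_mul μ)).const_mul (β / 2))
        simp only [mul_zero, add_zero] at this
        refine this.congr fun i => ?_
        rw [hαb]; ring
      -- restrict to indices with `t i ≠ 0`
      have htpos : ∀ᶠ i in l, 0 < t i := ht.eventually_gt_atTop 0
      set α' : ι → ℝ := fun i => if 0 < t i then α i else 1 with hα'
      have hα'e : ∀ᶠ i in l, α' i = α i := by
        filter_upwards [htpos] with i hi
        simp only [hα', if_pos hi]
      have hα'ne : ∀ i, α' i ≠ 0 := by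
        intro i
        simp only [hα']
        split_ifs with hi
        · rw [hαb]
          have := hne rfl i
          positivity
        · exact one_ne_zero
      have hV := tendsto_fermiLim_two_div (hα0.congr' (hα'e.mono fun i hi => hi.symm)) hα'ne
      have hM := tendsto_fwdDiff_two_windowSum hβ ha hD hD' μ ht hb0 hb (hne rfl) (hsep rfl)
      constructor
      · have := (hM.const_mul (2 / β)).div hV (by norm_num)
        rw [show 2 / β * (g * μ ^ 2 * (β / 2) ^ 3 / 8) / (1 / 8) = g * (μ * β / 2) ^ 2 by
          field_simp] at this
        refine this.congr' ?_
        filter_upwards [hα'e, htpos] with i hi hti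
        have h1 := hα'ne i
        have h2 := hne rfl i
        simp only [Pi.div_apply]
        rw [hi] at h1 ⊢
        rw [show (b i + μ) / t i ^ 4 = 2 / β * α i by rw [hαb]; field_simp]
        field_simp
      · have h1 : Tendsto (fun i => (t i ^ 8)⁻¹ / α' i) l (nhds 0) := by
          have h2 := (hsep rfl).inv_tendsto_atTop.const_mul (2 / β)
          rw [mul_zero] at h2
          refine squeeze_zero_norm' ?_ h2
          filter_upwards [hα'e, htpos] with i hi hti
          have h3 := abs_pos.2 (hne rfl i)
          rw [hi, hαb, Real.norm_eq_abs, abs_div, abs_mul, abs_div (b i + μ),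
            abs_of_pos (by positivity : 0 < (t i ^ 8)⁻¹), abs_of_pos (by positivity : 0 < t i ^ 4),
            abs_of_pos (by positivity : 0 < β / 2)]
          simp only [Pi.inv_apply]
          apply le_of_eq
          field_simp
        have := h1.div hV (by norm_num)
        rw [zero_div] at this
        refine this.congr' ?_
        filter_upwards [hα'e] with i hi
        have h1 := hα'ne i
        simp only [Pi.div_apply]
        rw [hi] at h1 ⊢
        field_simp

lemma abs_fwdDiff_iter_sub_le {F G : ℝ → ℝ} {ε : ℝ} {J : ℕ} (hJ : J ≤ 2)
    (h : ∀ u, |u| ≤ 2 → |F u - G u| ≤ ε) :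
    |(fwdDiff (1 : ℝ))^[J] F 0 - (fwdDiff (1 : ℝ))^[J] G 0| ≤ 4 * ε := by
  have h0 := h 0 (by norm_num)
  have h1 := h 1 (by norm_num)
  have h2 := h 2 (by norm_num)
  rw [abs_le] at h0 h1 h2 ⊢
  interval_cases J
  · simp only [Function.iterate_zero, id]
    constructor <;> linarith
  · simp only [Function.iterate_succ, Function.iterate_zero, Function.comp, id, fwdDiff, zero_add]
    constructor <;> linarith
  · simp only [Function.iterate_succ, Function.iterate_zero, Function.comp, id, fwdDiff, zero_add,
      one_add_one_eq_two]
    constructor <;> linarith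

lemma tendsto_altSum_div_fermiLim {ι : Type*} {l : Filter ι} {f : ℝ → ℝ} {β κ : ℝ} {γ : ℕ → ℝ}
    (hf : IsPartitionLike f β κ γ) {a μ q : ℝ} (ha : 0 < a) {J : ℕ} (hJ : J ≤ 2) {t b α : ι → ℝ}
    (ht : Tendsto t l atTop) (hb0 : ∀ i, 0 ≤ b i)
    (hα : ∀ i, α i = (2 * b i + μ * J) * β / (4 * t i ^ 4))
    (hne : J = 2 → ∀ i, b i + μ ≠ 0)
    (hsep : J = 2 → Tendsto (fun i => t i ^ 4 * |b i + μ|) l atTop)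
    (hbq : Tendsto (fun i => Real.exp (-(β / (2 * t i ^ 4)) * b i)) l (nhds q)) (hq0 : 0 ≤ q)
    (hq1 : q ≤ 1) :
    Tendsto (fun i => (fwdDiff (1 : ℝ))^[J] (fun u => altSum f a (b i + u * μ) (t i ^ 8 + b i)) 0 *
      t i ^ (4 * J) / f (t i ^ 8) / fermiLim J (Real.exp (-α i))) l (nhds ((μ * β / 2) ^ J)) := by
  obtain ⟨φ, hφ, hfF, C, t₀, happ⟩ := exists_altSum_approx hf ha μ
  obtain ⟨D, rfl, hD, hD'⟩ := hφ.exists_derivs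
  obtain ⟨hM, hV⟩ := tendsto_windowSum_div_fermiLim (a := a) hf.beta_pos ha hD hD' hJ ht hb0 hα hne hsep
    hbq hq0 hq1
  have hX : Tendsto (fun i => t i ^ 8) l atTop := (tendsto_pow_atTop (by norm_num)).comp ht
  have hfF' := (hfF.comp hX).inv₀ hf.gamma_zero_pos.ne'
  set A : ι → ℝ := fun i =>
    (fwdDiff (1 : ℝ))^[J] (fun u => altSum f a (b i + u * μ) (t i ^ 8 + b i)) 0 with hA
  set M : ι → ℝ := fun i => (fwdDiff (1 : ℝ))^[J] (windowSum (D 0) a μ (t i) (b i)) 0 with hMdef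
  have herr : Tendsto (fun i => (A i - M i) * t i ^ (4 * J) / expWeight β κ (t i ^ 8) /
      fermiLim J (Real.exp (-α i))) l (nhds 0) := by
    have h1 := (hV.abs).const_mul (4 * C)
    rw [abs_zero, mul_zero] at h1
    refine squeeze_zero_norm' ?_ h1
    filter_upwards [ht.eventually_ge_atTop t₀, ht.eventually_ge_atTop 1] with i hi hi1
    have hp : 0 < t i := by linarith
    have hF := expWeight_pos (β := β) (κ := κ) (by positivity : 0 < t i ^ 8)
    have h2 : |A i - M i| ≤ 4 * (C * (expWeight β κ (t i ^ 8) / t i ^ 16)) :=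
      abs_fwdDiff_iter_sub_le hJ fun u hu => happ (t i) hi (b i) (hb0 i) u hu
    have h3 : t i ^ (4 * J) ≤ t i ^ 8 := pow_le_pow_right₀ hi1 (by omega)
    rw [norm_div, Real.norm_eq_abs, Real.norm_eq_abs, abs_div, abs_mul, abs_of_pos hF,
      abs_of_pos (by positivity : 0 < t i ^ (4 * J)), abs_div (t i ^ 8)⁻¹,
      abs_of_pos (by positivity : 0 < (t i ^ 8)⁻¹), mul_div_assoc']
    refine div_le_div_of_nonneg_right ?_ (abs_nonneg _)
    rw [div_le_iff₀ hF]
    calc |A i - M i| * t i ^ (4 * J) ≤ 4 * (C * (expWeight β κ (t i ^ 8) / t i ^ 16)) * t i ^ 8 :=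
          mul_le_mul h2 h3 (by positivity) ((abs_nonneg _).trans h2)
      _ = _ := by field_simp
  have := (herr.add hM).mul hfF'
  have hγ := hf.gamma_zero_pos
  rw [zero_add, mul_assoc, mul_comm (_ ^ J), ← mul_assoc, mul_inv_cancel₀ hγ.ne', one_mul] at this
  refine this.congr' ?_
  filter_upwards [ht.eventually_gt_atTop 0] with i hp
  have hF := expWeight_pos (β := β) (κ := κ) (by positivity : 0 < t i ^ 8)
  simp only [Function.comp, inv_div]
  rw [← add_div, ← add_div, ← add_mul, sub_add_cancel]
  field_simp
  rfl

theorem corollary1p6 (f : ℝ → ℝ) (β κ : ℝ) (γ : ℕ → ℝ) (hf : IsPartitionLike f β κ γ)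
    (J : ℕ) (hJ : J = 0 ∨ J = 1 ∨ J = 2) (a : ℝ) (ha : 0 < a) (μ : ℝ) (hμ : μ ≠ 0)
    -- `b` and `X` vary together along an arbitrary filter, with `X → +∞`; taking filters on pairs
    -- `(b, X)`, this is the asymptotic equivalence uniformly in `b`
    {ι : Type*} (l : Filter ι) (b X : ι → ℝ) (hX : Tendsto X l atTop)
    (hb : ∀ i, 0 ≤ b i) (hne : ∀ i, -μ * (J : ℝ) ≠ 2 * b i)
    (hsep : J = 2 → Tendsto (fun i => √(X i) * |2 * b i + μ * (J : ℝ)|) l atTop) :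
    (fun i => (fwdDiff (1 : ℝ))^[J] (fun u : ℝ => altSum f a (b i + u * μ) (X i + b i)) 0 /
        (X i ^ (-((J : ℝ) / 2)) * (μ * β / 2) ^ J * f (X i)))
      ~[l]
    (fun i => Real.exp ((2 * b i + μ * (J : ℝ)) * β / (4 * √(X i))) *
        iteratedDeriv J (fun t : ℝ => 1 / (1 + Real.exp t))
          ((2 * b i + μ * (J : ℝ)) * β / (4 * √(X i)))) := by
  have hβ := hf.beta_pos
  have hJ2 : J ≤ 2 := by omega
  simp only [exp_mul_iteratedDeriv_fermi hJ2]
  set t : ι → ℝ := fun i => X i ^ (1 / 8 : ℝ) with ht_def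
  have ht : Tendsto t l atTop := (tendsto_rpow_atTop (by norm_num)).comp hX
  have hXpos := hX.eventually_gt_atTop 0
  have ht8 : ∀ᶠ i in l, t i ^ 8 = X i := by
    filter_upwards [hXpos] with i hi
    rw [ht_def]
    simp only
    rw [← Real.rpow_natCast, ← Real.rpow_mul hi.le]
    norm_num
  have ht4 : ∀ᶠ i in l, √(X i) = t i ^ 4 := by
    filter_upwards [ht8] with i hi
    rw [← hi, sqrt_pow_eight]
  have hne2 : J = 2 → ∀ i, b i + μ ≠ 0 := by
    rintro rfl i h
    apply hne i
    push_cast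
    linarith
  have hV0 : ∀ᶠ i in l, fermiLim J (Real.exp (-((2 * b i + μ * J) * β / (4 * √(X i))))) ≠ 0 := by
    filter_upwards [hXpos] with i hi
    refine fermiLim_ne_zero hJ2 (Real.exp_pos _).le fun h2 h1 => ?_
    have h3 := Real.exp_eq_one_iff _ |>.1 h1
    have hs : 0 < √(X i) := Real.sqrt_pos.2 hi
    have h4 : (2 * b i + μ * J) * β = 0 := by
      rw [neg_eq_zero, div_eq_zero_iff] at h3
      rcases h3 with h3 | h3
      · exact h3
      · linarith
    rcases mul_eq_zero.1 h4 with h5 | h5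
    · exact hne i (by linarith)
    · exact hβ.ne' h5
  -- Along an ultrafilter, compactness of [0,1] makes exp(-βb/(2√X)) converge with no assumption on
  -- the size of b. This is where uniformity in b comes from.
  rw [isEquivalent_iff_tendsto_one hV0, tendsto_iff_ultrafilter]
  intro U hU
  obtain ⟨q, hq, hqU⟩ := isCompact_Icc.ultrafilter_le_nhds
    (U.map fun i => Real.exp (-(β / (2 * t i ^ 4)) * b i)) (by
      rw [Ultrafilter.coe_map, le_principal_iff, mem_map]
      refine hU ?_
      filter_upwards [ht.eventually_gt_atTop 0] with i hi
      refine ⟨(Real.exp_pos _).le, Real.exp_le_one_iff.2 ?_⟩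
      have := hb i
      rw [neg_mul, neg_nonpos]
      positivity) (s := Set.Icc (0 : ℝ) 1)
  have hsepU : J = 2 → Tendsto (fun i => t i ^ 4 * |b i + μ|) U atTop := by
    intro h2
    have h3 := ((hsep h2).mono_left hU).const_mul_atTop (by norm_num : (0 : ℝ) < 1 / 2)
    refine h3.congr' ?_
    filter_upwards [hU ht4] with i hi
    have : |2 * b i + μ * J| = 2 * |b i + μ| := by
      rw [h2, show 2 * b i + μ * (2 : ℕ) = 2 * (b i + μ) by push_cast; ring, abs_mul]
      norm_num
    rw [hi, this]
    ring
  have hmain := (tendsto_altSum_div_fermiLim (α := fun i => (2 * b i + μ * J) * β / (4 * t i ^ 4))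
    hf ha hJ2 (ht.mono_left hU) hb (fun i => rfl) hne2 hsepU hqU hq.1 hq.2).div_const
    ((μ * β / 2) ^ J)
  have hc : (μ * β / 2) ^ J ≠ 0 := by positivity
  rw [div_self hc] at hmain
  refine hmain.congr' ?_
  filter_upwards [hU ht8, hU ht4, hU hXpos, hU (ht.eventually_gt_atTop 0)] with i h8 h4 hXi hti
  simp only [Pi.div_apply]
  have hXJ : X i ^ (-((J : ℝ) / 2)) = (t i ^ (4 * J))⁻¹ := by
    rw [← h8, ← Real.rpow_natCast (t i) 8, ← Real.rpow_mul hti.le, ← Real.rpow_natCast (t i) (4 * J),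
      ← Real.rpow_neg hti.le]
    congr 1
    push_cast; ring
  rw [hXJ, h4, h8]
  generalize (fwdDiff (1 : ℝ))^[J] (fun u : ℝ => altSum f a (b i + u * μ) (X i + b i)) 0 = S
  field_simp
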